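/- Let $A\subset\mathbb{Z}^d$ be a finite set with $\mathbb{Z}A=\mathbb{Z}^d$, let $\mathbb{N}A$ be the monoid generated by $A$, let $R_A=\mathbb{C}[\mathbb{N}A]$ be its semigroup algebra, and let $D(R_A)$ be the ring of ($\mathbb{C}$-linear, Grothendieck) differential operators of $R_A$, i.e. $D(R_A)=\bigcup_{k\ge 0}D^k(R_A)\subseteq \mathrm{End}_{\mathbb{C}}(R_A)$ with $D^0(R_A)=\mathrm{End}_{R_A}(R_A)$ and $D^{k+1}(R_A)=\{P : [f,P]\in D^k(R_A)\ \text{for all } f\in R_A\}$. For a face $\tau$ of the cone $\mathbb{R}_{\ge0}A$ (the cone itself included) and $\alpha\in\mathbb{C}^d$ put $$E_\tau(\alpha)=\{\lambda\in\mathbb{C}(A\cap\tau)/\mathbb{Z}(A\cap\tau) : \alpha-\lambda\in\mathbb{N}A+\mathbb{Z}(A\cap\tau)\}.$$ Write $\alpha\preceq\beta$ if $E_\tau(\alpha)\subseteq E_\tau(\beta)$ for all faces $\tau$, write $\alpha\sim\beta$ if $\alpha\preceq\beta$ and $\beta\preceq\alpha$, and let $[\alpha]$ be the equivalence class of $\alpha$.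 Let $\mathcal{F}$ be the set of facets (maximal proper faces) of $\mathbb{R}_{\ge0}A$. For $\sigma\in\mathcal{F}$ let $F_\sigma$ be its primitive integral support function: the unique linear form on $\mathbb{R}^d$ (extended to $\mathbb{C}^d$) that is nonnegative on $\mathbb{R}_{\ge0}A$, vanishes on $\sigma$, and satisfies $F_\sigma(\mathbb{Z}^d)=\mathbb{Z}$. Put $$\mathcal{F}_+(\alpha)=\{\sigma\in\mathcal{F} : F_\sigma(\alpha)\in F_\sigma(\mathbb{N}A)\},\qquad \mathcal{F}_-(\alpha)=\{\sigma\in\mathcal{F} : F_\sigma(\alpha)\in\mathbb{Z}\setminus F_\sigma(\mathbb{N}A)\},$$ $$\mathbb{R}_{>0}(\alpha)=\{\gamma\in\mathbb{R}^d : F_\sigma(\gamma)>0\ (\sigma\in\mathcal{F}_+(\alpha)),\ F_\sigma(\gamma)<0\ (\sigma\in\mathcal{F}_-(\alpha))\}.$$ Let $\mathrm{Face}(\alpha)$ be the set of faces $\tau$ such that $\alpha-\lambda\in\mathbb{Z}^d$ for some $\lambda\in\mathbb{C}(A\cap\tau)$ and such that every facet containing $\tau$ belongs to $\mathcal{F}_+(\alpha)$.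 The class $[\alpha]$ is called extreme if $E_\tau(\alpha)$ has exactly $[\mathbb{Q}(A\cap\tau)\cap\mathbb{Z}^d:\mathbb{Z}(A\cap\tau)]$ elements for every $\tau\in\mathrm{Face}(\alpha)$, and $E_\tau(\alpha)=\emptyset$ for every face $\tau\notin\mathrm{Face}(\alpha)$. (This does not depend on the representative $\alpha$.) Theorem. The algebra $D(R_A)$ is simple if and only if both of the following conditions hold: (C1) every equivalence class $[\alpha]$, $\alpha\in\mathbb{C}^d$, is extreme; (C2) for every $\alpha\in\mathbb{C}^d$, the set $\mathbb{R}_{>0}(\alpha)$ is nonempty. -/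

import Mathlib

namespace ToricDiff

noncomputable section

/-! ## Differential operators on a commutative algebra -/

section DiffOp

variable {S : Type*} [CommRing S] [Algebra ℂ S]

/-- The commutator `[f, P] = f P - P f` of the multiplication by `f` with `P`. -/
def commMul (f : S) (P : Module.End ℂ S) : Module.End ℂ S :=
  LinearMap.mulLeft ℂ f * P - P * LinearMap.mulLeft ℂ f

/-- `P ∈ Dᵏ(S)`: for `k = 0` the map `P` is `S`-linear, and `P ∈ Dᵏ⁺¹(S)` when
`[f, P] ∈ Dᵏ(S)` for all `f : S`. -/
def IsDiffOpOfOrder : ℕ → Module.End ℂ S → Prop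
  | 0, P => ∀ f g : S, P (f * g) = f * P g
  | k + 1, P => ∀ f : S, IsDiffOpOfOrder k (commMul f P)

theorem isDiffOpOfOrder_zero_iff {P : Module.End ℂ S} :
    IsDiffOpOfOrder 0 P ↔ ∀ f : S, commMul f P = 0 := by
  constructor
  · intro h f
    ext g
    simp [commMul, h f g]
  · intro h f g
    have := LinearMap.congr_fun (h f) g
    simp only [commMul, LinearMap.sub_apply, Module.End.mul_apply, LinearMap.mulLeft_apply,
      LinearMap.zero_apply] at this
    exact (sub_eq_zero.mp this).symm

theorem commMul_add (f : S) (P Q : Module.End ℂ S) :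
    commMul f (P + Q) = commMul f P + commMul f Q := by
  simp only [commMul, mul_add, add_mul]; abel

theorem commMul_mul (f : S) (P Q : Module.End ℂ S) :
    commMul f (P * Q) = commMul f P * Q + P * commMul f Q := by
  simp only [commMul, sub_mul, mul_sub, mul_assoc]; abel

theorem IsDiffOpOfOrder.zero (k : ℕ) : IsDiffOpOfOrder k (0 : Module.End ℂ S) := by
  induction k with
  | zero => intro f g; simp
  | succ k ih => intro f; simpa [commMul] using ih

theorem IsDiffOpOfOrder.add {k : ℕ} {P Q : Module.End ℂ S} (hP : IsDiffOpOfOrder k P)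
    (hQ : IsDiffOpOfOrder k Q) : IsDiffOpOfOrder k (P + Q) := by
  induction k generalizing P Q with
  | zero => intro f g; simp [hP f g, hQ f g, mul_add]
  | succ k ih => intro f; rw [commMul_add]; exact ih (hP f) (hQ f)

theorem IsDiffOpOfOrder.succ {k : ℕ} {P : Module.End ℂ S} (hP : IsDiffOpOfOrder k P) :
    IsDiffOpOfOrder (k + 1) P := by
  induction k generalizing P with
  | zero => intro f; rw [isDiffOpOfOrder_zero_iff.mp hP f]; exact .zero 0
  | succ k ih => intro f; exact ih (hP f)

theorem IsDiffOpOfOrder.mono {k l : ℕ} (h : k ≤ l) {P : Module.End ℂ S}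
    (hP : IsDiffOpOfOrder k P) : IsDiffOpOfOrder l P := by
  induction h with
  | refl => exact hP
  | step _ ih => exact ih.succ

theorem IsDiffOpOfOrder.mul {k l : ℕ} {P Q : Module.End ℂ S} (hP : IsDiffOpOfOrder k P)
    (hQ : IsDiffOpOfOrder l Q) : IsDiffOpOfOrder (k + l) (P * Q) := by
  induction hn : k + l generalizing k l P Q with
  | zero =>
    obtain ⟨rfl, rfl⟩ : k = 0 ∧ l = 0 := by omega
    intro f g
    simp [hQ f g, hP f (Q g)]
  | succ n ih =>
    intro f
    rw [commMul_mul]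
    refine .add ?_ ?_
    · cases k with
      | zero => rw [isDiffOpOfOrder_zero_iff.mp hP f, zero_mul]; exact .zero n
      | succ k => exact ih (hP f) hQ (by omega)
    · cases l with
      | zero => rw [isDiffOpOfOrder_zero_iff.mp hQ f, mul_zero]; exact .zero n
      | succ l => exact ih hP (hQ f) (by omega)

variable (S) in
/-- The `ℂ`-algebra `D(S) = ⋃ₖ Dᵏ(S)` of differential operators of the commutative
`ℂ`-algebra `S`, with composition as product. -/
def diffOps : Subalgebra ℂ (Module.End ℂ S) where
  carrier := {P | ∃ k, IsDiffOpOfOrder k P}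
  mul_mem' := by
    rintro P Q ⟨k, hP⟩ ⟨l, hQ⟩
    exact ⟨k + l, hP.mul hQ⟩
  add_mem' := by
    rintro P Q ⟨k, hP⟩ ⟨l, hQ⟩
    exact ⟨max k l, (hP.mono (le_max_left k l)).add (hQ.mono (le_max_right k l))⟩
  algebraMap_mem' := by
    intro c
    exact ⟨0, fun f g => by simp [Module.algebraMap_end_apply]⟩

end DiffOp

/-! ## The semigroup, its cone, faces and facets -/

variable {d : ℕ}

/-- The coordinatewise inclusion `ℤᵈ → Kᵈ`. -/
def castVec (K : Type*) [Ring K] : (Fin d → ℤ) →+ (Fin d → K) where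
  toFun a i := (a i : K)
  map_zero' := by ext; simp
  map_add' a b := by ext; simp

/-- The monoid `ℕA ⊆ ℤᵈ`. -/
abbrev semigp (A : Finset (Fin d → ℤ)) : AddSubmonoid (Fin d → ℤ) :=
  AddSubmonoid.closure (A : Set (Fin d → ℤ))

/-- The semigroup algebra `R_A = ℂ[ℕA]`. -/
abbrev semigpAlgebra (A : Finset (Fin d → ℤ)) : Type := AddMonoidAlgebra ℂ (semigp A)

/-- The cone `ℝ_{≥0}A ⊆ ℝᵈ`. -/
def cone (A : Finset (Fin d → ℤ)) : PointedCone ℝ (Fin d → ℝ) :=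
  PointedCone.hull ℝ (castVec ℝ '' (A : Set (Fin d → ℤ)))

/-- `τ` is a face of the cone `ℝ_{≥0}A` (the cone itself is one of its faces). -/
def IsFace (A : Finset (Fin d → ℤ)) (τ : PointedCone ℝ (Fin d → ℝ)) : Prop :=
  τ.IsFaceOf (cone A)

/-- The set `𝓕` of facets, i.e. maximal proper faces, of the cone `ℝ_{≥0}A`. -/
def facets (A : Finset (Fin d → ℤ)) : Set (PointedCone ℝ (Fin d → ℝ)) :=
  {σ | Maximal (fun τ => IsFace A τ ∧ τ ≠ cone A) σ}

/-- The linear form on `Kᵈ` with integer coefficients `c`. -/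
def linForm (c : Fin d → ℤ) {K : Type*} [Ring K] (x : Fin d → K) : K :=
  ∑ i, (c i : K) * x i

/-- `c` is the coefficient vector of a primitive integral support function of `σ`: the form is
nonnegative on the cone, zero on `σ`, and maps `ℤᵈ` onto `ℤ`. (A linear form on `ℝᵈ` that maps
`ℤᵈ` into `ℤ` has integer coefficients.) -/
structure IsPrimitiveSupport (A : Finset (Fin d → ℤ)) (σ : PointedCone ℝ (Fin d → ℝ))
    (c : Fin d → ℤ) : Prop where
  nonneg : ∀ x ∈ cone A, 0 ≤ linForm c x
  zero : ∀ x ∈ σ, linForm c x = 0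
  surj : ∀ m : ℤ, ∃ a : Fin d → ℤ, linForm c a = m

open Classical in
/-- The coefficient vector of the primitive integral support function `F_σ` of a facet `σ`.
When `ℤA = ℤᵈ`, exactly one vector `c` satisfies `IsPrimitiveSupport A σ c` for each facet `σ`;
the value `0` is a default that is not used for facets. -/
def supportCoeff (A : Finset (Fin d → ℤ)) (σ : PointedCone ℝ (Fin d → ℝ)) : Fin d → ℤ :=
  if h : ∃ c, IsPrimitiveSupport A σ c then h.choose else 0

/-- The primitive integral support function `F_σ`, as a linear form on `Kᵈ`
(used for `K = ℤ, ℝ, ℂ`). -/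
def supportFn (A : Finset (Fin d → ℤ)) (σ : PointedCone ℝ (Fin d → ℝ)) {K : Type*} [Ring K]
    (x : Fin d → K) : K :=
  linForm (supportCoeff A σ) x

/-! ## The sets `E_τ(α)` and the equivalence relation on parameters -/

/-- `A ∩ τ`. -/
def onFace (A : Finset (Fin d → ℤ)) (τ : PointedCone ℝ (Fin d → ℝ)) : Set (Fin d → ℤ) :=
  {a | a ∈ A ∧ castVec ℝ a ∈ τ}

/-- `ℤ(A ∩ τ)`, as a subgroup of `ℤᵈ`. -/
def faceLattice (A : Finset (Fin d → ℤ)) (τ : PointedCone ℝ (Fin d → ℝ)) :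
    AddSubgroup (Fin d → ℤ) :=
  AddSubgroup.closure (onFace A τ)

/-- `ℤ(A ∩ τ)`, as a subgroup of `ℂᵈ`. -/
def faceLatticeC (A : Finset (Fin d → ℤ)) (τ : PointedCone ℝ (Fin d → ℝ)) :
    AddSubgroup (Fin d → ℂ) :=
  (faceLattice A τ).map (castVec ℂ)

/-- `ℂ(A ∩ τ)`. -/
def faceSpanC (A : Finset (Fin d → ℤ)) (τ : PointedCone ℝ (Fin d → ℝ)) :
    Submodule ℂ (Fin d → ℂ) :=
  Submodule.span ℂ (castVec ℂ '' onFace A τ)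

/-- `ℚ(A ∩ τ) ∩ ℤᵈ`. -/
def saturatedFaceLattice (A : Finset (Fin d → ℤ)) (τ : PointedCone ℝ (Fin d → ℝ)) :
    AddSubgroup (Fin d → ℤ) :=
  (Submodule.span ℚ (castVec ℚ '' onFace A τ)).toAddSubgroup.comap (castVec ℚ)

/-- The index `[ℚ(A ∩ τ) ∩ ℤᵈ : ℤ(A ∩ τ)]`. -/
def faceIndex (A : Finset (Fin d → ℤ)) (τ : PointedCone ℝ (Fin d → ℝ)) : ℕ :=
  (faceLattice A τ).relIndex (saturatedFaceLattice A τ)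

/-- `E_τ(α) = {λ ∈ ℂ(A ∩ τ) / ℤ(A ∩ τ) : α - λ ∈ ℕA + ℤ(A ∩ τ)}`, where the quotient
`ℂ(A ∩ τ) / ℤ(A ∩ τ)` is regarded as a subset of `ℂᵈ / ℤ(A ∩ τ)`. -/
def E (A : Finset (Fin d → ℤ)) (τ : PointedCone ℝ (Fin d → ℝ)) (α : Fin d → ℂ) :
    Set ((Fin d → ℂ) ⧸ faceLatticeC A τ) :=
  QuotientAddGroup.mk ''
    {l | l ∈ faceSpanC A τ ∧
      ∃ b ∈ semigp A, ∃ z ∈ faceLatticeC A τ, α - l = castVec ℂ b + z}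

/-- The preorder `α ⪯ β`: `E_τ(α) ⊆ E_τ(β)` for all faces `τ`. -/
def Prec (A : Finset (Fin d → ℤ)) (α β : Fin d → ℂ) : Prop :=
  ∀ τ, IsFace A τ → E A τ α ⊆ E A τ β

/-- The equivalence relation `α ∼ β` on `ℂᵈ`: `α ⪯ β` and `β ⪯ α`. -/
def paramSetoid (A : Finset (Fin d → ℤ)) : Setoid (Fin d → ℂ) where
  r α β := Prec A α β ∧ Prec A β α
  iseqv :=
    { refl := fun _ => ⟨fun _ _ => subset_rfl, fun _ _ => subset_rfl⟩
      symm := fun h => ⟨h.2, h.1⟩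
      trans := fun h h' => ⟨fun τ hτ => (h.1 τ hτ).trans (h'.1 τ hτ),
        fun τ hτ => (h'.2 τ hτ).trans (h.2 τ hτ)⟩ }

/-! ## The two conditions -/

/-- `𝓕₊(α)`: the facets `σ` with `F_σ(α) ∈ F_σ(ℕA)`. -/
def facetsPos (A : Finset (Fin d → ℤ)) (α : Fin d → ℂ) : Set (PointedCone ℝ (Fin d → ℝ)) :=
  {σ | σ ∈ facets A ∧ ∃ b ∈ semigp A, supportFn A σ α = ((supportFn A σ b : ℤ) : ℂ)}

/-- `𝓕₋(α)`: the facets `σ` with `F_σ(α) ∈ ℤ ∖ F_σ(ℕA)`. -/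
def facetsNeg (A : Finset (Fin d → ℤ)) (α : Fin d → ℂ) : Set (PointedCone ℝ (Fin d → ℝ)) :=
  {σ | σ ∈ facets A ∧ (∃ m : ℤ, supportFn A σ α = (m : ℂ)) ∧
    ¬ ∃ b ∈ semigp A, supportFn A σ α = ((supportFn A σ b : ℤ) : ℂ)}

/-- `ℝ_{>0}(α)`: the `γ ∈ ℝᵈ` with `F_σ(γ) > 0` for `σ ∈ 𝓕₊(α)` and `F_σ(γ) < 0` for
`σ ∈ 𝓕₋(α)`. -/
def openCone (A : Finset (Fin d → ℤ)) (α : Fin d → ℂ) : Set (Fin d → ℝ) :=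
  {γ | (∀ σ ∈ facetsPos A α, 0 < supportFn A σ γ) ∧
    (∀ σ ∈ facetsNeg A α, supportFn A σ γ < 0)}

/-- `Face(α)`: the faces `τ` such that `α - λ ∈ ℤᵈ` for some `λ ∈ ℂ(A ∩ τ)`, and such that every
facet containing `τ` belongs to `𝓕₊(α)`. -/
def faceSet (A : Finset (Fin d → ℤ)) (α : Fin d → ℂ) : Set (PointedCone ℝ (Fin d → ℝ)) :=
  {τ | IsFace A τ ∧
    (∃ l ∈ faceSpanC A τ, ∃ a : Fin d → ℤ, α - l = castVec ℂ a) ∧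
    ∀ σ ∈ facets A, τ ≤ σ → σ ∈ facetsPos A α}

/-- An equivalence class `[α]` is extreme if `E_τ(α)` has exactly `[ℚ(A ∩ τ) ∩ ℤᵈ : ℤ(A ∩ τ)]`
elements for every `τ ∈ Face(α)`, and is empty for every face `τ ∉ Face(α)`. (The condition is
the same for all representatives `α` of the class.) -/
def IsExtremeClass (A : Finset (Fin d → ℤ)) (C : Quotient (paramSetoid A)) : Prop :=
  ∀ α : Fin d → ℂ, Quotient.mk (paramSetoid A) α = C →
    (∀ τ ∈ faceSet A α, (E A τ α).encard = (faceIndex A τ : ℕ∞)) ∧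
    (∀ τ, IsFace A τ → τ ∉ faceSet A α → E A τ α = ∅)

end

end ToricDiff

/-! Both sides are equivalent to a third condition: every equivalence class is Zariski dense in `ℂᵈ`
(`ClassIsZariskiDense`).

The link between the algebra and the preorder is the grading of `D(R_A)`. An operator has finitely
many homogeneous components `tᵇ ↦ f(b) tᵇ⁺ᵉ`, where `f` is a polynomial vanishing on the gap of
those `b ∈ ℕA` with `b + e ∉ ℕA`. By `VanishesOnGap.prec` and `exists_vanishesOnGap_of_prec`, some
such `f` is nonzero at `α` exactly when `α ⪯ α + e`.

Density gives simplicity (`isSimpleRing_of_dense`): commutators push a nonzero ideal down to a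
monomial and then to a nonzero polynomial `p` in degree 0. If the ideal were proper, its degree-0
part would vanish at some `α`. By density `p(β) ≠ 0` for some `β ∼ α`, and moving from `α` to `β`,
applying `p` and moving back gives an element of the ideal that is nonzero at `α`. Simplicity gives
density (`dense_of_isSimpleRing`): the operators that act by zero within one class form a proper
ideal, which contains every polynomial vanishing on that class.

The combinatorial half is `conditions_iff_forall_dense`. A dense class has points `α + x` with every
`|F_σ(x)|` large. Belonging to the class then forces the signs of `F_σ(x)` on `𝓕₊(α)` and `𝓕₋(α)`,
and a conductor argument makes the sets `E_τ(α)` as large as possible. Conversely, for an extreme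
class, far translates along an integral point of `ℝ_{>0}(α)` stay in the class, and they are dense.
-/

namespace ToricDiff

open PointedCone

/-! ### Farkas' lemma and facet functionals over an ordered field -/

section Farkas

variable {ι K V : Type*} [Field K] [LinearOrder K] [IsStrictOrderedRing K] [AddCommGroup V]
  [Module K V]

theorem farkas (S : Finset ι) (v : ι → V) (x : V) :
    (∃ c : ι → K, (∀ i, 0 ≤ c i) ∧ x = ∑ i ∈ S, c i • v i) ∨
      ∃ φ : V →ₗ[K] K, (∀ i ∈ S, 0 ≤ φ (v i)) ∧ φ x < 0 := by
  classical
  induction S using Finset.induction_on generalizing v x with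
  | empty =>
    by_cases hx : x = 0
    · exact .inl ⟨0, fun _ => le_rfl, by simpa using hx⟩
    · obtain ⟨φ, hφ, -⟩ := Submodule.exists_le_ker_of_notMem (p := (⊥ : Submodule K V)) (v := x)
        (by simpa using hx)
      right
      rcases lt_or_gt_of_ne hφ with h | h
      · exact ⟨φ, by simp, h⟩
      · exact ⟨-φ, by simp, by simpa using h⟩
  | insert a S ha ih =>
    rcases ih v x with ⟨c, hc, hx⟩ | ⟨φ, hφ, hφx⟩
    · refine .inl ⟨Function.update c a 0, fun i => ?_, ?_⟩
      · by_cases h : i = a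
        · subst h; simp
        · simpa [h] using hc i
      · rw [Finset.sum_insert ha, hx]
        simp only [Function.update_self, zero_smul, zero_add]
        refine Finset.sum_congr rfl fun i hi => ?_
        rw [Function.update_of_ne (by rintro rfl; exact ha hi)]
    · rcases le_or_gt 0 (φ (v a)) with h0 | h0
      · exact .inr ⟨φ, by simpa [h0] using hφ, hφx⟩
      · let p : V →ₗ[K] V := LinearMap.id - (φ.smulRight ((φ (v a))⁻¹ • v a))
        have hp : ∀ y, p y = y - (φ y * (φ (v a))⁻¹) • v a := fun y => by
          simp [p, smul_smul]
        rcases ih (fun i => p (v i)) (p x) with ⟨c, hc, hx⟩ | ⟨ψ, hψ, hψx⟩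
        · left
          have hinv : (φ (v a))⁻¹ < 0 := inv_lt_zero.mpr h0
          refine ⟨Function.update c a
            (φ x * (φ (v a))⁻¹ + ∑ i ∈ S, c i * (φ (v i) * -(φ (v a))⁻¹)), fun i => ?_, ?_⟩
          · by_cases h : i = a
            · subst h
              simp only [Function.update_self]
              refine add_nonneg (mul_nonneg_of_nonpos_of_nonpos hφx.le hinv.le)
                (Finset.sum_nonneg fun j hj => mul_nonneg (hc j)
                  (mul_nonneg (hφ j hj) (by linarith)))
            · simpa [h] using hc i
          · rw [Finset.sum_insert ha]
            have h1 : ∑ i ∈ S, Function.update c a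
                (φ x * (φ (v a))⁻¹ + ∑ i ∈ S, c i * (φ (v i) * -(φ (v a))⁻¹)) i • v i
                = ∑ i ∈ S, c i • v i := by
              refine Finset.sum_congr rfl fun i hi => ?_
              rw [Function.update_of_ne (by rintro rfl; exact ha hi)]
            rw [h1]
            simp only [Function.update_self]
            have h2 : x = p x + (φ x * (φ (v a))⁻¹) • v a := by rw [hp]; abel
            rw [h2, hx]
            simp only [hp, smul_sub, Finset.sum_sub_distrib, add_smul, Finset.sum_smul, smul_smul]
            have h3 : ∀ i, (c i * (φ (v i) * -(φ (v a))⁻¹)) • v a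
                = -((c i * (φ (v i) * (φ (v a))⁻¹)) • v a) := fun i => by
              rw [← neg_smul]; congr 1; ring
            simp only [h3, Finset.sum_neg_distrib]
            have h4 : φ (∑ i ∈ S, c i • v i - ∑ i ∈ S, (c i * (φ (v i) * (φ (v a))⁻¹)) • v a
                + (φ x * (φ (v a))⁻¹) • v a) = φ x := by
              conv_rhs => rw [h2, hx]
              simp only [hp, smul_sub, Finset.sum_sub_distrib, smul_smul]
            rw [h4]
            abel
        · refine .inr ⟨ψ ∘ₗ p, ?_, hψx⟩
          intro i hi
          rcases Finset.mem_insert.mp hi with rfl | hi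
          · simp [hp, mul_inv_cancel₀ h0.ne]
          · exact hψ i hi

/-- Choose a separating functional vanishing on as many `v i` as possible. If these did not span its
kernel, it could be tilted, with its value at `x` fixed, until one more vector became tight. -/
theorem exists_tight_functional (S : Finset ι) (v : ι → V) (x : V)
    (hS : Submodule.span K (v '' S) = ⊤) (φ₀ : V →ₗ[K] K) (hφ₀ : ∀ i ∈ S, 0 ≤ φ₀ (v i))
    (hx₀ : φ₀ x < 0) :
    ∃ φ : V →ₗ[K] K, (∀ i ∈ S, 0 ≤ φ (v i)) ∧ φ x < 0 ∧
      ∀ y, φ y = 0 → y ∈ Submodule.span K (v '' {i | i ∈ S ∧ φ (v i) = 0}) := by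
  classical
  obtain ⟨φ, ⟨hφ, hx⟩, hmax⟩ : ∃ φ : V →ₗ[K] K, ((∀ i ∈ S, 0 ≤ φ (v i)) ∧ φ x < 0) ∧
      ∀ ψ : V →ₗ[K] K, ((∀ i ∈ S, 0 ≤ ψ (v i)) ∧ ψ x < 0) →
        (S.filter (fun i => ψ (v i) = 0)).card ≤ (S.filter (fun i => φ (v i) = 0)).card := by
    let N : Set ℕ := {n | ∃ φ : V →ₗ[K] K, ((∀ i ∈ S, 0 ≤ φ (v i)) ∧ φ x < 0) ∧
      (S.filter (fun i => φ (v i) = 0)).card = n}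
    have hne : N.Nonempty := ⟨_, φ₀, ⟨hφ₀, hx₀⟩, rfl⟩
    have hbd : BddAbove N := ⟨S.card, by
      rintro n ⟨φ, -, rfl⟩; exact Finset.card_filter_le _ _⟩
    obtain ⟨φ, h, hc⟩ := Nat.sSup_mem hne hbd
    exact ⟨φ, h, fun ψ hψ => hc ▸ le_csSup hbd ⟨ψ, hψ, rfl⟩⟩
  refine ⟨φ, hφ, hx, fun y hy => ?_⟩
  by_contra hyT
  obtain ⟨ψ, hψy, hψT⟩ := Submodule.exists_le_ker_of_notMem hyT
  obtain ⟨χ, hχT, hχx, j, hj, hχj⟩ : ∃ χ : V →ₗ[K] K, (∀ i ∈ S, φ (v i) = 0 → χ (v i) = 0) ∧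
      χ x = 0 ∧ ∃ j ∈ S, χ (v j) < 0 := by
    -- The multiple of `φ` is chosen so that `χ x = 0`; adding multiples of `χ` then keeps the value
    -- at `x` negative.
    let χ : V →ₗ[K] K := ψ - (ψ x * (φ x)⁻¹) • φ
    have hχT : ∀ i ∈ S, φ (v i) = 0 → χ (v i) = 0 := fun i hi h => by
      have : ψ (v i) = 0 := hψT (Submodule.subset_span ⟨i, ⟨hi, h⟩, rfl⟩)
      simp [χ, h, this]
    have hχx : χ x = 0 := by simp [χ, mul_assoc, inv_mul_cancel₀ hx.ne]
    have hχy : χ y ≠ 0 := by simpa [χ, hy] using hψy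
    obtain ⟨j, hj, hχj⟩ : ∃ j ∈ S, χ (v j) ≠ 0 := by
      by_contra! h
      have : (⊤ : Submodule K V) ≤ LinearMap.ker χ := by
        rw [← hS, Submodule.span_le]
        rintro _ ⟨i, hi, rfl⟩
        exact h i hi
      exact hχy (this (Submodule.mem_top (x := y)))
    rcases lt_or_gt_of_ne hχj with h | h
    · exact ⟨χ, hχT, hχx, j, hj, h⟩
    · exact ⟨-χ, fun i hi h => by simp [hχT i hi h], by simp [hχx], j, hj, by simpa using h⟩
  obtain ⟨k, hk, hmin⟩ := Finset.exists_min_image (S.filter (fun i => χ (v i) < 0))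
    (fun i => φ (v i) / -χ (v i)) ⟨j, by simp [hj, hχj]⟩
  obtain ⟨hkS, hχk⟩ := Finset.mem_filter.mp hk
  -- The first time at which some `φ + t • χ` acquires a new zero among the `v i`; by minimality all
  -- other values are still nonnegative.
  set t := φ (v k) / -χ (v k) with ht
  have ht0 : 0 ≤ t := div_nonneg (hφ k hkS) (by linarith)
  have htk : φ (v k) + t * χ (v k) = 0 := by
    rw [ht]; field_simp [hχk.ne]; ring
  have hle := hmax (φ + t • χ) ⟨fun i hi => ?_, by simpa [hχx] using hx⟩
  · refine absurd hle (not_le.mpr (Finset.card_lt_card ?_))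
    refine Finset.ssubset_iff_of_subset (fun i hi => ?_) |>.mpr ⟨k, ?_, ?_⟩
    · obtain ⟨hi, h⟩ := Finset.mem_filter.mp hi
      simp [hi, h, hχT i hi h]
    · simpa [hkS] using htk
    · simp only [Finset.mem_filter, not_and]
      exact fun _ h => hχk.ne (hχT k hkS h)
  · simp only [LinearMap.add_apply, LinearMap.smul_apply, smul_eq_mul]
    rcases lt_or_ge (χ (v i)) 0 with h | h
    · have := hmin i (by simp [hi, h])
      rw [le_div_iff₀ (by linarith)] at this
      linarith
    · exact add_nonneg (hφ i hi) (mul_nonneg ht0 h)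

end Farkas

/-! ### Integral linear forms -/

variable {d : ℕ}

@[simp] theorem castVec_apply (K : Type*) [Ring K] (a : Fin d → ℤ) (i : Fin d) :
    castVec K a i = (a i : K) := rfl

theorem castVec_injective (K : Type*) [Ring K] [CharZero K] :
    Function.Injective (castVec K : (Fin d → ℤ) → (Fin d → K)) := fun a b h => by
  ext i; simpa using congrFun h i

section LinForm

variable {K : Type*} [Ring K] (c : Fin d → ℤ)

theorem linForm_castVec (a : Fin d → ℤ) : linForm c (castVec K a) = ((linForm c a : ℤ) : K) := by
  simp [linForm]

theorem linForm_add (x y : Fin d → K) : linForm c (x + y) = linForm c x + linForm c y := by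
  simp [linForm, mul_add, Finset.sum_add_distrib]

theorem linForm_neg (x : Fin d → K) : linForm c (-x) = -linForm c x := by
  simp [linForm]

theorem linForm_sub (x y : Fin d → K) : linForm c (x - y) = linForm c x - linForm c y := by
  rw [sub_eq_add_neg, linForm_add, linForm_neg, sub_eq_add_neg]

theorem linForm_smul {K : Type*} [CommRing K] (r : K) (x : Fin d → K) :
    linForm c (r • x) = r * linForm c x := by
  simp [linForm, Finset.mul_sum, mul_left_comm]

/-- `linForm c` as a linear map. -/
def linFormₗ (K : Type*) [CommRing K] (c : Fin d → ℤ) : (Fin d → K) →ₗ[K] K where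
  toFun := linForm c
  map_add' := linForm_add c
  map_smul' := linForm_smul c

@[simp] theorem linFormₗ_apply {K : Type*} [CommRing K] (x : Fin d → K) :
    linFormₗ K c x = linForm c x := rfl

end LinForm

/-- Clear denominators, then divide by the generator of the image of `ℤᵈ`; the sign goes into `c` so
that `k` is positive. -/
theorem exists_primitive_form (φ : (Fin d → ℚ) →ₗ[ℚ] ℚ) (hφ : φ ≠ 0) :
    ∃ (k : ℚ) (c : Fin d → ℤ), 0 < k ∧ (∀ x, φ x = k * linForm c x) ∧
      ∀ m : ℤ, ∃ a : Fin d → ℤ, linForm c a = m := by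
  obtain ⟨D, hD⟩ := IsLocalization.exist_integer_multiples_of_finset (nonZeroDivisors ℤ)
    (Finset.univ.image fun i : Fin d => φ (Pi.single i 1))
  have hD0 : ((D : ℤ) : ℚ) ≠ 0 := by exact_mod_cast nonZeroDivisors.ne_zero D.2
  have hn : ∀ i : Fin d, ∃ n : ℤ, (n : ℚ) = (D : ℤ) * φ (Pi.single i 1) := fun i => by
    obtain ⟨n, hn⟩ := hD _ (Finset.mem_image_of_mem _ (Finset.mem_univ i))
    exact ⟨n, by simpa using hn⟩
  choose n hn using hn
  have hφn : ∀ x, φ x = ((D : ℤ) : ℚ)⁻¹ * linForm n x := fun x => by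
    rw [LinearMap.pi_apply_eq_sum_univ φ x, linForm, Finset.mul_sum]
    refine Finset.sum_congr rfl fun i _ => ?_
    have : (fun j => if i = j then (1 : ℚ) else 0) = Pi.single i 1 := by
      ext j; simp [Pi.single_apply, eq_comm]
    rw [hn i, smul_eq_mul, this]
    field_simp
  obtain ⟨g, hg⟩ := Int.subgroup_cyclic
    (linFormₗ ℤ n).toAddMonoidHom.range
  rw [← AddSubgroup.zmultiples_eq_closure] at hg
  have hgmem : g ∈ (linFormₗ ℤ n).toAddMonoidHom.range := hg ▸ AddSubgroup.mem_zmultiples g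
  obtain ⟨b, hb⟩ := hgmem
  have hb : linForm n b = g := hb
  have hdvd : ∀ i, ∃ c : ℤ, n i = g * c := fun i => by
    have : n i ∈ (linFormₗ ℤ n).toAddMonoidHom.range :=
      ⟨Pi.single i 1, by simp [linForm, Pi.single_apply]⟩
    rw [hg] at this
    obtain ⟨c, hc⟩ := AddSubgroup.mem_zmultiples_iff.mp this
    exact ⟨c, by rw [← hc]; simp [mul_comm]⟩
  choose c hc using hdvd
  have hnc : ∀ {K : Type} [CommRing K] (x : Fin d → K), linForm n x = g * linForm c x := by
    intro K _ x
    simp [linForm, hc, Finset.mul_sum, mul_assoc]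
  have hg0 : g ≠ 0 := by
    rintro rfl
    refine hφ (LinearMap.ext fun x => ?_)
    rw [hφn, hnc]; simp
  have hcb : linForm c b = 1 := by
    have := hnc b
    rw [hb] at this
    simpa [hg0] using this
  have hk0 : (((D : ℤ) : ℚ)⁻¹ * g) ≠ 0 := mul_ne_zero (inv_ne_zero hD0) (by exact_mod_cast hg0)
  have hform : ∀ x, φ x = (((D : ℤ) : ℚ)⁻¹ * g) * linForm c x := fun x => by
    rw [hφn, hnc]; simp [mul_assoc]
  rcases lt_or_gt_of_ne hk0 with h | h
  · refine ⟨-(((D : ℤ) : ℚ)⁻¹ * g), -c, by linarith, fun x => ?_, fun m => ⟨-(m • b), ?_⟩⟩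
    · rw [hform]; simp [linForm]
    · have : linForm (-c) (-(m • b)) = m * linForm c b := by
        simp [linForm, Finset.mul_sum, mul_left_comm]
      rw [this, hcb, mul_one]
  · refine ⟨_, c, h, hform, fun m => ⟨m • b, ?_⟩⟩
    rw [linForm_smul, hcb, mul_one]

end ToricDiff

/-! ### The cone, its lattice points and its faces -/

namespace ToricDiff

open PointedCone

variable {d : ℕ}

/-- Farkas over `ℚ`, sharpened to a tight functional and rescaled to a primitive one: a point
outside the cone violates a facet inequality. -/
theorem exists_support_form (S : Finset (Fin d → ℤ))
    (hS : AddSubgroup.closure (S : Set (Fin d → ℤ)) = ⊤) (x : Fin d → ℤ) :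
    (∃ q : (Fin d → ℤ) → ℚ, (∀ a, 0 ≤ q a) ∧ castVec ℚ x = ∑ a ∈ S, q a • castVec ℚ a) ∨
    ∃ c : Fin d → ℤ, (∀ m : ℤ, ∃ a : Fin d → ℤ, linForm c a = m) ∧ (∀ a ∈ S, 0 ≤ linForm c a) ∧
      linForm c x < 0 ∧ ∀ y : Fin d → ℚ, linForm c y = 0 →
        y ∈ Submodule.span ℚ (castVec ℚ '' {a | a ∈ S ∧ linForm c a = 0}) := by
  rcases farkas (K := ℚ) S (castVec ℚ) (castVec ℚ x) with h | ⟨φ₀, h0, hx0⟩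
  · exact .inl h
  right
  have hspan : Submodule.span ℚ (castVec ℚ '' (S : Set (Fin d → ℤ))) = ⊤ := by
    have h1 : ∀ a : Fin d → ℤ, castVec ℚ a ∈ Submodule.span ℚ (castVec ℚ '' (S : Set _)) := by
      intro a
      have ha : a ∈ AddSubgroup.closure (S : Set (Fin d → ℤ)) := by rw [hS]; trivial
      have : AddSubgroup.closure (S : Set (Fin d → ℤ)) ≤
          (Submodule.span ℚ (castVec ℚ '' (S : Set (Fin d → ℤ)))).toAddSubgroup.comap
            (castVec ℚ) :=
        (AddSubgroup.closure_le _).mpr fun b hb => Submodule.subset_span ⟨b, hb, rfl⟩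
      exact this ha
    rw [eq_top_iff, ← (Pi.basisFun ℚ (Fin d)).span_eq, Submodule.span_le]
    rintro _ ⟨i, rfl⟩
    convert! h1 (Pi.single i 1) using 1
    ext j
    simp [Pi.single_apply]
  obtain ⟨φ, hφ, hx, hker⟩ := exists_tight_functional S (castVec ℚ) (castVec ℚ x) hspan φ₀ h0 hx0
  obtain ⟨k, c, hk, hkc, hsurj⟩ := exists_primitive_form φ (by rintro rfl; simp at hx)
  have hval : ∀ a : Fin d → ℤ, φ (castVec ℚ a) = k * (linForm c a : ℤ) := fun a => by
    rw [hkc, linForm_castVec]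
  refine ⟨c, hsurj, fun a ha => ?_, ?_, fun y hy => ?_⟩
  · have := hφ a ha
    rw [hval] at this
    exact_mod_cast nonneg_of_mul_nonneg_right this hk
  · rw [hval] at hx
    exact_mod_cast neg_of_mul_neg_right hx hk.le
  · have := hker y (by rw [hkc, hy, mul_zero])
    convert! this using 5 with a
    rw [hval]
    simp [hk.ne']

theorem mem_hull_image_iff (S : Finset (Fin d → ℤ)) (x : Fin d → ℝ) :
    x ∈ hull ℝ (castVec ℝ '' (S : Set (Fin d → ℤ))) ↔
      ∃ c : (Fin d → ℤ) → ℝ, (∀ a, 0 ≤ c a) ∧ x = ∑ a ∈ S, c a • castVec ℝ a := by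
  classical
  constructor
  · intro hx
    induction hx using Submodule.span_induction with
    | mem x hx =>
      obtain ⟨a, ha, rfl⟩ := hx
      refine ⟨fun b => if b = a then 1 else 0, fun b => by positivity, ?_⟩
      have ha : a ∈ S := ha
      simp [ite_smul, ha]
    | zero => exact ⟨0, fun _ => le_rfl, by simp⟩
    | add x y _ _ hx hy =>
      obtain ⟨c, hc, rfl⟩ := hx
      obtain ⟨e, he, rfl⟩ := hy
      exact ⟨c + e, fun a => add_nonneg (hc a) (he a), by
        simp [add_smul, Finset.sum_add_distrib]⟩
    | smul r x _ hx =>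
      obtain ⟨c, hc, rfl⟩ := hx
      refine ⟨fun a => r * c a, fun a => mul_nonneg r.2 (hc a), ?_⟩
      rw [Finset.smul_sum]
      refine Finset.sum_congr rfl fun a _ => ?_
      rw [mul_smul]; rfl
  · rintro ⟨c, hc, rfl⟩
    exact Submodule.sum_mem _ fun a ha =>
      PointedCone.smul_mem _ (hc a) (subset_hull ⟨a, ha, rfl⟩)

theorem mem_cone_iff {A : Finset (Fin d → ℤ)} {x : Fin d → ℝ} :
    x ∈ cone A ↔ ∃ c : (Fin d → ℤ) → ℝ, (∀ a, 0 ≤ c a) ∧ x = ∑ a ∈ A, c a • castVec ℝ a :=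
  mem_hull_image_iff A x

theorem castVec_mem_cone {A : Finset (Fin d → ℤ)} {a : Fin d → ℤ} (ha : a ∈ A) :
    castVec ℝ a ∈ cone A := subset_hull ⟨a, ha, rfl⟩

theorem castVec_mem_cone_of_mem_semigp {A : Finset (Fin d → ℤ)} {a : Fin d → ℤ}
    (ha : a ∈ semigp A) : castVec ℝ a ∈ cone A := by
  have : semigp A ≤ (cone A).toAddSubmonoid.comap (castVec ℝ) :=
    AddSubmonoid.closure_le.mpr fun a ha => castVec_mem_cone ha
  exact this ha

theorem mem_cone_of_rat {A : Finset (Fin d → ℤ)} {x : Fin d → ℤ} {q : (Fin d → ℤ) → ℚ}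
    (hq : ∀ a, 0 ≤ q a) (hx : castVec ℚ x = ∑ a ∈ A, q a • castVec ℚ a) :
    castVec ℝ x ∈ cone A := by
  refine mem_cone_iff.mpr ⟨fun a => (q a : ℝ), fun a => Rat.cast_nonneg.mpr (hq a), ?_⟩
  ext i
  have := congrFun hx i
  simp only [castVec_apply, Finset.sum_apply, Pi.smul_apply, smul_eq_mul] at this ⊢
  exact_mod_cast congrArg (Rat.cast : ℚ → ℝ) this

theorem linForm_nonneg_on_cone {A : Finset (Fin d → ℤ)} {c : Fin d → ℤ}
    (h : ∀ a ∈ A, 0 ≤ linForm c a) {x : Fin d → ℝ} (hx : x ∈ cone A) : 0 ≤ linForm c x := by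
  obtain ⟨r, hr, rfl⟩ := mem_cone_iff.mp hx
  rw [← linFormₗ_apply, map_sum]
  refine Finset.sum_nonneg fun a ha => ?_
  rw [map_smul, linFormₗ_apply, linForm_castVec, smul_eq_mul]
  exact mul_nonneg (hr a) (by exact_mod_cast h a ha)

/-- Rounding down the coefficients of a lattice point written as a real combination of `A`
leaves one of finitely many remainders. -/
theorem exists_floor_decomposition (A : Finset (Fin d → ℤ)) :
    ∃ Q : Set (Fin d → ℤ), Q.Finite ∧ ∀ (c : (Fin d → ℤ) → ℝ) (x : Fin d → ℤ),
      castVec ℝ x = ∑ a ∈ A, c a • castVec ℝ a → x - ∑ a ∈ A, ⌊c a⌋ • a ∈ Q := by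
  -- The remainder is `∑ fract (c a) • a`, so each coordinate is bounded by `∑ |a i|`.
  refine ⟨Set.Icc (fun i => -∑ a ∈ A, |a i|) (fun i => ∑ a ∈ A, |a i|), Set.finite_Icc _ _, ?_⟩
  intro c x hx
  have key : ∀ i, |(x - ∑ a ∈ A, ⌊c a⌋ • a) i| ≤ ∑ a ∈ A, |a i| := fun i => by
    have h := congrFun hx i
    simp only [castVec_apply, Finset.sum_apply, Pi.smul_apply, smul_eq_mul] at h
    have h2 : (((x - ∑ a ∈ A, ⌊c a⌋ • a) i : ℤ) : ℝ) = ∑ a ∈ A, Int.fract (c a) * (a i : ℝ) := by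
      simp only [Pi.sub_apply, Finset.sum_apply, Pi.smul_apply, smul_eq_mul]
      push_cast
      rw [h, ← Finset.sum_sub_distrib]
      refine Finset.sum_congr rfl fun a _ => ?_
      rw [Int.fract]; ring
    have h3 : |(((x - ∑ a ∈ A, ⌊c a⌋ • a) i : ℤ) : ℝ)| ≤ ∑ a ∈ A, |(a i : ℝ)| := by
      rw [h2]
      refine (Finset.abs_sum_le_sum_abs _ _).trans (Finset.sum_le_sum fun a _ => ?_)
      rw [abs_mul, abs_of_nonneg (Int.fract_nonneg _)]
      exact mul_le_of_le_one_left (abs_nonneg _) (Int.fract_lt_one _).le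
    exact_mod_cast h3
  exact ⟨fun i => (abs_le.mp (key i)).1, fun i => (abs_le.mp (key i)).2⟩

theorem sum_zsmul_mem_semigp {A : Finset (Fin d → ℤ)} {n : (Fin d → ℤ) → ℤ} (hn : ∀ a, 0 ≤ n a) :
    ∑ a ∈ A, n a • a ∈ semigp A := by
  refine AddSubmonoid.sum_mem _ fun a ha => ?_
  lift n to (Fin d → ℤ) → ℕ using hn
  rw [natCast_zsmul]
  exact AddSubmonoid.nsmul_mem _ (AddSubmonoid.subset_closure ha) _

/-- Pigeonhole: rounding down leaves only finitely many remainders, so two multiples `m • x` and `n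
• x` share one. Their difference is a combination of `A` with coefficients `⌊n c⌋ - ⌊m c⌋ ≥ 0`. -/
theorem exists_nsmul_mem_semigp {A : Finset (Fin d → ℤ)} {x : Fin d → ℤ}
    (hx : castVec ℝ x ∈ cone A) : ∃ m : ℕ, 0 < m ∧ m • x ∈ semigp A := by
  obtain ⟨Q, hQ, hdec⟩ := exists_floor_decomposition A
  obtain ⟨c, hc, hx⟩ := mem_cone_iff.mp hx
  have hm : ∀ m : ℕ, m • x - ∑ a ∈ A, ⌊(m : ℝ) * c a⌋ • a ∈ Q := fun m => by
    refine hdec (fun a => m * c a) (m • x) ?_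
    rw [map_nsmul, hx, Finset.smul_sum]
    refine Finset.sum_congr rfl fun a _ => ?_
    rw [mul_smul, Nat.cast_smul_eq_nsmul]
  have := hQ.to_subtype
  obtain ⟨m, n, hmn, h⟩ := Finite.exists_ne_map_eq_of_infinite fun m : ℕ => (⟨_, hm m⟩ : Q)
  wlog hlt : m < n generalizing m n
  · exact this n m hmn.symm h.symm (by omega)
  have h := congrArg Subtype.val h
  simp only at h
  refine ⟨n - m, by omega, ?_⟩
  have h2 : (n - m) • x = ∑ a ∈ A, (⌊(n : ℝ) * c a⌋ - ⌊(m : ℝ) * c a⌋) • a := by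
    simp only [sub_smul, Finset.sum_sub_distrib]
    rw [sub_nsmul _ hlt.le]
    rw [sub_eq_sub_iff_sub_eq_sub] at h
    rw [← sub_eq_add_neg, ← neg_sub (m • x) (n • x), h, neg_sub]
  rw [h2]
  refine sum_zsmul_mem_semigp fun a => sub_nonneg.mpr (Int.floor_le_floor ?_)
  exact mul_le_mul_of_nonneg_right (by exact_mod_cast hlt.le) (hc a)

theorem exists_sub_mem_semigp {A : Finset (Fin d → ℤ)}
    (hA : AddSubgroup.closure (A : Set (Fin d → ℤ)) = ⊤) (x : Fin d → ℤ) :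
    ∃ v ∈ semigp A, v + x ∈ semigp A := by
  have hx : x ∈ AddSubgroup.closure (A : Set (Fin d → ℤ)) := by rw [hA]; trivial
  induction hx using AddSubgroup.closure_induction with
  | mem x hx => exact ⟨0, zero_mem _, by simpa using AddSubmonoid.subset_closure hx⟩
  | zero => exact ⟨0, zero_mem _, by simp⟩
  | add x y _ _ hx hy =>
    obtain ⟨v, hv, hvx⟩ := hx
    obtain ⟨w, hw, hwy⟩ := hy
    exact ⟨v + w, add_mem hv hw, by
      rw [add_add_add_comm]; exact add_mem hvx hwy⟩
  | neg x _ hx =>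
    obtain ⟨v, hv, hvx⟩ := hx
    exact ⟨v + x, hvx, by simpa using hv⟩

/-- Each of the finitely many remainders `q` has some `v q ∈ ℕA` with `v q + q ∈ ℕA`; the sum of all
these `v q` corrects every remainder at once. -/
theorem exists_add_mem_semigp {A : Finset (Fin d → ℤ)}
    (hA : AddSubgroup.closure (A : Set (Fin d → ℤ)) = ⊤) :
    ∃ v ∈ semigp A, ∀ x : Fin d → ℤ, castVec ℝ x ∈ cone A → v + x ∈ semigp A := by
  obtain ⟨Q, hQ, hdec⟩ := exists_floor_decomposition A
  choose v hv hvx using exists_sub_mem_semigp hA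
  refine ⟨∑ q ∈ hQ.toFinset, v q, AddSubmonoid.sum_mem _ fun q _ => hv q, fun x hx => ?_⟩
  obtain ⟨c, hc, hx⟩ := mem_cone_iff.mp hx
  have hq := hdec c x hx
  set q := x - ∑ a ∈ A, ⌊c a⌋ • a with hqdef
  rw [← Finset.add_sum_erase _ _ (hQ.mem_toFinset.mpr hq)]
  have : v q + ∑ p ∈ hQ.toFinset.erase q, v p + x =
      (v q + q) + (∑ p ∈ hQ.toFinset.erase q, v p + ∑ a ∈ A, ⌊c a⌋ • a) := by
    rw [hqdef]; abel
  rw [this]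
  exact add_mem (hvx q) (add_mem (AddSubmonoid.sum_mem _ fun q _ => hv q)
    (sum_zsmul_mem_semigp fun a => Int.floor_nonneg.mpr (hc a)))

/-! ### Faces -/

section Faces

variable {A : Finset (Fin d → ℤ)} {τ : PointedCone ℝ (Fin d → ℝ)}

/-- In a nonnegative combination that lies in `τ`, the face property puts every generator with
positive coefficient in `τ`. Hence a face is determined by `A ∩ τ`, and there are finitely many
faces. -/
theorem IsFace.eq_hull (hτ : IsFace A τ) : τ = hull ℝ (castVec ℝ '' onFace A τ) := by
  classical
  apply le_antisymm
  · intro x hx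
    obtain ⟨c, hc, rfl⟩ := mem_cone_iff.mp (hτ.le hx)
    refine Submodule.sum_mem _ fun a ha => ?_
    rcases (hc a).eq_or_lt with h | h
    · rw [← h, zero_smul]; exact Submodule.zero_mem _
    · refine PointedCone.smul_mem _ h.le (subset_hull ⟨a, ⟨ha, ?_⟩, rfl⟩)
      rw [← Finset.add_sum_erase _ _ ha] at hx
      exact hτ.mem_of_smul_add_mem (castVec_mem_cone ha) (Submodule.sum_mem _ fun b hb =>
        PointedCone.smul_mem _ (hc b) (castVec_mem_cone (Finset.mem_of_mem_erase hb))) h hx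
  · refine Submodule.span_le.mpr ?_
    rintro _ ⟨a, ha, rfl⟩
    exact ha.2

theorem IsFace.le_iff (hτ : IsFace A τ) {C : PointedCone ℝ (Fin d → ℝ)} :
    τ ≤ C ↔ ∀ a ∈ onFace A τ, castVec ℝ a ∈ C := by
  refine ⟨fun h a ha => h ha.2, fun h => ?_⟩
  rw [hτ.eq_hull]
  exact Submodule.span_le.mpr (by rintro _ ⟨a, ha, rfl⟩; exact h a ha)

theorem finite_faces (A : Finset (Fin d → ℤ)) : {τ | IsFace A τ}.Finite := by
  refine Set.Finite.of_finite_image (f := onFace A) ?_ ?_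
  · exact (A.finite_toSet.powerset).subset (by rintro _ ⟨τ, -, rfl⟩ a ha; exact ha.1)
  · intro τ hτ τ' hτ' h
    rw [IsFace.eq_hull hτ, IsFace.eq_hull hτ', h]

theorem finite_facets (A : Finset (Fin d → ℤ)) : (facets A).Finite :=
  (finite_faces A).subset fun _ h => Maximal.prop (P := fun τ => IsFace A τ ∧ τ ≠ cone A) h |>.1

/-- The sum of the elements of `A ∩ τ`. -/
noncomputable def faceSum (A : Finset (Fin d → ℤ)) (τ : PointedCone ℝ (Fin d → ℝ)) : Fin d → ℤ :=
  ∑ᶠ a ∈ onFace A τ, a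

theorem onFace_finite (A : Finset (Fin d → ℤ)) (τ : PointedCone ℝ (Fin d → ℝ)) :
    (onFace A τ).Finite := A.finite_toSet.subset fun _ h => h.1

theorem faceSum_eq (A : Finset (Fin d → ℤ)) (τ : PointedCone ℝ (Fin d → ℝ)) :
    faceSum A τ = ∑ a ∈ (onFace_finite A τ).toFinset, a :=
  finsum_mem_eq_finite_toFinset_sum _ _

theorem faceSum_mem_faceLattice : faceSum A τ ∈ faceLattice A τ := by
  rw [faceSum_eq]
  exact AddSubgroup.sum_mem _ fun a ha =>
    AddSubgroup.subset_closure ((onFace_finite A τ).mem_toFinset.mp ha)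

theorem faceSum_mem_semigp : faceSum A τ ∈ semigp A := by
  rw [faceSum_eq]
  exact AddSubmonoid.sum_mem _ fun a ha =>
    AddSubmonoid.subset_closure ((onFace_finite A τ).mem_toFinset.mp ha).1

theorem castVec_faceSum_mem : castVec ℝ (faceSum A τ) ∈ τ := by
  rw [faceSum_eq, map_sum]
  exact Submodule.sum_mem _ fun a ha => ((onFace_finite A τ).mem_toFinset.mp ha).2

theorem linForm_faceSum (c : Fin d → ℤ) :
    linForm c (faceSum A τ) = ∑ a ∈ (onFace_finite A τ).toFinset, linForm c a := by
  rw [faceSum_eq, ← linFormₗ_apply, map_sum]; rfl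

/-- A sum of nonnegative terms vanishes only termwise, so the single vector `faceSum A τ` tests
vanishing on the whole face. -/
theorem linForm_faceSum_eq_zero_iff {c : Fin d → ℤ} (hc : ∀ a ∈ A, 0 ≤ linForm c a) :
    linForm c (faceSum A τ) = 0 ↔ ∀ a ∈ onFace A τ, linForm c a = 0 := by
  rw [linForm_faceSum, Finset.sum_eq_zero_iff_of_nonneg]
  · simp
  · intro a ha
    exact hc a ((onFace_finite A τ).mem_toFinset.mp ha).1

end Faces

end ToricDiff

/-! ### Facets, support functions and the conductor -/

namespace ToricDiff

open PointedCone

variable {d : ℕ}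

section BaseChange

variable {K : Type*} [Field K] [CharZero K] {T : Set (Fin d → ℤ)} {a : Fin d → ℤ}

theorem castVec_mem_span_of_rat (h : castVec ℚ a ∈ Submodule.span ℚ (castVec ℚ '' T)) :
    castVec K a ∈ Submodule.span K (castVec K '' T) := by
  let f : (Fin d → ℚ) →ₗ[ℚ] (Fin d → K) := (Algebra.linearMap ℚ K).compLeft (Fin d)
  have hf : ∀ a : Fin d → ℤ, f (castVec ℚ a) = castVec K a := fun a => by
    ext i; simp [f]
  have hle : Submodule.span ℚ (castVec ℚ '' T) ≤
      ((Submodule.span K (castVec K '' T)).restrictScalars ℚ).comap f := by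
    rw [Submodule.span_le]
    rintro _ ⟨b, hb, rfl⟩
    change f (castVec ℚ b) ∈ Submodule.span K (castVec K '' T)
    rw [hf]
    exact Submodule.subset_span ⟨b, hb, rfl⟩
  have : f (castVec ℚ a) ∈ Submodule.span K (castVec K '' T) := hle h
  rwa [hf] at this

/-- A rational functional separating `a` from the rational span extends coefficientwise to `K` and
still separates. -/
theorem castVec_mem_span_rat (h : castVec K a ∈ Submodule.span K (castVec K '' T)) :
    castVec ℚ a ∈ Submodule.span ℚ (castVec ℚ '' T) := by
  by_contra hn
  obtain ⟨φ, hφ, hle⟩ := Submodule.exists_le_ker_of_notMem hn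
  let ψ : (Fin d → K) →ₗ[K] K :=
    ∑ i, ((φ (Pi.single i 1) : ℚ) : K) • LinearMap.proj i
  have hψ : ∀ b : Fin d → ℤ, ψ (castVec K b) = ((φ (castVec ℚ b) : ℚ) : K) := fun b => by
    rw [LinearMap.pi_apply_eq_sum_univ φ]
    simp only [ψ, LinearMap.sum_apply, LinearMap.smul_apply, LinearMap.proj_apply, smul_eq_mul,
      castVec_apply, Rat.cast_sum, Rat.cast_mul, Rat.cast_intCast]
    refine Finset.sum_congr rfl fun i _ => ?_
    have : (fun j => if i = j then (1 : ℚ) else 0) = Pi.single i 1 := by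
      ext j; simp [Pi.single_apply, eq_comm]
    rw [this, mul_comm]
  have hk : Submodule.span K (castVec K '' T) ≤ LinearMap.ker ψ := by
    rw [Submodule.span_le]
    rintro _ ⟨b, hb, rfl⟩
    have : φ (castVec ℚ b) = 0 := hle (Submodule.subset_span ⟨b, hb, rfl⟩)
    simp [hψ, this]
  have := hk h
  rw [LinearMap.mem_ker, hψ] at this
  exact hφ (by exact_mod_cast this)

end BaseChange

variable {A : Finset (Fin d → ℤ)} {σ τ : PointedCone ℝ (Fin d → ℝ)} {c : Fin d → ℤ}

theorem exists_linForm_ne_zero (hA : AddSubgroup.closure (A : Set (Fin d → ℤ)) = ⊤)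
    {b : Fin d → ℤ} (hb : linForm c b ≠ 0) : ∃ a ∈ A, linForm c a ≠ 0 := by
  by_contra! h
  have hle : AddSubgroup.closure (A : Set (Fin d → ℤ)) ≤
      (linFormₗ ℤ c).toAddMonoidHom.ker :=
    (AddSubgroup.closure_le _).mpr fun a ha => h a ha
  rw [hA] at hle
  exact hb (hle (AddSubgroup.mem_top b))

/-- The kernel of a linear form as a cone. -/
noncomputable def kerCone (c : Fin d → ℤ) : PointedCone ℝ (Fin d → ℝ) :=
  (LinearMap.ker (linFormₗ ℝ c)).restrictScalars _

@[simp] theorem mem_kerCone {x : Fin d → ℝ} : x ∈ kerCone c ↔ linForm c x = 0 := Iff.rfl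

theorem castVec_mem_kerCone {a : Fin d → ℤ} : castVec ℝ a ∈ kerCone c ↔ linForm c a = 0 := by
  rw [mem_kerCone, linForm_castVec, Int.cast_eq_zero]

theorem cone_inf_kerCone_ne (hA : AddSubgroup.closure (A : Set (Fin d → ℤ)) = ⊤)
    (hsurj : ∀ m : ℤ, ∃ a : Fin d → ℤ, linForm c a = m) : cone A ⊓ kerCone c ≠ cone A := by
  intro heq
  obtain ⟨b, hb⟩ := hsurj 1
  obtain ⟨a, ha, ha0⟩ := exists_linForm_ne_zero hA (c := c) (b := b) (by omega)
  exact ha0 (castVec_mem_kerCone.mp (inf_eq_left.mp heq (castVec_mem_cone ha)))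

theorem isFace_kerCone (hc : ∀ a ∈ A, 0 ≤ linForm c a) : IsFace A (cone A ⊓ kerCone c) := by
  refine ⟨inf_le_left, fun {x y r} hx hy hr h => ⟨hx, ?_⟩⟩
  have h0 : linForm c (r • x + y) = 0 := h.2
  rw [linForm_add, linForm_smul] at h0
  have h1 := linForm_nonneg_on_cone hc hx
  have h2 := linForm_nonneg_on_cone hc hy
  have h3 : r * linForm c x = 0 := by nlinarith
  exact (mul_eq_zero.mp h3).resolve_left hr.ne'

theorem IsPrimitiveSupport.nonneg_int (h : IsPrimitiveSupport A σ c) {a : Fin d → ℤ}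
    (ha : castVec ℝ a ∈ cone A) : 0 ≤ linForm c a := by
  have := h.nonneg _ ha
  rw [linForm_castVec] at this
  exact_mod_cast this

theorem IsPrimitiveSupport.zero_int (h : IsPrimitiveSupport A σ c) {a : Fin d → ℤ}
    (ha : castVec ℝ a ∈ σ) : linForm c a = 0 := by
  have := h.zero _ ha
  rw [linForm_castVec] at this
  exact_mod_cast this

/-- The zero set of `c` on the cone is a proper face containing `σ`, so maximality of `σ` makes them
equal. -/
theorem IsPrimitiveSupport.mem_of_eq_zero (hA : AddSubgroup.closure (A : Set (Fin d → ℤ)) = ⊤)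
    (hσ : σ ∈ facets A) (h : IsPrimitiveSupport A σ c) {x : Fin d → ℝ} (hx : x ∈ cone A)
    (h0 : linForm c x = 0) : x ∈ σ := by
  have hσ : Maximal (fun τ => IsFace A τ ∧ τ ≠ cone A) σ := hσ
  refine hσ.le_of_ge (y := cone A ⊓ kerCone c)
    ⟨isFace_kerCone fun a ha => h.nonneg_int (castVec_mem_cone ha), cone_inf_kerCone_ne hA h.surj⟩
    (fun y hy => ⟨hσ.prop.1.le hy, h.zero y hy⟩) ⟨hx, h0⟩

/-- Take `b ∈ A` outside `σ`, adjoin `-s` to `A` for `s = faceSum A σ`, and separate `-b` from the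
enlarged cone. A form nonnegative at `s` and `-s` vanishes at `s`, hence on all of `σ`. -/
theorem exists_primitiveSupport (hA : AddSubgroup.closure (A : Set (Fin d → ℤ)) = ⊤)
    (hσ : σ ∈ facets A) : ∃ c, IsPrimitiveSupport A σ c ∧ ∀ y : Fin d → ℚ, linForm c y = 0 →
      y ∈ Submodule.span ℚ (castVec ℚ '' onFace A σ) := by
  classical
  have hσ' : Maximal (fun τ => IsFace A τ ∧ τ ≠ cone A) σ := hσ
  have hface : IsFace A σ := hσ'.prop.1
  obtain ⟨b, hbA, hb⟩ : ∃ b ∈ A, castVec ℝ b ∉ σ := by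
    by_contra! h
    refine hσ'.prop.2 (le_antisymm hface.le (Submodule.span_le.mpr ?_))
    rintro _ ⟨a, ha, rfl⟩
    exact h a ha
  set s := faceSum A σ with hs
  have hA' : AddSubgroup.closure ((insert (-s) A : Finset (Fin d → ℤ)) : Set (Fin d → ℤ)) = ⊤ :=
    top_le_iff.mp (hA ▸ AddSubgroup.closure_mono (by simp))
  rcases exists_support_form _ hA' (-b) with ⟨q, hq, hx⟩ | ⟨c, hsurj, hc, hcb, hker⟩
  -- If `-b` were in the enlarged cone, then `b + z = r • s` with `z` in the cone, and the face
  -- property would put `b` in `σ`.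
  · exfalso
    have h := mem_cone_of_rat hq hx
    rw [cone, Finset.coe_insert, Set.image_insert_eq, PointedCone.hull,
      Submodule.mem_span_insert] at h
    obtain ⟨r, z, hz, h⟩ := h
    refine hb (hface.mem_of_add_mem_left (castVec_mem_cone hbA) hz ?_)
    have : castVec ℝ b + z = r • castVec ℝ s := by
      rw [map_neg, map_neg, smul_neg] at h
      rw [neg_eq_iff_eq_neg.mp h]; abel
    rw [this]
    exact Submodule.smul_mem _ _ castVec_faceSum_mem
  · have hcA : ∀ a ∈ A, 0 ≤ linForm c a := fun a ha => hc a (Finset.mem_insert_of_mem ha)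
    have hs0 : linForm c s = 0 := by
      have h1 := hc (-s) (Finset.mem_insert_self _ _)
      have h2 : 0 ≤ linForm c s := by
        have := linForm_nonneg_on_cone hcA (castVec_mem_cone_of_mem_semigp
          (faceSum_mem_semigp (A := A) (τ := σ)))
        rw [linForm_castVec] at this
        exact_mod_cast this
      rw [linForm_neg] at h1
      omega
    have hprim : IsPrimitiveSupport A σ c := by
      refine ⟨fun x hx => linForm_nonneg_on_cone hcA hx, fun x hx => ?_, hsurj⟩
      have hle : σ ≤ kerCone c := hface.le_iff.mpr fun a ha => by
        rw [mem_kerCone, linForm_castVec, (linForm_faceSum_eq_zero_iff hcA).mp hs0 a ha,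
          Int.cast_zero]
      exact hle hx
    refine ⟨c, hprim, fun y hy => Submodule.span_le.mpr ?_ (hker y hy)⟩
    rintro _ ⟨a, ⟨haA, ha0⟩, rfl⟩
    rcases Finset.mem_insert.mp haA with rfl | haA
    · rw [map_neg]
      refine Submodule.neg_mem _ ?_
      rw [hs, faceSum_eq, map_sum]
      exact Submodule.sum_mem _ fun a ha =>
        Submodule.subset_span ⟨a, (onFace_finite A σ).mem_toFinset.mp ha, rfl⟩
    · refine Submodule.subset_span ⟨a, ⟨haA, hprim.mem_of_eq_zero hA hσ (castVec_mem_cone haA) ?_⟩,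
        rfl⟩
      rw [linForm_castVec, ha0, Int.cast_zero]

/-- The form `c'` vanishes on `ker c`, which is spanned by `σ`, so `c'` is a multiple of `c`.
Surjectivity makes the factor `±1`, and nonnegativity on the cone excludes `-1`. -/
theorem IsPrimitiveSupport.unique (hA : AddSubgroup.closure (A : Set (Fin d → ℤ)) = ⊤)
    {c c' : Fin d → ℤ} (h : IsPrimitiveSupport A σ c) (h' : IsPrimitiveSupport A σ c')
    (hker : ∀ y : Fin d → ℚ, linForm c y = 0 →
      y ∈ Submodule.span ℚ (castVec ℚ '' onFace A σ)) : c' = c := by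
  obtain ⟨w, hw⟩ := h.surj 1
  have hmul : ∀ a : Fin d → ℤ, linForm c' a = linForm c a * linForm c' w := fun a => by
    have h0 : linForm c (castVec ℚ (a - linForm c a • w)) = 0 := by
      rw [linForm_castVec, linForm_sub, linForm_smul, hw]; simp
    have hle : Submodule.span ℚ (castVec ℚ '' onFace A σ) ≤ LinearMap.ker (linFormₗ ℚ c') := by
      rw [Submodule.span_le]
      rintro _ ⟨b, hb, rfl⟩
      simp [linForm_castVec, h'.zero_int hb.2]
    have h1 := hle (hker _ h0)
    rw [LinearMap.mem_ker, linFormₗ_apply, linForm_castVec, linForm_sub, linForm_smul] at h1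
    have h1 : linForm c' a - linForm c a * linForm c' w = 0 := by exact_mod_cast h1
    linarith
  obtain ⟨b, hb⟩ := h'.surj 1
  obtain ⟨a, ha, ha0⟩ := exists_linForm_ne_zero hA (c := c) (b := w) (by omega)
  have hpos : 0 < linForm c a := lt_of_le_of_ne (h.nonneg_int (castVec_mem_cone ha)) ha0.symm
  have hpos' := h'.nonneg_int (castVec_mem_cone ha)
  have h1 : linForm c' w = 1 := by
    have := hmul b
    rw [hb] at this
    rcases Int.eq_one_or_neg_one_of_mul_eq_one' this.symm with h | h
    · exact h.2
    · rw [hmul a, h.2] at hpos'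
      linarith
  funext i
  have := hmul (Pi.single i 1)
  rw [h1, mul_one] at this
  simpa [linForm, Pi.single_apply] using this

theorem isPrimitiveSupport_supportCoeff (hA : AddSubgroup.closure (A : Set (Fin d → ℤ)) = ⊤)
    (hσ : σ ∈ facets A) : IsPrimitiveSupport A σ (supportCoeff A σ) := by
  obtain ⟨c, hc, -⟩ := exists_primitiveSupport hA hσ
  have h : ∃ c, IsPrimitiveSupport A σ c := ⟨c, hc⟩
  rw [supportCoeff, dif_pos h]
  exact h.choose_spec

theorem supportFn_eq_zero_mem_span (hA : AddSubgroup.closure (A : Set (Fin d → ℤ)) = ⊤)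
    (hσ : σ ∈ facets A) {y : Fin d → ℚ} (hy : supportFn A σ y = 0) :
    y ∈ Submodule.span ℚ (castVec ℚ '' onFace A σ) := by
  obtain ⟨c, hc, hker⟩ := exists_primitiveSupport hA hσ
  rw [supportFn, hc.unique hA (isPrimitiveSupport_supportCoeff hA hσ) hker] at hy
  exact hker y hy

theorem mem_faceSpanC_of_supportFn_eq_zero
    (hA : AddSubgroup.closure (A : Set (Fin d → ℤ)) = ⊤) (hσ : σ ∈ facets A) {y : Fin d → ℂ}
    (hy : supportFn A σ y = 0) : y ∈ faceSpanC A σ := by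
  set c := supportCoeff A σ
  have hc : IsPrimitiveSupport A σ c := isPrimitiveSupport_supportCoeff hA hσ
  obtain ⟨w, hw⟩ := hc.surj 1
  -- With `w` of value 1, the integral vectors `e_j - c_j w` lie in the kernel of `c`, and `∑ y_j
  -- (e_j - c_j w) = y - c(y) w = y`. This reduces the complex statement to the rational one.
  have hdec : y = ∑ j, y j • castVec ℂ (Pi.single j 1 - c j • w) := by
    have h0 : ∑ j, y j * (c j : ℂ) = 0 := by
      rw [← hy, supportFn, linForm]
      exact Finset.sum_congr rfl fun j _ => mul_comm _ _
    ext i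
    simp only [Finset.sum_apply, Pi.smul_apply, castVec_apply, smul_eq_mul, Pi.sub_apply,
      Int.cast_sub, Int.cast_mul, mul_sub, Finset.sum_sub_distrib]
    simp only [← mul_assoc, ← Finset.sum_mul, h0, zero_mul, sub_zero]
    simp [Pi.single_apply]
  rw [hdec]
  refine Submodule.sum_mem _ fun j _ => Submodule.smul_mem _ _ (castVec_mem_span_of_rat ?_)
  refine supportFn_eq_zero_mem_span hA hσ ?_
  rw [supportFn, linForm_castVec, linForm_sub, linForm_smul, hw]
  simp [linForm, Pi.single_apply, c]

theorem exists_sub_of_mem_span_onFace {x : Fin d → ℝ}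
    (hx : x ∈ Submodule.span ℝ (castVec ℝ '' onFace A τ)) : ∃ p ∈ τ, ∃ q ∈ τ, x = p - q := by
  induction hx using Submodule.span_induction with
  | mem x hx =>
    obtain ⟨a, ha, rfl⟩ := hx
    exact ⟨_, ha.2, 0, Submodule.zero_mem _, by simp⟩
  | zero => exact ⟨0, Submodule.zero_mem _, 0, Submodule.zero_mem _, by simp⟩
  | add x y _ _ hx hy =>
    obtain ⟨p, hp, q, hq, rfl⟩ := hx
    obtain ⟨p', hp', q', hq', rfl⟩ := hy
    exact ⟨_, Submodule.add_mem _ hp hp', _, Submodule.add_mem _ hq hq', by abel⟩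
  | smul r x _ hx =>
    obtain ⟨p, hp, q, hq, rfl⟩ := hx
    rcases le_total 0 r with h | h
    · exact ⟨_, PointedCone.smul_mem _ h hp, _, PointedCone.smul_mem _ h hq, smul_sub _ _ _⟩
    · refine ⟨_, PointedCone.smul_mem _ (neg_nonneg.mpr h) hq, _,
        PointedCone.smul_mem _ (neg_nonneg.mpr h) hp, ?_⟩
      simp only [neg_smul, smul_sub]; abel

/-- A strictly larger face `ρ` contains some `a₀` with `c(a₀) ≠ 0`, so it spans the whole space.
Each generator `b` then satisfies `b + q ∈ ρ` for some `q ∈ ρ`, which forces `b ∈ ρ`. -/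
theorem kerCone_mem_facets (hA : AddSubgroup.closure (A : Set (Fin d → ℤ)) = ⊤)
    (hsurj : ∀ m : ℤ, ∃ a : Fin d → ℤ, linForm c a = m) (hc : ∀ a ∈ A, 0 ≤ linForm c a)
    (hker : ∀ y : Fin d → ℚ, linForm c y = 0 →
      y ∈ Submodule.span ℚ (castVec ℚ '' {a | a ∈ A ∧ linForm c a = 0})) :
    cone A ⊓ kerCone c ∈ facets A := by
  refine ⟨⟨isFace_kerCone hc, cone_inf_kerCone_ne hA hsurj⟩, fun ρ hρ hle => ?_⟩
  refine le_inf hρ.1.le (hρ.1.le_iff.mpr fun a₀ ha₀ => ?_)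
  by_contra hne
  have hne : linForm c a₀ ≠ 0 := fun h => hne (by rw [mem_kerCone, linForm_castVec, h]; simp)
  have hneQ : ((linForm c a₀ : ℤ) : ℚ) ≠ 0 := by exact_mod_cast hne
  refine hρ.2 (le_antisymm hρ.1.le (Submodule.span_le.mpr ?_))
  rintro _ ⟨b, hb, rfl⟩
  have hbspan : castVec ℚ b ∈ Submodule.span ℚ (castVec ℚ '' onFace A ρ) := by
    have h0 : linForm c (castVec ℚ b -
        (((linForm c b : ℤ) : ℚ) / ((linForm c a₀ : ℤ) : ℚ)) • castVec ℚ a₀) = 0 := by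
      rw [linForm_sub, linForm_smul, linForm_castVec, linForm_castVec, div_mul_cancel₀ _ hneQ,
        sub_self]
    have h1 : castVec ℚ b -
        (((linForm c b : ℤ) : ℚ) / ((linForm c a₀ : ℤ) : ℚ)) • castVec ℚ a₀ ∈
        Submodule.span ℚ (castVec ℚ '' onFace A ρ) := by
      refine Submodule.span_mono ?_ (hker _ h0)
      rintro _ ⟨a, ⟨ha, ha0⟩, rfl⟩
      refine ⟨a, ⟨ha, hle ⟨castVec_mem_cone ha, ?_⟩⟩, rfl⟩
      change linForm c (castVec ℝ a) = 0
      rw [linForm_castVec, ha0, Int.cast_zero]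
    have h2 := Submodule.add_mem _ h1 (Submodule.smul_mem _
      (((linForm c b : ℤ) : ℚ) / ((linForm c a₀ : ℤ) : ℚ))
      (Submodule.subset_span ⟨a₀, ha₀, rfl⟩))
    simpa using h2
  obtain ⟨p, hp, q, hq, hpq⟩ := exists_sub_of_mem_span_onFace
    (castVec_mem_span_of_rat (K := ℝ) hbspan)
  exact hρ.1.mem_of_add_mem_left (castVec_mem_cone hb) (hρ.1.le hq)
    (by rw [hpq, sub_add_cancel]; exact hp)

/-- The form cutting off a point outside the cone has a facet as its zero set, and by uniqueness it
is the support function of that facet. -/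
theorem castVec_mem_cone_of_supportFn_nonneg
    (hA : AddSubgroup.closure (A : Set (Fin d → ℤ)) = ⊤) {x : Fin d → ℤ}
    (hx : ∀ σ ∈ facets A, 0 ≤ supportFn A σ x) : castVec ℝ x ∈ cone A := by
  rcases exists_support_form A hA x with ⟨q, hq, h⟩ | ⟨c, hsurj, hc, hcx, hker⟩
  · exact mem_cone_of_rat hq h
  · exfalso
    have hσ := kerCone_mem_facets hA hsurj hc hker
    have hprim : IsPrimitiveSupport A (cone A ⊓ kerCone c) c :=
      ⟨fun y hy => linForm_nonneg_on_cone hc hy, fun y hy => hy.2, hsurj⟩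
    have heq := hprim.unique hA (isPrimitiveSupport_supportCoeff hA hσ) fun y hy => by
      refine Submodule.span_mono ?_ (hker y hy)
      rintro _ ⟨a, ⟨ha, ha0⟩, rfl⟩
      refine ⟨a, ⟨ha, castVec_mem_cone ha, ?_⟩, rfl⟩
      change linForm c (castVec ℝ a) = 0
      rw [linForm_castVec, ha0, Int.cast_zero]
    have := hx _ hσ
    rw [supportFn, heq] at this
    omega

section SupportFn

variable {K : Type*} [Ring K]

theorem supportFn_castVec (a : Fin d → ℤ) :
    supportFn A σ (castVec K a) = ((supportFn A σ a : ℤ) : K) := linForm_castVec _ a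

theorem supportFn_add (x y : Fin d → K) :
    supportFn A σ (x + y) = supportFn A σ x + supportFn A σ y := linForm_add _ x y

theorem supportFn_sub (x y : Fin d → K) :
    supportFn A σ (x - y) = supportFn A σ x - supportFn A σ y := linForm_sub _ x y

theorem supportFn_nsmul (n : ℕ) (x : Fin d → ℤ) :
    supportFn A σ (n • x) = n * supportFn A σ x := by
  rw [← natCast_zsmul]
  exact linForm_smul _ (n : ℤ) x

end SupportFn

theorem supportFn_nonneg (hA : AddSubgroup.closure (A : Set (Fin d → ℤ)) = ⊤)
    (hσ : σ ∈ facets A) {a : Fin d → ℤ} (ha : a ∈ semigp A) : 0 ≤ supportFn A σ a :=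
  (isPrimitiveSupport_supportCoeff hA hσ).nonneg_int (castVec_mem_cone_of_mem_semigp ha)

/-- Take `N` above every `F_σ(v)`, where `v + x ∈ ℕA` for all lattice points `x` of the cone. For
the relative form, multiples of `faceSum A τ` make `F_σ` large on the facets not containing `τ`
without lowering it on the others. -/
theorem exists_conductor (hA : AddSubgroup.closure (A : Set (Fin d → ℤ)) = ⊤) :
    ∃ N : ℤ, (∀ x : Fin d → ℤ, (∀ σ ∈ facets A, N ≤ supportFn A σ x) → x ∈ semigp A) ∧
      ∀ τ, IsFace A τ → ∀ x : Fin d → ℤ, (∀ σ ∈ facets A, τ ≤ σ → N ≤ supportFn A σ x) →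
        ∃ z ∈ faceLattice A τ, x + z ∈ semigp A := by
  obtain ⟨v, hv, hvx⟩ := exists_add_mem_semigp hA
  obtain ⟨N, hN⟩ := ((finite_facets A).image fun σ => (supportFn A σ v : ℤ)).bddAbove
  have hN : ∀ σ ∈ facets A, (supportFn A σ v : ℤ) ≤ N := fun σ hσ => hN ⟨σ, hσ, rfl⟩
  have hcond : ∀ x : Fin d → ℤ, (∀ σ ∈ facets A, N ≤ supportFn A σ x) → x ∈ semigp A := by
    intro x hx
    have := hvx (x - v) (castVec_mem_cone_of_supportFn_nonneg hA fun σ hσ => by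
      have h1 := hN σ hσ
      have h2 := hx σ hσ
      rw [supportFn_sub]
      omega)
    simpa using this
  refine ⟨N, hcond, fun τ hτ x hx => ?_⟩
  obtain ⟨M, hM⟩ := ((finite_facets A).image fun σ => (N - supportFn A σ x).toNat).bddAbove
  have hM : ∀ σ ∈ facets A, (N - supportFn A σ x).toNat ≤ M := fun σ hσ => hM ⟨σ, hσ, rfl⟩
  refine ⟨M • faceSum A τ, AddSubgroup.nsmul_mem _ faceSum_mem_faceLattice _,
    hcond _ fun σ hσ => ?_⟩
  have hprim := isPrimitiveSupport_supportCoeff hA hσ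
  have h0 : 0 ≤ supportFn A σ (faceSum A τ) := supportFn_nonneg hA hσ faceSum_mem_semigp
  rw [supportFn_add, supportFn_nsmul]
  by_cases hle : τ ≤ σ
  · have := hx σ hσ hle
    have : 0 ≤ (M : ℤ) * supportFn A σ (faceSum A τ) := mul_nonneg (by positivity) h0
    omega
  · have h1 : supportFn A σ (faceSum A τ) ≠ 0 := fun h => hle <| hτ.le_iff.mpr fun a ha => by
      have := (linForm_faceSum_eq_zero_iff
        (fun a ha => hprim.nonneg_int (castVec_mem_cone ha))).mp h a ha
      refine hprim.mem_of_eq_zero hA hσ (castVec_mem_cone ha.1) ?_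
      rw [linForm_castVec, this, Int.cast_zero]
    have h2 : 1 ≤ supportFn A σ (faceSum A τ) := by omega
    have h3 := hM σ hσ
    have h4 : (M : ℤ) * 1 ≤ M * supportFn A σ (faceSum A τ) :=
      mul_le_mul_of_nonneg_left h2 (by positivity)
    omega

/-! ### The smallest face that contains a given element -/

/-- The smallest face of the cone that contains `s`, for `s` in the cone. -/
def minFace (A : Finset (Fin d → ℤ)) (s : Fin d → ℝ) : PointedCone ℝ (Fin d → ℝ) where
  carrier := {x | x ∈ cone A ∧ ∃ r : ℝ, 0 ≤ r ∧ r • s - x ∈ cone A}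
  add_mem' := by
    rintro x y ⟨hx, r, hr, hrx⟩ ⟨hy, t, ht, hty⟩
    refine ⟨add_mem hx hy, r + t, add_nonneg hr ht, ?_⟩
    have : (r + t) • s - (x + y) = (r • s - x) + (t • s - y) := by rw [add_smul]; abel
    rw [this]
    exact add_mem hrx hty
  zero_mem' := ⟨Submodule.zero_mem _, 0, le_rfl, by simp⟩
  smul_mem' := by
    rintro k x ⟨hx, r, hr, hrx⟩
    refine ⟨Submodule.smul_mem _ k hx, k * r, mul_nonneg k.2 hr, ?_⟩
    have : ((k : ℝ) * r) • s - k • x = k • (r • s - x) := by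
      rw [smul_sub, mul_smul]; rfl
    rw [this]
    exact Submodule.smul_mem _ k hrx

theorem isFace_minFace (s : Fin d → ℝ) : IsFace A (minFace A s) := by
  refine ⟨fun x hx => hx.1, ?_⟩
  rintro x y t hx hy ht ⟨-, r, hr, h⟩
  refine ⟨hx, t⁻¹ * r, by positivity, ?_⟩
  have : (t⁻¹ * r) • s - x = t⁻¹ • ((r • s - (t • x + y)) + y) := by
    rw [mul_smul, smul_add, smul_sub, smul_add, inv_smul_smul₀ ht.ne']; abel
  rw [this]
  exact PointedCone.smul_mem _ (by positivity) (add_mem h hy)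

/-- Some `n • s - a` lies in the cone, so an `(m + 1)`-fold multiple of it lies in `ℕA`; adding `m •
a` leaves a single `a` subtracted. -/
theorem exists_nsmul_sub_mem_semigp {s a : Fin d → ℤ} (hs : s ∈ semigp A) (ha : a ∈ semigp A)
    (h : castVec ℝ a ∈ minFace A (castVec ℝ s)) : ∃ n : ℕ, n • s - a ∈ semigp A := by
  obtain ⟨-, r, hr, h⟩ := h
  obtain ⟨n, hn⟩ := exists_nat_ge r
  have h1 : castVec ℝ (n • s - a) ∈ cone A := by
    have : castVec ℝ (n • s - a) = ((n : ℝ) - r) • castVec ℝ s + (r • castVec ℝ s - castVec ℝ a) := by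
      rw [map_sub, map_nsmul, sub_smul, Nat.cast_smul_eq_nsmul]; abel
    rw [this]
    exact add_mem (PointedCone.smul_mem _ (by linarith) (castVec_mem_cone_of_mem_semigp hs)) h
  obtain ⟨m, hm, h2⟩ := exists_nsmul_mem_semigp h1
  obtain ⟨m, rfl⟩ : ∃ k, m = k + 1 := ⟨m - 1, by omega⟩
  refine ⟨(m + 1) * n, ?_⟩
  have : ((m + 1) * n) • s - a = (m + 1) • (n • s - a) + m • a := by
    rw [smul_sub, mul_smul, add_smul m 1 a, one_smul]; abel
  rw [this]
  exact add_mem h2 (AddSubmonoid.nsmul_mem _ ha _)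

theorem exists_nsmul_add_mem_semigp {s z : Fin d → ℤ} (hs : s ∈ semigp A)
    (hz : z ∈ faceLattice A (minFace A (castVec ℝ s))) : ∃ n : ℕ, n • s + z ∈ semigp A := by
  -- Both signs are carried along so that the induction passes through negation.
  suffices h : ∃ n : ℕ, n • s + z ∈ semigp A ∧ n • s - z ∈ semigp A from
    h.imp fun _ h => h.1
  induction hz using AddSubgroup.closure_induction with
  | mem a ha =>
    have haA := AddSubmonoid.subset_closure (Finset.mem_coe.mpr ha.1)
    obtain ⟨n, hn⟩ := exists_nsmul_sub_mem_semigp hs haA ha.2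
    exact ⟨n, add_mem (AddSubmonoid.nsmul_mem _ hs _) haA, hn⟩
  | zero => exact ⟨0, by simp⟩
  | add x y _ _ hx hy =>
    obtain ⟨m, h1, h2⟩ := hx
    obtain ⟨n, h3, h4⟩ := hy
    refine ⟨m + n, ?_, ?_⟩
    · rw [add_smul, add_add_add_comm]; exact add_mem h1 h3
    · rw [add_smul, add_sub_add_comm]; exact add_mem h2 h4
  | neg x _ hx =>
    obtain ⟨n, h1, h2⟩ := hx
    exact ⟨n, by rwa [← sub_eq_add_neg], by rwa [sub_neg_eq_add]⟩

end ToricDiff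

/-! ### The sets `E_τ(α)`, their largest possible size, and extreme parameters -/

namespace ToricDiff

variable {d : ℕ} {A : Finset (Fin d → ℤ)} {σ τ : PointedCone ℝ (Fin d → ℝ)}
  {α β l : Fin d → ℂ}

/-! ### The sets `E_τ(α)` -/

theorem castVec_mem_faceSpanC {z : Fin d → ℤ} (hz : z ∈ faceLattice A τ) :
    castVec ℂ z ∈ faceSpanC A τ := by
  have : faceLattice A τ ≤ (faceSpanC A τ).toAddSubgroup.comap (castVec ℂ) :=
    (AddSubgroup.closure_le _).mpr fun a ha => Submodule.subset_span ⟨a, ha, rfl⟩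
  exact this hz

theorem mk_mem_E_iff : (QuotientAddGroup.mk l : (Fin d → ℂ) ⧸ faceLatticeC A τ) ∈ E A τ α ↔
    l ∈ faceSpanC A τ ∧ ∃ b ∈ semigp A, ∃ z ∈ faceLattice A τ, α - l = castVec ℂ (b + z) := by
  constructor
  · rintro ⟨l', ⟨hl', b, hb, _, ⟨z, hz, rfl⟩, h⟩, heq⟩
    obtain ⟨y, hy, hyl⟩ := QuotientAddGroup.eq.mp heq
    obtain rfl : l = l' + castVec ℂ y := by rw [hyl]; abel
    refine ⟨add_mem hl' (castVec_mem_faceSpanC hy), b, hb, z - y, sub_mem hz hy, ?_⟩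
    rw [← sub_sub, h, ← map_add, ← map_sub]; congr 1; abel
  · rintro ⟨hl, b, hb, z, hz, h⟩
    exact ⟨l, ⟨hl, b, hb, _, ⟨z, hz, rfl⟩, by rw [h, map_add]⟩, rfl⟩

theorem supportFn_eq_zero_of_mem_faceSpanC
    (hA : AddSubgroup.closure (A : Set (Fin d → ℤ)) = ⊤) (hσ : σ ∈ facets A) (hle : τ ≤ σ)
    (hl : l ∈ faceSpanC A τ) : supportFn A σ l = 0 := by
  have : faceSpanC A τ ≤ LinearMap.ker (linFormₗ ℂ (supportCoeff A σ)) := by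
    refine Submodule.span_le.mpr ?_
    rintro _ ⟨a, ha, rfl⟩
    simp [linForm_castVec, (isPrimitiveSupport_supportCoeff hA hσ).zero_int (hle ha.2)]
  exact this hl

theorem supportFn_eq_zero_of_mem_faceLattice
    (hA : AddSubgroup.closure (A : Set (Fin d → ℤ)) = ⊤) (hσ : σ ∈ facets A) (hle : τ ≤ σ)
    {z : Fin d → ℤ} (hz : z ∈ faceLattice A τ) : supportFn A σ z = 0 := by
  have := supportFn_eq_zero_of_mem_faceSpanC hA hσ hle (castVec_mem_faceSpanC hz)
  rw [supportFn_castVec] at this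
  exact_mod_cast this

theorem supportFn_eq_of_sub_eq (hA : AddSubgroup.closure (A : Set (Fin d → ℤ)) = ⊤)
    (hσ : σ ∈ facets A) (hle : τ ≤ σ) (hl : l ∈ faceSpanC A τ) {a : Fin d → ℤ}
    (h : α - l = castVec ℂ a) : supportFn A σ α = ((supportFn A σ a : ℤ) : ℂ) := by
  rw [← supportFn_castVec, ← h, supportFn_sub, supportFn_eq_zero_of_mem_faceSpanC hA hσ hle hl,
    sub_zero]

/-- For facets containing `τ`, `F_σ` kills both `ℂ(A ∩ τ)` and `ℤ(A ∩ τ)`, so `F_σ(α) = F_σ(b)`.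
Thus the emptiness half of extremeness always holds. -/
theorem mem_faceSet_of_mem_E (hA : AddSubgroup.closure (A : Set (Fin d → ℤ)) = ⊤)
    (hτ : IsFace A τ)
    (h : (QuotientAddGroup.mk l : (Fin d → ℂ) ⧸ faceLatticeC A τ) ∈ E A τ α) :
    τ ∈ faceSet A α := by
  obtain ⟨hl, b, hb, z, hz, h⟩ := mk_mem_E_iff.mp h
  refine ⟨hτ, ⟨l, hl, _, h⟩, fun σ hσ hle => ⟨hσ, b, hb, ?_⟩⟩
  rw [supportFn_eq_of_sub_eq hA hσ hle hl h, supportFn_add,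
    supportFn_eq_zero_of_mem_faceLattice hA hσ hle hz, add_zero]

theorem isFace_of_mem_facets (hσ : σ ∈ facets A) : IsFace A σ :=
  (Maximal.prop (P := fun τ => IsFace A τ ∧ τ ≠ cone A) hσ).1

theorem eq_of_facet_le (hσ : σ ∈ facets A) (hτ : τ ∈ facets A) (h : σ ≤ τ) : σ = τ :=
  Maximal.eq_of_le (P := fun τ => IsFace A τ ∧ τ ≠ cone A) hσ
    (Maximal.prop (P := fun τ => IsFace A τ ∧ τ ≠ cone A) hτ) h

/-- Since `ℂ(A ∩ σ)` is the kernel of `F_σ`, the facet `σ` lies in `𝓕₊(α)` exactly when `E_σ(α)` is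
nonempty. -/
theorem mem_facetsPos_of_prec (hA : AddSubgroup.closure (A : Set (Fin d → ℤ)) = ⊤)
    (h : Prec A α β) (hσ : σ ∈ facetsPos A α) : σ ∈ facetsPos A β := by
  obtain ⟨hσ, b, hb, hαb⟩ := hσ
  have hface := isFace_of_mem_facets hσ
  have hmem : (QuotientAddGroup.mk (α - castVec ℂ b) : (Fin d → ℂ) ⧸ faceLatticeC A σ) ∈
      E A σ α := by
    refine mk_mem_E_iff.mpr ⟨mem_faceSpanC_of_supportFn_eq_zero hA hσ ?_, b, hb, 0, zero_mem _,
      by simp⟩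
    rw [supportFn_sub, supportFn_castVec, hαb, sub_self]
  exact (mem_faceSet_of_mem_E hA hface (h σ hface hmem)).2.2 σ hσ le_rfl

theorem faceSpanC_cone (hA : AddSubgroup.closure (A : Set (Fin d → ℤ)) = ⊤) :
    faceSpanC A (cone A) = ⊤ := by
  have hlat : faceLattice A (cone A) = ⊤ :=
    top_le_iff.mp (hA ▸ AddSubgroup.closure_mono fun a ha => ⟨ha, castVec_mem_cone ha⟩)
  rw [eq_top_iff, ← (Pi.basisFun ℂ (Fin d)).span_eq, Submodule.span_le]
  rintro _ ⟨i, rfl⟩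
  convert! castVec_mem_faceSpanC (A := A) (τ := cone A) (z := Pi.single i 1) (by simp [hlat]) using 1
  ext j
  simp [Pi.single_apply]

/-- Compare `E_τ` for `τ` the whole cone, where the class of `α` itself belongs to `E_τ(α)`. -/
theorem exists_eq_add_of_prec (hA : AddSubgroup.closure (A : Set (Fin d → ℤ)) = ⊤)
    (h : Prec A α β) : ∃ x : Fin d → ℤ, β = α + castVec ℂ x := by
  have hmem : (QuotientAddGroup.mk α : (Fin d → ℂ) ⧸ faceLatticeC A (cone A)) ∈
      E A (cone A) α :=
    mk_mem_E_iff.mpr ⟨by rw [faceSpanC_cone hA]; trivial, 0, zero_mem _, 0, zero_mem _, by simp⟩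
  obtain ⟨-, b, -, z, -, h⟩ := mk_mem_E_iff.mp (h _ (PointedCone.IsFaceOf.refl _) hmem)
  exact ⟨b + z, by rw [← h]; abel⟩

/-! ### The number of elements of `E_τ(α)` -/

theorem exists_nsmul_eq_castVec {y : Fin d → ℚ}
    (hy : y ∈ Submodule.span ℚ (castVec ℚ '' onFace A τ)) :
    ∃ m : ℕ, 0 < m ∧ ∃ z ∈ faceLattice A τ, (m : ℚ) • y = castVec ℚ z := by
  induction hy using Submodule.span_induction with
  | mem x hx =>
    obtain ⟨a, ha, rfl⟩ := hx
    exact ⟨1, one_pos, a, AddSubgroup.subset_closure ha, by simp⟩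
  | zero => exact ⟨1, one_pos, 0, zero_mem _, by simp⟩
  | add x y _ _ hx hy =>
    obtain ⟨m, hm, z, hz, h⟩ := hx
    obtain ⟨n, hn, w, hw, h'⟩ := hy
    refine ⟨m * n, by positivity, n • z + m • w,
      add_mem (nsmul_mem hz _) (nsmul_mem hw _), ?_⟩
    rw [map_add, map_nsmul, map_nsmul, ← h, ← h', smul_add, ← Nat.cast_smul_eq_nsmul ℚ,
      ← Nat.cast_smul_eq_nsmul ℚ, smul_smul, smul_smul]
    push_cast
    rw [mul_comm (n : ℚ)]
  | smul q x _ hx =>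
    obtain ⟨m, hm, z, hz, h⟩ := hx
    refine ⟨q.den * m, Nat.mul_pos q.pos hm, q.num • z, zsmul_mem hz _, ?_⟩
    rw [map_zsmul, ← h, ← Int.cast_smul_eq_zsmul ℚ, smul_smul, smul_smul]
    congr 1
    have := Rat.mul_den_eq_num q
    push_cast
    rw [← this]; ring

/-- The classes `λ ∈ ℂ(A ∩ τ)/ℤ(A ∩ τ)` with `α - λ` integral. -/
def integralShifts (A : Finset (Fin d → ℤ)) (τ : PointedCone ℝ (Fin d → ℝ)) (α : Fin d → ℂ) :
    Set ((Fin d → ℂ) ⧸ faceLatticeC A τ) :=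
  QuotientAddGroup.mk '' {l | l ∈ faceSpanC A τ ∧ ∃ a : Fin d → ℤ, α - l = castVec ℂ a}

theorem E_subset_integralShifts : E A τ α ⊆ integralShifts A τ α := by
  rintro _ ⟨l, ⟨hl, b, hb, _, ⟨z, hz, rfl⟩, h⟩, rfl⟩
  exact ⟨l, ⟨hl, b + z, by rw [h, map_add]⟩, rfl⟩

/-- The set is a coset of the image of `ℚ(A ∩ τ) ∩ ℤᵈ` modulo `ℤ(A ∩ τ)`, a finitely generated
torsion group. Its finiteness makes `faceIndex` a true cardinality rather than the value 0 given to
infinite index. -/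
theorem integralShifts_finite_and_encard {a : Fin d → ℤ} (hl : l ∈ faceSpanC A τ)
    (h : α - l = castVec ℂ a) :
    (integralShifts A τ α).Finite ∧ (integralShifts A τ α).encard = (faceIndex A τ : ℕ∞) := by
  let S := saturatedFaceLattice A τ
  let φ : S →+ (Fin d → ℂ) ⧸ faceLatticeC A τ :=
    (QuotientAddGroup.mk' _).comp ((castVec ℂ).comp S.subtype)
  have hφ : ∀ x : S, φ x = QuotientAddGroup.mk (castVec ℂ (x : Fin d → ℤ)) := fun _ => rfl
  have hker : φ.ker = (faceLattice A τ).addSubgroupOf S := by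
    ext x
    rw [AddMonoidHom.mem_ker, hφ, QuotientAddGroup.eq_zero_iff, AddSubgroup.mem_addSubgroupOf]
    constructor
    · rintro ⟨z, hz, h⟩
      rwa [← castVec_injective ℂ h]
    · exact fun h => ⟨x, h, rfl⟩
  have : Module.Finite ℤ S :=
    inferInstanceAs (Module.Finite ℤ (AddSubgroup.toIntSubmodule S))
  have : Module.Finite ℤ φ.range :=
    Module.Finite.of_surjective φ.rangeRestrict.toIntLinearMap φ.rangeRestrict_surjective
  have : Finite φ.range := by
    have : AddGroup.FG φ.range := Module.Finite.iff_addGroup_fg.mp this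
    refine AddCommGroup.finite_of_fg_isAddTorsion _ ?_
    rintro ⟨_, x, rfl⟩
    obtain ⟨m, hm, z, hz, h⟩ := exists_nsmul_eq_castVec (A := A) (τ := τ) x.2
    rw [isOfFinAddOrder_iff_nsmul_eq_zero]
    refine ⟨m, hm, Subtype.ext ?_⟩
    change m • φ x = 0
    rw [← map_nsmul, ← AddMonoidHom.mem_ker, hker, AddSubgroup.mem_addSubgroupOf]
    have : m • (x : Fin d → ℤ) = z := by
      apply castVec_injective ℚ
      rw [← h, map_nsmul, Nat.cast_smul_eq_nsmul]
    simpa [this] using hz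
  have himg : integralShifts A τ α =
      (fun q => (QuotientAddGroup.mk l : (Fin d → ℂ) ⧸ faceLatticeC A τ) + q) '' φ.range := by
    ext q
    constructor
    · rintro ⟨l', ⟨hl', a', h'⟩, rfl⟩
      have hd : castVec ℂ (a - a') = l' - l := by rw [map_sub, ← h, ← h']; abel
      have hmem : a - a' ∈ S := castVec_mem_span_rat (K := ℂ) (T := onFace A τ) (by
        rw [hd]; exact sub_mem hl' hl)
      refine ⟨φ ⟨_, hmem⟩, ⟨_, rfl⟩, ?_⟩
      simp only [hφ, hd]
      rw [← QuotientAddGroup.mk_add, add_sub_cancel]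
    · rintro ⟨_, ⟨x, rfl⟩, rfl⟩
      refine ⟨l + castVec ℂ (x : Fin d → ℤ), ⟨add_mem hl ?_, a - x, ?_⟩, rfl⟩
      · exact castVec_mem_span_of_rat x.2
      · rw [map_sub, ← h]; abel
  have hfin : (φ.range : Set ((Fin d → ℂ) ⧸ faceLatticeC A τ)).Finite := Set.toFinite _
  rw [himg]
  refine ⟨hfin.image _, ?_⟩
  rw [(add_right_injective _).encard_image, faceIndex, AddSubgroup.relIndex, ← hker,
    AddSubgroup.index_ker, ← hfin.cast_ncard_eq]
  rfl

/-- `E_τ(α)` is a subset of a finite set with that many elements, so the count is attained exactly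
when the two sets coincide. -/
theorem encard_E_eq_iff (hτ : τ ∈ faceSet A α) :
    (E A τ α).encard = (faceIndex A τ : ℕ∞) ↔
      ∀ l ∈ faceSpanC A τ, (∃ a : Fin d → ℤ, α - l = castVec ℂ a) →
        (QuotientAddGroup.mk l : (Fin d → ℂ) ⧸ faceLatticeC A τ) ∈ E A τ α := by
  obtain ⟨-, ⟨l₀, hl₀, a₀, h₀⟩, -⟩ := hτ
  obtain ⟨hfin, hcard⟩ := integralShifts_finite_and_encard hl₀ h₀
  rw [← hcard]
  constructor
  · intro h l hl ha
    have : E A τ α = integralShifts A τ α :=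
      (hfin.subset E_subset_integralShifts).eq_of_subset_of_encard_le E_subset_integralShifts h.ge
    rw [this]
    exact ⟨l, ⟨hl, ha⟩, rfl⟩
  · intro h
    congr 1
    refine subset_antisymm E_subset_integralShifts ?_
    rintro _ ⟨l, ⟨hl, ha⟩, rfl⟩
    exact h l hl ha

/-- `E_τ(α)` is as large as possible for all `τ ∈ Face(α)`. -/
def IsExtremeParam (A : Finset (Fin d → ℤ)) (α : Fin d → ℂ) : Prop :=
  ∀ τ ∈ faceSet A α, ∀ l ∈ faceSpanC A τ, (∃ a : Fin d → ℤ, α - l = castVec ℂ a) →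
    (QuotientAddGroup.mk l : (Fin d → ℂ) ⧸ faceLatticeC A τ) ∈ E A τ α

theorem forall_isExtremeClass_iff (hA : AddSubgroup.closure (A : Set (Fin d → ℤ)) = ⊤) :
    (∀ C : Quotient (paramSetoid A), IsExtremeClass A C) ↔ ∀ α, IsExtremeParam A α := by
  constructor
  · intro h α τ hτ
    exact (encard_E_eq_iff hτ).mp ((h _ α rfl).1 τ hτ)
  · rintro h C α -
    refine ⟨fun τ hτ => (encard_E_eq_iff hτ).mpr (h α τ hτ), fun τ hτ hnot => ?_⟩
    rw [Set.eq_empty_iff_forall_notMem]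
    intro q
    obtain ⟨l, rfl⟩ := QuotientAddGroup.mk_surjective q
    exact fun hq => hnot (mem_faceSet_of_mem_E hA hτ hq)

end ToricDiff

/-! ### Zariski density and the two combinatorial conditions -/

namespace ToricDiff

open MvPolynomial

variable {d : ℕ}

/-! ### Polynomials that vanish on shifted monoids -/

theorem eval_line_eq_zero (f : MvPolynomial (Fin d) ℂ) (p v : Fin d → ℂ) {s : Set ℂ}
    (hs : s.Infinite) (h : ∀ t ∈ s, eval (p + t • v) f = 0) (t : ℂ) : eval (p + t • v) f = 0 := by
  let g : Polynomial ℂ := aeval (fun i => Polynomial.C (p i) + Polynomial.C (v i) * Polynomial.X) f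
  have hg : ∀ t, g.eval t = eval (p + t • v) f := fun t => by
    rw [← Polynomial.coe_evalRingHom, ← MvPolynomial.aeval_eq_eval]
    simp only [g]
    change ((Polynomial.evalRingHom t).comp (aeval (fun i => Polynomial.C (p i) +
      Polynomial.C (v i) * Polynomial.X) : MvPolynomial (Fin d) ℂ →ₐ[ℂ] _).toRingHom) f =
      (aeval (p + t • v) : MvPolynomial (Fin d) ℂ →ₐ[ℂ] ℂ).toRingHom f
    congr 1
    apply MvPolynomial.ringHom_ext
    · intro r; simp
    · intro i
      simp only [RingHom.coe_comp, Function.comp_apply]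
      change Polynomial.evalRingHom t (aeval _ (X i)) = aeval _ (X i)
      rw [aeval_X, aeval_X]
      simp only [Polynomial.coe_evalRingHom, Polynomial.eval_add, Polynomial.eval_C,
        Polynomial.eval_mul, Polynomial.eval_X, Pi.add_apply, Pi.smul_apply, smul_eq_mul,
        mul_comm (v i)]
  have : g = 0 := Polynomial.eq_zero_of_infinite_isRoot g
    (hs.mono fun t ht => by rw [Set.mem_ofPred_eq, Polynomial.IsRoot, hg, h t ht])
  rw [← hg, this, Polynomial.eval_zero]

theorem infinite_natCast_ge (n : ℕ) : {t : ℂ | ∃ m : ℕ, n ≤ m ∧ t = m}.Infinite := by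
  have : (Set.Ici n).Infinite := Set.Ici_infinite n
  refine (this.image (f := fun m : ℕ => (m : ℂ)) Nat.cast_injective.injOn).mono ?_
  rintro _ ⟨m, hm, rfl⟩
  exact ⟨m, hm, rfl⟩

/-- A polynomial vanishing at `p + n a` for all `n ∈ ℕ` vanishes on that complex line; the
directions in `T` are freed one after another. -/
theorem eval_eq_zero_of_mem_span (f : MvPolynomial (Fin d) ℂ) (p : Fin d → ℂ)
    (T : Set (Fin d → ℤ))
    (h : ∀ n ∈ AddSubmonoid.closure T, eval (p + castVec ℂ n) f = 0) {u : Fin d → ℂ}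
    (hu : u ∈ Submodule.span ℂ (castVec ℂ '' T)) : eval (p + u) f = 0 := by
  -- The base point varies and vanishing on the whole translated monoid is kept, so that the steps
  -- can be iterated.
  suffices H : ∀ w, (∀ n ∈ AddSubmonoid.closure T, eval (w + castVec ℂ n) f = 0) →
      ∀ n ∈ AddSubmonoid.closure T, eval (w + u + castVec ℂ n) f = 0 by
    simpa using H p h 0 (zero_mem _)
  induction hu using Submodule.closure_induction with
  | zero => simp
  | add x y _ _ hx hy =>
    intro w hw
    have := hy _ (hx w hw)
    simpa only [add_assoc] using this
  | smul_mem r x hx =>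
    obtain ⟨a, ha, rfl⟩ := hx
    intro w hw n hn
    rw [add_right_comm]
    refine eval_line_eq_zero f _ _ (infinite_natCast_ge 0) ?_ r
    rintro _ ⟨m, -, rfl⟩
    have := hw (n + m • a)
      (add_mem hn (AddSubmonoid.nsmul_mem _ (AddSubmonoid.subset_closure ha) m))
    rw [map_add, map_nsmul, ← add_assoc] at this
    rwa [Nat.cast_smul_eq_nsmul]

theorem eq_zero_of_eval_add_castVec (f : MvPolynomial (Fin d) ℂ) (α : Fin d → ℂ)
    (h : ∀ x : Fin d → ℤ, eval (α + castVec ℂ x) f = 0) : f = 0 := by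
  refine MvPolynomial.funext_set (fun i => Set.range fun n : ℤ => α i + n)
    (fun i => Set.infinite_range_of_injective fun m n hmn => by simpa using hmn) fun x hx => ?_
  choose n hn using fun i => hx i (Set.mem_univ i)
  obtain rfl : α + castVec ℂ n = x := by ext i; exact hn i
  rw [h, map_zero]

theorem eq_zero_of_eval_semigp {A : Finset (Fin d → ℤ)}
    (hA : AddSubgroup.closure (A : Set (Fin d → ℤ)) = ⊤) (f : MvPolynomial (Fin d) ℂ)
    (h : ∀ b ∈ semigp A, eval (castVec ℂ b) f = 0) : f = 0 := by
  refine MvPolynomial.funext fun x => ?_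
  have hx : x ∈ Submodule.span ℂ (castVec ℂ '' (A : Set (Fin d → ℤ))) := by
    have : faceSpanC A (cone A) ≤ Submodule.span ℂ (castVec ℂ '' (A : Set (Fin d → ℤ))) :=
      Submodule.span_mono (Set.image_mono fun a ha => ha.1)
    rw [faceSpanC_cone hA] at this
    exact this trivial
  have := eval_eq_zero_of_mem_span f 0 A (by simpa using h) hx
  simpa using this

/-- The polynomial of a linear form. -/
noncomputable def linPoly (c : Fin d → ℤ) : MvPolynomial (Fin d) ℂ := ∑ i, C (c i : ℂ) * X i

@[simp] theorem eval_linPoly (c : Fin d → ℤ) (x : Fin d → ℂ) :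
    eval x (linPoly c) = linForm c x := by simp [linPoly, linForm]

theorem linPoly_sub_C_ne_zero {c : Fin d → ℤ}
    (hc : ∀ m : ℤ, ∃ a : Fin d → ℤ, linForm c a = m) (t : ℂ) : linPoly c - C t ≠ 0 := by
  intro h
  obtain ⟨w, hw⟩ := hc 1
  have := congrArg (eval ((t + 1) • castVec ℂ w)) h
  simp [linForm_smul, linForm_castVec, hw] at this

/-! ### Zariski dense equivalence classes -/

/-- The equivalence class of `α` is Zariski dense in `ℂᵈ`. -/
def ClassIsZariskiDense (A : Finset (Fin d → ℤ)) (α : Fin d → ℂ) : Prop :=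
  ∀ f : MvPolynomial (Fin d) ℂ, (∀ β, Prec A α β → Prec A β α → eval β f = 0) → f = 0

variable {A : Finset (Fin d → ℤ)} {σ τ : PointedCone ℝ (Fin d → ℝ)} {α β : Fin d → ℂ}

theorem exists_conductor_facets (hA : AddSubgroup.closure (A : Set (Fin d → ℤ)) = ⊤) :
    ∃ N : ℕ, (∀ σ ∈ facets A, ∀ m : ℤ, N ≤ m → ∃ b ∈ semigp A, supportFn A σ b = m) ∧
      ∀ τ, IsFace A τ → ∀ x : Fin d → ℤ, (∀ σ ∈ facets A, τ ≤ σ → N ≤ supportFn A σ x) →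
        ∃ z ∈ faceLattice A τ, x + z ∈ semigp A := by
  obtain ⟨N, -, hN⟩ := exists_conductor hA
  have hN' : ∀ τ, IsFace A τ → ∀ x : Fin d → ℤ,
      (∀ σ ∈ facets A, τ ≤ σ → (N.toNat : ℤ) ≤ supportFn A σ x) →
        ∃ z ∈ faceLattice A τ, x + z ∈ semigp A := fun τ hτ x hx =>
    hN τ hτ x fun σ hσ hle => (Int.self_le_toNat N).trans (hx σ hσ hle)
  refine ⟨N.toNat, fun σ hσ m hm => ?_, hN'⟩
  -- Lift `m` to a lattice point and apply the conductor to the facet itself; the correction in `ℤ(A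
  -- ∩ σ)` does not change `F_σ`.
  obtain ⟨w, hw⟩ := (isPrimitiveSupport_supportCoeff hA hσ).surj m
  obtain ⟨z, hz, hwz⟩ := hN' σ (isFace_of_mem_facets hσ) w fun ρ hρ hle => by
    obtain rfl := eq_of_facet_le hσ hρ hle
    rwa [supportFn, hw]
  refine ⟨_, hwz, ?_⟩
  rw [supportFn_add, supportFn_eq_zero_of_mem_faceLattice hA hσ le_rfl hz, add_zero, supportFn, hw]

theorem exists_bound_supportFn (A : Finset (Fin d → ℤ)) (α : Fin d → ℂ) :
    ∃ B : ℕ, ∀ σ ∈ facets A, ∀ m : ℤ, supportFn A σ α = m → |m| ≤ B := by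
  have h : ∀ σ : PointedCone ℝ (Fin d → ℝ), ∃ n : ℕ, ∀ m : ℤ, supportFn A σ α = m → |m| ≤ n := by
    intro σ
    by_cases h : ∃ m : ℤ, supportFn A σ α = m
    · obtain ⟨m, hm⟩ := h
      refine ⟨m.natAbs, fun k hk => ?_⟩
      rw [hm] at hk
      have : m = k := by exact_mod_cast hk
      rw [← this, Int.abs_eq_natAbs]
    · exact ⟨0, fun m hm => absurd ⟨m, hm⟩ h⟩
  choose n hn using h
  obtain ⟨B, hB⟩ := ((finite_facets A).image n).bddAbove
  refine ⟨B, fun σ hσ m hm => (hn σ m hm).trans ?_⟩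
  exact_mod_cast hB ⟨σ, hσ, rfl⟩

/-- The points to avoid lie on the finitely many hyperplanes `F_σ = F_σ(α) + k`, `|k| ≤ N`, and a
dense class is not contained in their union. -/
theorem ClassIsZariskiDense.exists_large (hA : AddSubgroup.closure (A : Set (Fin d → ℤ)) = ⊤)
    (h : ClassIsZariskiDense A α) (N : ℕ) : ∃ x : Fin d → ℤ,
      Prec A α (α + castVec ℂ x) ∧ Prec A (α + castVec ℂ x) α ∧
        ∀ σ ∈ facets A, (N : ℤ) < |(supportFn A σ x : ℤ)| := by
  let f : MvPolynomial (Fin d) ℂ := ∏ σ ∈ (finite_facets A).toFinset,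
    ∏ k ∈ Finset.Icc (-N : ℤ) N, (linPoly (supportCoeff A σ) - C (supportFn A σ α + k))
  have hf : f ≠ 0 := Finset.prod_ne_zero_iff.mpr fun σ hσ => Finset.prod_ne_zero_iff.mpr
    fun k _ => linPoly_sub_C_ne_zero
      (isPrimitiveSupport_supportCoeff hA ((finite_facets A).mem_toFinset.mp hσ)).surj _
  obtain ⟨β, h1, h2, hβ⟩ : ∃ β, Prec A α β ∧ Prec A β α ∧ eval β f ≠ 0 := by
    by_contra! hn
    exact hf (h f hn)
  obtain ⟨x, rfl⟩ := exists_eq_add_of_prec hA h1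
  refine ⟨x, h1, h2, fun σ hσ => ?_⟩
  by_contra! hle
  refine hβ ?_
  simp only [f, map_prod]
  refine Finset.prod_eq_zero ((finite_facets A).mem_toFinset.mpr hσ)
    (Finset.prod_eq_zero (Finset.mem_Icc.mpr (abs_le.mp hle)) ?_)
  rw [map_sub, eval_linPoly, eval_C]
  change supportFn A σ _ - _ = 0
  rw [supportFn_add, supportFn_castVec, sub_self]

/-- Once `|F_σ(x)|` is large its sign is forced. On `𝓕₊(α)` a negative value would make `F_σ(α + x)`
negative; on `𝓕₋(α)` a positive one would take it past the conductor of `F_σ(ℕA)`. Either would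
change `𝓕₊`. -/
theorem ClassIsZariskiDense.exists_shift (hA : AddSubgroup.closure (A : Set (Fin d → ℤ)) = ⊤)
    (h : ClassIsZariskiDense A α) (M : ℕ) : ∃ x : Fin d → ℤ,
      Prec A (α + castVec ℂ x) α ∧ (∀ σ ∈ facetsPos A α, (M : ℤ) < supportFn A σ x) ∧
        ∀ σ ∈ facetsNeg A α, (supportFn A σ x : ℤ) < 0 := by
  obtain ⟨N, hN, -⟩ := exists_conductor_facets hA
  obtain ⟨B, hB⟩ := exists_bound_supportFn A α
  obtain ⟨x, h1, h2, hx⟩ := h.exists_large hA (M + N + B)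
  have hval : ∀ σ, ∀ m : ℤ, supportFn A σ α = m →
      supportFn A σ (α + castVec ℂ x) = ((m + supportFn A σ x : ℤ) : ℂ) := fun σ m hm => by
    rw [supportFn_add, supportFn_castVec, hm]; push_cast; rfl
  refine ⟨x, h2, fun σ hσ => ?_, fun σ hσ => ?_⟩
  · obtain ⟨hf, b, hb, hαb⟩ := hσ
    obtain ⟨-, b', hb', h⟩ := mem_facetsPos_of_prec hA h1 ⟨hf, b, hb, hαb⟩
    rw [hval σ _ hαb] at h
    have h : supportFn A σ b + supportFn A σ x = supportFn A σ b' := by exact_mod_cast h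
    have h3 := supportFn_nonneg hA hf hb'
    have h4 := hB σ hf _ hαb
    have h5 := hx σ hf
    rw [abs_le] at h4
    rcases lt_abs.mp h5 with h5 | h5 <;> push_cast at h5 <;> omega
  · obtain ⟨hf, ⟨m, hm⟩, hnot⟩ := hσ
    by_contra! hpos
    have h4 := abs_le.mp (hB σ hf _ hm)
    have h5 := hx σ hf
    rw [abs_of_nonneg hpos] at h5
    obtain ⟨b, hb, hbm⟩ := hN σ hf (m + supportFn A σ x) (by push_cast at h5; omega)
    obtain ⟨-, b', hb', h⟩ := mem_facetsPos_of_prec hA h2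
      (σ := σ) ⟨hf, b, hb, by rw [hval σ m hm, hbm]⟩
    exact hnot ⟨b', hb', h⟩

theorem ClassIsZariskiDense.openCone_nonempty
    (hA : AddSubgroup.closure (A : Set (Fin d → ℤ)) = ⊤) (h : ClassIsZariskiDense A α) :
    (openCone A α).Nonempty := by
  obtain ⟨x, -, hpos, hneg⟩ := h.exists_shift hA 0
  refine ⟨castVec ℝ x, fun σ hσ => ?_, fun σ hσ => ?_⟩
  · rw [supportFn_castVec]; exact_mod_cast hpos σ hσ
  · rw [supportFn_castVec]; exact_mod_cast hneg σ hσ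

/-- A shift inside the class lifts every integral `α - l` past the conductor on the facets
containing `τ`. Hence `l` lies in `E_τ(α + x)`, and so in `E_τ(α)`. -/
theorem ClassIsZariskiDense.isExtremeParam
    (hA : AddSubgroup.closure (A : Set (Fin d → ℤ)) = ⊤) (h : ClassIsZariskiDense A α) :
    IsExtremeParam A α := by
  rintro τ hτ l hl ⟨a, ha⟩
  obtain ⟨N, -, hN⟩ := exists_conductor_facets hA
  obtain ⟨x, hprec, hpos, -⟩ := h.exists_shift hA N
  obtain ⟨z, hz, hxz⟩ := hN τ hτ.1 (a + x) fun σ hσ hle => by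
    have h1 := hpos σ (hτ.2.2 σ hσ hle)
    obtain ⟨-, b, hb, hαb⟩ := hτ.2.2 σ hσ hle
    rw [supportFn_eq_of_sub_eq hA hσ hle hl ha] at hαb
    have h2 : supportFn A σ a = supportFn A σ b := by exact_mod_cast hαb
    have h3 := supportFn_nonneg hA hσ hb
    rw [supportFn_add]
    omega
  refine hprec τ hτ.1 (mk_mem_E_iff.mpr ⟨hl, _, hxz, -z, neg_mem hz, ?_⟩)
  rw [add_sub_right_comm, ha, ← map_add]
  congr 1
  abel

/-- The conductor gives `α ⪯ α + x`. Conversely, `E_τ(α + x)` being nonempty makes `F_σ(α + x)`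
nonnegative on the facets containing `τ`, which rules out `𝓕₋(α)`; so `τ ∈ Face(α)` and extremeness
applies. -/
theorem prec_add_of_large (hA : AddSubgroup.closure (A : Set (Fin d → ℤ)) = ⊤)
    (hext : IsExtremeParam A α) : ∃ M : ℕ, ∀ x : Fin d → ℤ,
      (∀ σ ∈ facetsPos A α, (M : ℤ) ≤ supportFn A σ x) →
      (∀ σ ∈ facetsNeg A α, (supportFn A σ x : ℤ) ≤ -M) →
        Prec A α (α + castVec ℂ x) ∧ Prec A (α + castVec ℂ x) α := by
  obtain ⟨N, -, hN⟩ := exists_conductor_facets hA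
  obtain ⟨B, hB⟩ := exists_bound_supportFn A α
  refine ⟨N + B + 1, fun x hpos hneg => ⟨fun τ hτ q hq => ?_, fun τ hτ q hq => ?_⟩⟩ <;>
    obtain ⟨l, rfl⟩ := QuotientAddGroup.mk_surjective q
  · have hface := mem_faceSet_of_mem_E hA hτ hq
    obtain ⟨hl, b, hb, z, hz, h⟩ := mk_mem_E_iff.mp hq
    obtain ⟨w, hw, hxw⟩ := hN τ hτ (b + z + x) fun σ hσ hle => by
      have h1 := hpos σ (hface.2.2 σ hσ hle)
      have h2 := supportFn_nonneg hA hσ hb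
      rw [supportFn_add, supportFn_add, supportFn_eq_zero_of_mem_faceLattice hA hσ hle hz]
      push_cast at h1
      omega
    refine mk_mem_E_iff.mpr ⟨hl, _, hxw, -w, neg_mem hw, ?_⟩
    rw [add_sub_right_comm, h, ← map_add]
    congr 1
    abel
  · have hface := mem_faceSet_of_mem_E hA hτ hq
    obtain ⟨hl, b, hb, z, hz, h⟩ := mk_mem_E_iff.mp hq
    have hint : α - l = castVec ℂ (b + z - x) := by
      rw [map_sub, ← h]; abel
    refine hext τ ⟨hτ, ⟨l, hl, _, hint⟩, fun σ hσ hle => ?_⟩ l hl ⟨_, hint⟩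
    have hα := supportFn_eq_of_sub_eq hA hσ hle hl hint
    by_contra hnot
    have hn : σ ∈ facetsNeg A α := ⟨hσ, ⟨_, hα⟩, fun ⟨b, hb, h⟩ => hnot ⟨hσ, b, hb, h⟩⟩
    have h1 := hneg σ hn
    have h2 := abs_le.mp (hB σ hσ _ hα)
    rw [supportFn_sub, supportFn_add, supportFn_eq_zero_of_mem_faceLattice hA hσ hle hz] at h2
    have h3 := supportFn_nonneg hA hσ hb
    push_cast at h1
    omega

theorem exists_int_mem_openCone (h : (openCone A α).Nonempty) : ∃ x : Fin d → ℤ,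
    (∀ σ ∈ facetsPos A α, 0 < (supportFn A σ x : ℤ)) ∧
      ∀ σ ∈ facetsNeg A α, (supportFn A σ x : ℤ) < 0 := by
  obtain ⟨γ, hpos, hneg⟩ := h
  have hbd : ∀ σ, ∃ K : ℝ, ∀ y : Fin d → ℝ, |supportFn A σ (fun i => Int.fract (y i))| ≤ K := by
    refine fun σ => ⟨∑ i, |(supportCoeff A σ i : ℝ)|, fun y => ?_⟩
    rw [supportFn, linForm]
    refine (Finset.abs_sum_le_sum_abs _ _).trans (Finset.sum_le_sum fun i _ => ?_)
    rw [abs_mul, abs_of_nonneg (Int.fract_nonneg (y i))]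
    exact mul_le_of_le_one_right (abs_nonneg _) (Int.fract_lt_one _).le
  choose K hK using hbd
  -- Division by zero gives 0 where `F_σ(γ) = 0`; only facets with nonzero value are used. For `n >
  -- B` the scaled value `n F_σ(γ)` outweighs the rounding error.
  obtain ⟨B, hB⟩ := ((finite_facets A).image fun σ => K σ / |supportFn A σ γ|).bddAbove
  obtain ⟨n, hn⟩ := exists_nat_gt B
  have hlarge : ∀ σ ∈ facets A, supportFn A σ γ ≠ 0 → K σ < n * |supportFn A σ γ| := by
    intro σ hσ h0
    have : K σ / |supportFn A σ γ| < n := (hB ⟨σ, hσ, rfl⟩).trans_lt hn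
    rwa [div_lt_iff₀ (abs_pos.mpr h0)] at this
  have hval : ∀ σ, (((supportFn A σ fun i => ⌊n * γ i⌋) : ℤ) : ℝ) =
      n * supportFn A σ γ - supportFn A σ (fun i => Int.fract (n * γ i)) := fun σ => by
    rw [← supportFn_castVec, ← smul_eq_mul (n : ℝ), supportFn, supportFn, supportFn, smul_eq_mul,
      ← linForm_smul, ← linForm_sub]
    congr 1
    ext i
    exact (Int.self_sub_fract _).symm
  refine ⟨fun i => ⌊n * γ i⌋, fun σ hσ => ?_, fun σ hσ => ?_⟩
  · have h1 := hlarge σ hσ.1 (hpos σ hσ).ne'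
    have h2 := (abs_le.mp (hK σ fun i => n * γ i)).2
    rw [abs_of_pos (hpos σ hσ)] at h1
    have := hval σ
    exact_mod_cast (by linarith : (0 : ℝ) < ((supportFn A σ fun i => ⌊n * γ i⌋) : ℤ))
  · have h1 := hlarge σ hσ.1 (hneg σ hσ).ne
    have h2 := (abs_le.mp (hK σ fun i => n * γ i)).1
    rw [abs_of_neg (hneg σ hσ)] at h1
    have := hval σ
    exact_mod_cast (by linarith : (((supportFn A σ fun i => ⌊n * γ i⌋) : ℤ) : ℝ) < 0)

/-- For every lattice point `y`, the points `α + y + m x` lie in the class for large `m`. So `f`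
vanishes along this line, in particular at `α + y`. -/
theorem classIsZariskiDense_of_extreme (hA : AddSubgroup.closure (A : Set (Fin d → ℤ)) = ⊤)
    (hext : IsExtremeParam A α) (hne : (openCone A α).Nonempty) : ClassIsZariskiDense A α := by
  intro f hf
  obtain ⟨M, hM⟩ := prec_add_of_large hA hext
  obtain ⟨x, hpos, hneg⟩ := exists_int_mem_openCone hne
  refine eq_zero_of_eval_add_castVec f α fun y => ?_
  obtain ⟨B, hB⟩ := ((finite_facets A).image fun σ => (supportFn A σ y : ℤ).natAbs).bddAbove
  have hB : ∀ σ ∈ facets A, (supportFn A σ y : ℤ).natAbs ≤ B := fun σ hσ => hB ⟨σ, hσ, rfl⟩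
  have := eval_line_eq_zero f (α + castVec ℂ y) (castVec ℂ x) (infinite_natCast_ge (M + B)) ?_ 0
  · simpa using this
  rintro _ ⟨m, hm, rfl⟩
  have hadd : α + castVec ℂ y + (m : ℂ) • castVec ℂ x = α + castVec ℂ (y + m • x) := by
    rw [map_add, map_nsmul, Nat.cast_smul_eq_nsmul, add_assoc]
  have hm' : ((M + B : ℕ) : ℤ) ≤ m := by exact_mod_cast hm
  rw [hadd]
  refine (fun h => hf _ h.1 h.2) (hM (y + m • x) (fun σ hσ => ?_) fun σ hσ => ?_)
  · have h3 := hB σ hσ.1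
    have h4 : (m : ℤ) * 1 ≤ m * supportFn A σ x :=
      mul_le_mul_of_nonneg_left (hpos σ hσ) (by positivity)
    rw [supportFn_add, supportFn_nsmul]
    push_cast at hm'
    omega
  · have h3 := hB σ hσ.1
    have h4 : (m : ℤ) * 1 ≤ m * -supportFn A σ x :=
      mul_le_mul_of_nonneg_left (by have := hneg σ hσ; omega) (by positivity)
    rw [mul_neg] at h4
    rw [supportFn_add, supportFn_nsmul]
    push_cast at hm'
    omega

theorem conditions_iff_forall_dense (hA : AddSubgroup.closure (A : Set (Fin d → ℤ)) = ⊤) :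
    ((∀ C : Quotient (paramSetoid A), IsExtremeClass A C) ∧
      ∀ α : Fin d → ℂ, (openCone A α).Nonempty) ↔ ∀ α, ClassIsZariskiDense A α := by
  rw [forall_isExtremeClass_iff hA]
  exact ⟨fun h α => classIsZariskiDense_of_extreme hA (h.1 α) (h.2 α),
    fun h => ⟨fun α => (h α).isExtremeParam hA, fun α => (h α).openCone_nonempty hA⟩⟩

end ToricDiff

/-! ### The preorder and polynomials vanishing on gaps; polynomial functions on monoids -/

namespace ToricDiff

open MvPolynomial

variable {d : ℕ} {A : Finset (Fin d → ℤ)} {α : Fin d → ℂ} {e : Fin d → ℤ}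

/-- `f` vanishes on `Ω(e) = ℕA ∖ (-e + ℕA)`. -/
def VanishesOnGap (A : Finset (Fin d → ℤ)) (e : Fin d → ℤ) (f : MvPolynomial (Fin d) ℂ) : Prop :=
  ∀ b ∈ semigp A, b + e ∉ semigp A → eval (castVec ℂ b) f = 0

/-- If a class of `E_τ(α)` were lost in `E_τ(α + e)`, the whole of `b + ℕ(A ∩ τ)` would lie in the
gap. Then `f` would vanish on `b + ℂ(A ∩ τ)`, which contains `α`. -/
theorem VanishesOnGap.prec {f : MvPolynomial (Fin d) ℂ} (hf : VanishesOnGap A e f)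
    (hα : eval α f ≠ 0) : Prec A α (α + castVec ℂ e) := by
  intro τ hτ q hq
  obtain ⟨l, rfl⟩ := QuotientAddGroup.mk_surjective q
  obtain ⟨hl, b, hb, z, hz, h⟩ := mk_mem_E_iff.mp hq
  by_contra hnot
  have hgap : ∀ n ∈ AddSubmonoid.closure (onFace A τ), b + n + e ∉ semigp A := by
    intro n hn hmem
    have hn' : n ∈ faceLattice A τ := AddSubgroup.le_closure_toAddSubmonoid _ hn
    refine hnot (mk_mem_E_iff.mpr ⟨hl, _, hmem, z - n, sub_mem hz hn', ?_⟩)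
    rw [add_sub_right_comm, h, ← map_add]
    congr 1
    abel
  refine hα ?_
  have hu : l + castVec ℂ z ∈ faceSpanC A τ := add_mem hl (castVec_mem_faceSpanC hz)
  have hαeq : α = castVec ℂ b + (l + castVec ℂ z) := by
    rw [map_add] at h
    rw [← sub_add_cancel α l, h]; abel
  rw [hαeq]
  refine eval_eq_zero_of_mem_span f _ (onFace A τ) (fun n hn => ?_) hu
  rw [← map_add]
  exact hf _ (add_mem hb (AddSubmonoid.closure_mono (fun a ha => ha.1) hn)) (hgap n hn)

theorem exists_affine_poly {W : Submodule ℂ (Fin d → ℂ)} {p : Fin d → ℂ} (h : α - p ∉ W) :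
    ∃ f : MvPolynomial (Fin d) ℂ, eval α f ≠ 0 ∧ ∀ u ∈ W, eval (p + u) f = 0 := by
  obtain ⟨φ, hφ, hle⟩ := Submodule.exists_le_ker_of_notMem h
  have hev : ∀ x, eval x (∑ i, C (φ (Pi.single i 1)) * (X i - C (p i))) = φ (x - p) := fun x => by
    rw [LinearMap.pi_apply_eq_sum_univ φ (x - p)]
    simp only [map_sum, map_mul, map_sub, eval_C, eval_X, Pi.sub_apply, smul_eq_mul]
    refine Finset.sum_congr rfl fun i _ => ?_
    have : (fun j => if i = j then (1 : ℂ) else 0) = Pi.single i 1 := by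
      ext j; simp [Pi.single_apply, eq_comm]
    rw [this, mul_comm]
  exact ⟨_, by rwa [hev], fun u hu => by rw [hev, add_sub_cancel_left]; exact hle hu⟩

/-- The gap inside `b + ℕS` is covered by finitely many affine spaces avoiding `α`. If some `b + ∑
n_a a` is outside the gap, every gap point has a coefficient `m_i < n_i` and lies in one of finitely
many slices with fewer generators. If everything is in the gap, one affine space `b + ℂ(A ∩ τ)`
suffices. -/
theorem exists_poly_of_prec (h : Prec A α (α + castVec ℂ e)) (S : Finset (Fin d → ℤ))
    (hS : S ⊆ A) (b : Fin d → ℤ) (hb : b ∈ semigp A) :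
    ∃ f : MvPolynomial (Fin d) ℂ, eval α f ≠ 0 ∧ ∀ m : (Fin d → ℤ) → ℕ,
      b + ∑ a ∈ S, m a • a + e ∉ semigp A → eval (castVec ℂ (b + ∑ a ∈ S, m a • a)) f = 0 := by
  classical
  induction S using Finset.strongInduction generalizing b with
  | H S ih =>
  have hsum : ∀ m : (Fin d → ℤ) → ℕ, ∑ a ∈ S, m a • a ∈ semigp A := fun m =>
    AddSubmonoid.sum_mem _ fun a ha =>
      AddSubmonoid.nsmul_mem _ (AddSubmonoid.subset_closure (hS ha)) _
  by_cases hcase : ∃ n : (Fin d → ℤ) → ℕ, b + ∑ a ∈ S, n a • a + e ∈ semigp A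
  · obtain ⟨n, hn⟩ := hcase
    have hex : ∀ i ∈ S, ∀ j : ℕ, ∃ f : MvPolynomial (Fin d) ℂ, eval α f ≠ 0 ∧
        ∀ m : (Fin d → ℤ) → ℕ, (b + j • i) + ∑ a ∈ S.erase i, m a • a + e ∉ semigp A →
          eval (castVec ℂ ((b + j • i) + ∑ a ∈ S.erase i, m a • a)) f = 0 := fun i hi j =>
      ih _ (Finset.erase_ssubset hi) ((Finset.erase_subset _ _).trans hS) _
        (add_mem hb (AddSubmonoid.nsmul_mem _ (AddSubmonoid.subset_closure (hS hi)) _))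
    choose! f hfα hf using hex
    refine ⟨∏ i ∈ S, ∏ j ∈ Finset.range (n i), f i j, ?_, fun m hm => ?_⟩
    · simp only [map_prod]
      exact Finset.prod_ne_zero_iff.mpr fun i hi =>
        Finset.prod_ne_zero_iff.mpr fun j _ => hfα i hi j
    · obtain ⟨i, hi, hlt⟩ : ∃ i ∈ S, m i < n i := by
        by_contra! hle
        refine hm ?_
        have : b + ∑ a ∈ S, m a • a + e =
            (b + ∑ a ∈ S, n a • a + e) + ∑ a ∈ S, (m a - n a) • a := by
          have h1 : ∑ a ∈ S, m a • a = ∑ a ∈ S, n a • a + ∑ a ∈ S, (m a - n a) • a := by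
            rw [← Finset.sum_add_distrib]
            refine Finset.sum_congr rfl fun a ha => ?_
            rw [← add_smul, Nat.add_sub_cancel' (hle a ha)]
          rw [h1]; abel
        rw [this]
        exact add_mem hn (hsum _)
      have hx : b + ∑ a ∈ S, m a • a = (b + m i • i) + ∑ a ∈ S.erase i, m a • a := by
        rw [← Finset.add_sum_erase _ _ hi, add_assoc]
      simp only [map_prod]
      refine Finset.prod_eq_zero hi (Finset.prod_eq_zero (Finset.mem_range.mpr hlt) ?_)
      rw [hx]
      exact hf i hi _ m (hx ▸ hm)
  · push Not at hcase
    set s : Fin d → ℤ := ∑ a ∈ S, a with hs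
    have hsA : s ∈ semigp A := by simpa [hs] using hsum fun _ => 1
    set τ := minFace A (castVec ℝ s)
    have hτ : IsFace A τ := isFace_minFace _
    have hSτ : ∀ a ∈ S, a ∈ onFace A τ := fun a ha => by
      refine ⟨hS ha, castVec_mem_cone (hS ha), 1, zero_le_one, ?_⟩
      rw [one_smul, ← map_sub, hs, ← Finset.add_sum_erase _ _ ha, add_sub_cancel_left]
      exact castVec_mem_cone_of_mem_semigp (AddSubmonoid.sum_mem _ fun b hb =>
        AddSubmonoid.subset_closure (hS (Finset.mem_of_mem_erase hb)))
    -- Otherwise `b` gives a class of `E_τ(α) ⊆ E_τ(α + e)`, so `b + e ∈ ℕA + ℤ(A ∩ τ)`. As `τ` is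
    -- the smallest face containing `s`, adding a multiple of `s` brings `b + e` into `ℕA`, against
    -- the case assumption.
    have hnot : α - castVec ℂ b ∉ faceSpanC A τ := by
      intro hmem
      have hE : (QuotientAddGroup.mk (α - castVec ℂ b) : (Fin d → ℂ) ⧸ faceLatticeC A τ) ∈
          E A τ α := mk_mem_E_iff.mpr ⟨hmem, b, hb, 0, zero_mem _, by simp⟩
      obtain ⟨-, b', hb', z, hz, heq⟩ := mk_mem_E_iff.mp (h τ hτ hE)
      have heq : b + e = b' + z := by
        apply castVec_injective ℂ
        rw [← heq, map_add]; abel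
      obtain ⟨N, hN⟩ := exists_nsmul_add_mem_semigp hsA hz
      refine hcase (fun _ => N) ?_
      have : b + ∑ a ∈ S, N • a + e = b' + (N • s + z) := by
        rw [add_right_comm, heq, hs, Finset.smul_sum]; abel
      rw [this]
      exact add_mem hb' hN
    obtain ⟨f, hfα, hf⟩ := exists_affine_poly hnot
    refine ⟨f, hfα, fun m _ => ?_⟩
    rw [map_add]
    refine hf _ (castVec_mem_faceSpanC (AddSubgroup.sum_mem _ fun a ha =>
      AddSubgroup.nsmul_mem _ (AddSubgroup.subset_closure (hSτ a ha)) _))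

theorem mem_semigp_iff {b : Fin d → ℤ} :
    b ∈ semigp A ↔ ∃ m : (Fin d → ℤ) → ℕ, b = ∑ a ∈ A, m a • a := by
  classical
  constructor
  · intro hb
    induction hb using AddSubmonoid.closure_induction with
    | mem a ha =>
      have ha : a ∈ A := ha
      exact ⟨fun x => if x = a then 1 else 0, by simp [ite_smul, ha]⟩
    | zero => exact ⟨0, by simp⟩
    | add x y _ _ hx hy =>
      obtain ⟨m, rfl⟩ := hx
      obtain ⟨n, rfl⟩ := hy
      exact ⟨m + n, by simp [add_smul, Finset.sum_add_distrib]⟩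
  · rintro ⟨m, rfl⟩
    exact AddSubmonoid.sum_mem _ fun a ha =>
      AddSubmonoid.nsmul_mem _ (AddSubmonoid.subset_closure ha) _

theorem exists_vanishesOnGap_of_prec (h : Prec A α (α + castVec ℂ e)) :
    ∃ f, VanishesOnGap A e f ∧ eval α f ≠ 0 := by
  obtain ⟨f, hα, hf⟩ := exists_poly_of_prec h A subset_rfl 0 (zero_mem _)
  refine ⟨f, fun b hb hbe => ?_, hα⟩
  obtain ⟨m, rfl⟩ := mem_semigp_iff.mp hb
  simpa using hf m (by simpa using hbe)

/-- A gap point `b` has `F_σ(b) ≥ 0` but fails the conductor bound at `b + e` for some facet, so the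
gap lies on finitely many hyperplanes. -/
theorem exists_vanishesOnGap_ne_zero (hA : AddSubgroup.closure (A : Set (Fin d → ℤ)) = ⊤)
    (e : Fin d → ℤ) : ∃ f, VanishesOnGap A e f ∧ f ≠ 0 := by
  obtain ⟨N, hN, -⟩ := exists_conductor hA
  refine ⟨∏ σ ∈ (finite_facets A).toFinset, ∏ k ∈ Finset.Icc 0 (N - supportFn A σ e),
    (linPoly (supportCoeff A σ) - C ((k : ℤ) : ℂ)), fun b hb hbe => ?_, ?_⟩
  · obtain ⟨σ, hσ, hlt⟩ : ∃ σ ∈ facets A, (supportFn A σ (b + e) : ℤ) < N := by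
      by_contra! hle
      exact hbe (hN _ hle)
    rw [supportFn_add] at hlt
    simp only [map_prod]
    refine Finset.prod_eq_zero ((finite_facets A).mem_toFinset.mpr hσ)
      (Finset.prod_eq_zero (Finset.mem_Icc.mpr
        ⟨supportFn_nonneg hA hσ hb, by omega⟩ : supportFn A σ b ∈ _) ?_)
    rw [map_sub, eval_linPoly, eval_C, linForm_castVec, supportFn, sub_self]
  · exact Finset.prod_ne_zero_iff.mpr fun σ hσ => Finset.prod_ne_zero_iff.mpr
      fun k _ => linPoly_sub_C_ne_zero
        (isPrimitiveSupport_supportCoeff hA ((finite_facets A).mem_toFinset.mp hσ)).surj _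

/-! ### Polynomial functions on a monoid -/

section PolyFn

variable {M : Type*} [AddCommMonoid M]

/-- All differences of `g` of order `k + 1` vanish. -/
def IsPolyFn : ℕ → (M → ℂ) → Prop
  | 0, g => ∀ c, fwdDiff c g = 0
  | k + 1, g => ∀ c, IsPolyFn k (fwdDiff c g)

theorem IsPolyFn.zero (k : ℕ) : IsPolyFn k (0 : M → ℂ) := by
  have h0 : ∀ c, fwdDiff c (0 : M → ℂ) = 0 := fun c => by ext x; simp [fwdDiff]
  induction k with
  | zero => exact h0
  | succ k ih => intro c; rwa [h0]

theorem IsPolyFn.succ {k : ℕ} {g : M → ℂ} (h : IsPolyFn k g) : IsPolyFn (k + 1) g := by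
  induction k generalizing g with
  | zero => intro c; rw [h c]; exact .zero 0
  | succ k ih => intro c; exact ih (h c)

theorem IsPolyFn.mono {k l : ℕ} (hkl : k ≤ l) {g : M → ℂ} (h : IsPolyFn k g) : IsPolyFn l g := by
  induction hkl with
  | refl => exact h
  | step _ ih => exact ih.succ

theorem IsPolyFn.fwdDiff {k : ℕ} {g : M → ℂ} (h : IsPolyFn k g) (c : M) :
    IsPolyFn k (fwdDiff c g) := by
  cases k with
  | zero => rw [h c]; exact .zero 0
  | succ k => exact (h c).succ

theorem IsPolyFn.add {k : ℕ} {f g : M → ℂ} (hf : IsPolyFn k f) (hg : IsPolyFn k g) :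
    IsPolyFn k (f + g) := by
  induction k generalizing f g with
  | zero => intro c; rw [fwdDiff_add, hf c, hg c, add_zero]
  | succ k ih => intro c; rw [fwdDiff_add]; exact ih (hf c) (hg c)

theorem IsPolyFn.smul {k : ℕ} {g : M → ℂ} (r : ℂ) (hg : IsPolyFn k g) : IsPolyFn k (r • g) := by
  induction k generalizing g with
  | zero => intro c; rw [fwdDiff_const_smul, hg c, smul_zero]
  | succ k ih => intro c; rw [fwdDiff_const_smul]; exact ih (hg c)

theorem IsPolyFn.shift {k : ℕ} {g : M → ℂ} (hg : IsPolyFn k g) (c : M) :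
    IsPolyFn k fun x => g (x + c) := by
  have : (fun x => g (x + c)) = g + _root_.fwdDiff c g := by ext x; simp [_root_.fwdDiff]
  rw [this]
  exact hg.add (hg.fwdDiff c)

theorem IsPolyFn.mul_addMonoidHom {k : ℕ} {g : M → ℂ} (hg : IsPolyFn k g) (φ : M →+ ℂ) :
    IsPolyFn (k + 1) fun x => g x * φ x := by
  have key : ∀ (g : M → ℂ) c, _root_.fwdDiff c (fun x => g x * φ x) =
      (fun x => _root_.fwdDiff c g x * φ x) + φ c • fun x => g (x + c) := fun g c => by
    ext x
    simp only [_root_.fwdDiff, map_add, Pi.add_apply, Pi.smul_apply, smul_eq_mul]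
    ring
  induction k generalizing g with
  | zero =>
    intro c
    rw [key, hg c]
    have : (fun x => (0 : M → ℂ) x * φ x) = 0 := by ext x; simp
    rw [this, zero_add]
    exact (hg.shift c).smul _
  | succ k ih =>
    intro c
    rw [key]
    exact (ih (hg c)).add ((hg.shift c).smul _)

theorem IsPolyFn.iterate_fwdDiff {k : ℕ} {g : M → ℂ} (h : IsPolyFn k g) (c : M) (n : ℕ) :
    IsPolyFn k ((_root_.fwdDiff c)^[n] g) := by
  induction n with
  | zero => exact h
  | succ n ih => rw [Function.iterate_succ_apply']; exact ih.fwdDiff c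

theorem IsPolyFn.iterate_fwdDiff_eq_zero {k : ℕ} {g : M → ℂ} (h : IsPolyFn k g) (c : M) :
    (_root_.fwdDiff c)^[k + 1] g = 0 := by
  induction k generalizing g with
  | zero => exact h c
  | succ k ih => rw [Function.iterate_succ_apply]; exact ih (h c)

theorem exists_poly_eval_eq_choose (l : ℕ) : ∃ p : Polynomial ℂ, ∀ n : ℕ,
    p.eval (n : ℂ) = n.choose l := by
  refine ⟨Polynomial.C ((l.factorial : ℂ)⁻¹) * descPochhammer ℂ l, fun n => ?_⟩
  rw [Polynomial.eval_mul, Polynomial.eval_C, descPochhammer_eval_eq_descFactorial,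
    Nat.descFactorial_eq_factorial_mul_choose, Nat.cast_mul,
    inv_mul_cancel_left₀ (by exact_mod_cast l.factorial_ne_zero)]

/-- Newton's forward difference formula, with the sum cut at `k` because higher differences vanish.
-/
theorem IsPolyFn.apply_add_nsmul {k : ℕ} {g : M → ℂ} (h : IsPolyFn k g) (y c : M) (n : ℕ) :
    g (y + n • c) =
      ∑ l ∈ Finset.range (k + 1), (n.choose l : ℂ) * (_root_.fwdDiff c)^[l] g y := by
  rw [shift_eq_sum_fwdDiff_iter c g n y]
  have hbig : ∀ m, k + 1 ≤ m → (_root_.fwdDiff c)^[m] g = 0 := fun m hm => by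
    obtain ⟨j, rfl⟩ := Nat.exists_eq_add_of_le' hm
    rw [Function.iterate_add_apply, h.iterate_fwdDiff_eq_zero]
    exact Function.iterate_fixed (by ext x; simp [_root_.fwdDiff]) j
  have h1 : ∀ l, (n.choose l) • (_root_.fwdDiff c)^[l] g y =
      (n.choose l : ℂ) * (_root_.fwdDiff c)^[l] g y := fun l => nsmul_eq_mul _ _
  simp only [h1]
  rcases le_total n k with hle | hle
  · refine Finset.sum_subset (Finset.range_mono (by omega)) fun l _ hl => ?_
    rw [Nat.choose_eq_zero_of_lt (by simpa using hl), Nat.cast_zero, zero_mul]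
  · refine (Finset.sum_subset (Finset.range_mono (by omega)) fun l _ hl => ?_).symm
    rw [hbig l (by simpa using hl), Pi.zero_apply, mul_zero]

theorem IsPolyFn.exists_mvPolynomial {ι : Type*} (v : ι → M) (S : Finset ι) {k : ℕ} {g : M → ℂ}
    (h : IsPolyFn k g) : ∃ Q : MvPolynomial ι ℂ, ∀ n : ι → ℕ,
      g (∑ i ∈ S, n i • v i) = eval (fun i => (n i : ℂ)) Q := by
  classical
  induction S using Finset.induction_on generalizing g with
  | empty => exact ⟨C (g 0), fun n => by simp⟩
  | insert j S hj ih =>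
    choose Q hQ using fun l => ih (h.iterate_fwdDiff (v j) l)
    choose p hp using exists_poly_eval_eq_choose
    refine ⟨∑ l ∈ Finset.range (k + 1), Polynomial.aeval (X j) (p l) * Q l, fun n => ?_⟩
    rw [Finset.sum_insert hj, add_comm, h.apply_add_nsmul, map_sum]
    refine Finset.sum_congr rfl fun l _ => ?_
    rw [hQ, map_mul, ← hp]
    congr 1
    rw [← MvPolynomial.aeval_eq_eval]
    rw [← Polynomial.aeval_algHom_apply, aeval_X, Polynomial.coe_aeval_eq_eval]

end PolyFn

/-- The polynomial `x ↦ f (x + c)`. -/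
noncomputable def shiftPoly {ι : Type*} (c : ι → ℂ) (f : MvPolynomial ι ℂ) : MvPolynomial ι ℂ :=
  bind₁ (fun i => X i + C (c i)) f

@[simp] theorem eval_shiftPoly {ι : Type*} (c x : ι → ℂ) (f : MvPolynomial ι ℂ) :
    eval x (shiftPoly c f) = eval (x + c) f := by
  have : eval x (bind₁ (fun i => X i + C (c i)) f) =
      eval (fun i => eval x (X i + C (c i))) f := by
    rw [← MvPolynomial.aeval_eq_eval, ← MvPolynomial.aeval_eq_eval]
    exact aeval_bind₁ _ _ _
  rw [shiftPoly, this]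
  congr 2
  ext i
  simp

/-- Invariance under translation by `w` holds at all sufficiently large natural points, and these
are Zariski dense. -/
theorem eval_add_eq_of_forall_nat {ι : Type*} {Q : MvPolynomial ι ℂ} (w : ι → ℤ)
    (h : ∀ m n : ι → ℕ, (∀ i, (m i : ℤ) = n i + w i) →
      eval (fun i => (m i : ℂ)) Q = eval (fun i => (n i : ℂ)) Q) (u : ι → ℂ) :
    eval (u + fun i => (w i : ℂ)) Q = eval u Q := by
  have : shiftPoly (fun i => (w i : ℂ)) Q = Q := by
    refine MvPolynomial.funext_set (fun i => {t : ℂ | ∃ m : ℕ, (w i).natAbs ≤ m ∧ t = m})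
      (fun i => infinite_natCast_ge _) fun x hx => ?_
    choose n hn hxn using fun i => hx i (Set.mem_univ i)
    obtain rfl : x = fun i => (n i : ℂ) := _root_.funext hxn
    rw [eval_shiftPoly, ← h (fun i => (n i + w i).toNat) n fun i => ?_]
    · congr 2
      ext i
      have : (((n i + w i).toNat : ℤ) : ℂ) = ((n i + w i : ℤ) : ℂ) := by
        rw [Int.toNat_of_nonneg (by have := hn i; omega)]
      push_cast at this
      exact this.symm
    · exact Int.toNat_of_nonneg (by have := hn i; omega)
  rw [← eval_shiftPoly, this]

/-- On coefficient vectors `n ∈ ℕ^A` the function is a polynomial `Q`. Since `ℤA = ℤᵈ`, coefficients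
of `b` can be chosen linearly in `b`; they may be negative, but `Q` is invariant under relations
among the generators. -/
theorem IsPolyFn.exists_eval_castVec (hA : AddSubgroup.closure (A : Set (Fin d → ℤ)) = ⊤) {k : ℕ}
    {g : semigp A → ℂ} (h : IsPolyFn k g) :
    ∃ q : MvPolynomial (Fin d) ℂ, ∀ b : semigp A, g b = eval (castVec ℂ (b : Fin d → ℤ)) q := by
  classical
  let v : A → semigp A := fun a => ⟨a, AddSubmonoid.subset_closure a.2⟩
  obtain ⟨Q, hQ⟩ := h.exists_mvPolynomial v Finset.univ
  have hv : ∀ n : A → ℕ, ((∑ a, n a • v a : semigp A) : Fin d → ℤ) = ∑ a, n a • (a : Fin d → ℤ) :=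
    fun n => by simp [v]
  have hgen : ∀ i : Fin d, ∃ m : A → ℤ, (Pi.single i 1 : Fin d → ℤ) = ∑ a, m a • (a : Fin d → ℤ) := by
    intro i
    have : (Pi.single i 1 : Fin d → ℤ) ∈ AddSubgroup.closure (Set.range ((↑) : A → Fin d → ℤ)) := by
      rw [Subtype.range_coe]
      change _ ∈ AddSubgroup.closure (A : Set (Fin d → ℤ))
      rw [hA]; trivial
    obtain ⟨m, hm⟩ := AddSubgroup.mem_closure_range_iff_of_fintype.mp this
    exact ⟨m, hm⟩
  choose m hm using hgen
  refine ⟨bind₁ (fun a => ∑ i, C (m i a : ℂ) * X i) Q, fun b => ?_⟩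
  obtain ⟨n, hn⟩ : ∃ n : A → ℕ, b = ∑ a, n a • v a := by
    obtain ⟨n, hn⟩ := mem_semigp_iff.mp b.2
    refine ⟨fun a => n a, Subtype.ext ?_⟩
    rw [hv, hn, ← Finset.sum_coe_sort A fun a => n a • a]
  -- The translation vector is the difference of two expressions of `b` in the generators, hence a
  -- relation between them.
  have hker : ∀ p q : A → ℕ, (∀ a, (p a : ℤ) = q a + (∑ i, (b : Fin d → ℤ) i * m i a - n a)) →
      eval (fun a => (p a : ℂ)) Q = eval (fun a => (q a : ℂ)) Q := by
    intro p q hpq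
    rw [← hQ, ← hQ]
    congr 1
    apply Subtype.ext
    rw [hv, hv]
    have h1 : ∀ a, p a • (a : Fin d → ℤ) = q a • (a : Fin d → ℤ) +
        ((∑ i, (b : Fin d → ℤ) i * m i a) • (a : Fin d → ℤ) - n a • (a : Fin d → ℤ)) := fun a => by
      rw [← natCast_zsmul, hpq, add_smul, sub_smul, natCast_zsmul, natCast_zsmul]
    simp only [h1, Finset.sum_add_distrib, Finset.sum_sub_distrib]
    have h2 : ∑ a : A, (∑ i, (b : Fin d → ℤ) i * m i a) • (a : Fin d → ℤ) = b := by
      simp only [Finset.sum_smul]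
      rw [Finset.sum_comm]
      simp only [mul_smul, ← Finset.smul_sum, ← hm]
      ext j
      simp [Finset.sum_apply, Pi.single_apply]
    have h3 := hv n
    rw [← hn] at h3
    rw [h2, ← h3, sub_self, add_zero]
  have hfin := eval_add_eq_of_forall_nat _ hker fun a => (n a : ℂ)
  conv_lhs => rw [hn]
  rw [hQ, ← hfin, ← MvPolynomial.aeval_eq_eval, ← MvPolynomial.aeval_eq_eval]
  rw [aeval_bind₁]
  congr 2
  ext a
  simp [mul_comm]

theorem isPolyFn_eval (f : MvPolynomial (Fin d) ℂ) :
    ∃ k, IsPolyFn k fun x : Fin d → ℤ => eval (castVec ℂ x) f := by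
  induction f using MvPolynomial.induction_on with
  | C r => exact ⟨0, fun c => by ext x; simp [fwdDiff]⟩
  | add f g hf hg =>
    obtain ⟨k, hk⟩ := hf
    obtain ⟨l, hl⟩ := hg
    refine ⟨max k l, ?_⟩
    simp only [map_add]
    exact (hk.mono (le_max_left k l)).add (hl.mono (le_max_right k l))
  | mul_X f i hf =>
    obtain ⟨k, hk⟩ := hf
    refine ⟨k + 1, ?_⟩
    simp only [map_mul, eval_X]
    exact hk.mul_addMonoidHom ((Pi.evalAddMonoidHom (fun _ => ℂ) i).comp (castVec ℂ))

end ToricDiff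

/-! ### Homogeneous operators, and simplicity from density -/

namespace ToricDiff

open MvPolynomial

noncomputable section

section DiffOp

variable {S : Type*} [CommRing S] [Algebra ℂ S]

theorem commMul_smul (f : S) (r : ℂ) (P : Module.End ℂ S) :
    commMul f (r • P) = r • commMul f P := by
  simp only [commMul, mul_smul_comm, smul_mul_assoc, smul_sub]

theorem commMul_add_left (f g : S) (P : Module.End ℂ S) :
    commMul (f + g) P = commMul f P + commMul g P := by
  ext x
  simp only [commMul, LinearMap.sub_apply, Module.End.mul_apply, LinearMap.mulLeft_apply,
    LinearMap.add_apply, add_mul, map_add]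
  abel

theorem commMul_smul_left (r : ℂ) (f : S) (P : Module.End ℂ S) :
    commMul (r • f) P = r • commMul f P := by
  ext x
  simp [commMul, smul_sub]

theorem commMul_zero_left (P : Module.End ℂ S) : commMul 0 P = 0 := by
  ext x; simp [commMul]

theorem IsDiffOpOfOrder.smul {k : ℕ} {P : Module.End ℂ S} (hP : IsDiffOpOfOrder k P) (r : ℂ) :
    IsDiffOpOfOrder k (r • P) := by
  induction k generalizing P with
  | zero => intro f g; simp [hP f g]
  | succ k ih => intro f; rw [commMul_smul]; exact ih (hP f)

theorem isDiffOpOfOrder_zero_eq_mulLeft {P : Module.End ℂ S} (hP : IsDiffOpOfOrder 0 P) :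
    P = LinearMap.mulLeft ℂ (P 1) := by
  ext g
  have := hP g 1
  rw [mul_one] at this
  rw [this, LinearMap.mulLeft_apply, mul_comm]

theorem isDiffOpOfOrder_mulLeft (r : S) : IsDiffOpOfOrder 0 (LinearMap.mulLeft ℂ r) := by
  intro f g
  simp [mul_left_comm]

/-- Multiplication by `r` as a differential operator. -/
def mulOp (r : S) : diffOps S := ⟨LinearMap.mulLeft ℂ r, 0, isDiffOpOfOrder_mulLeft r⟩

/-- Commutators with multiplications stay in the ideal and lower the order. A nonzero operator
commuting with all of them is itself multiplication by its value at 1. -/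
theorem exists_mulOp_mem (I : TwoSidedIdeal (diffOps S)) (hI : I ≠ ⊥) :
    ∃ r : S, r ≠ 0 ∧ mulOp r ∈ I := by
  obtain ⟨P, hPI, hP0⟩ : ∃ P, P ∈ I ∧ P ≠ 0 := by
    by_contra! h
    exact hI (TwoSidedIdeal.ext fun x =>
      ⟨fun hx => (TwoSidedIdeal.mem_bot _).mpr (h x hx),
        fun hx => by rw [(TwoSidedIdeal.mem_bot _).mp hx]; exact I.zero_mem⟩)
  obtain ⟨k, hk⟩ := P.2
  have hzero : ∀ P : diffOps S, P ∈ I → P ≠ 0 → IsDiffOpOfOrder 0 (P : Module.End ℂ S) →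
      ∃ r : S, r ≠ 0 ∧ mulOp r ∈ I := fun P hPI hP0 hk => by
    have heq : P = mulOp ((P : Module.End ℂ S) 1) := Subtype.ext (isDiffOpOfOrder_zero_eq_mulLeft hk)
    refine ⟨(P : Module.End ℂ S) 1, fun h => hP0 ?_, heq ▸ hPI⟩
    rw [heq, h]
    exact Subtype.ext (by ext; simp [mulOp])
  induction k generalizing P with
  | zero => exact hzero P hPI hP0 hk
  | succ k ih =>
    by_cases hall : ∀ f : S, commMul f (P : Module.End ℂ S) = 0
    · exact hzero P hPI hP0 (isDiffOpOfOrder_zero_iff.mpr hall)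
    · push Not at hall
      obtain ⟨f, hf⟩ := hall
      refine ih (mulOp f * P - P * mulOp f)
        (I.sub_mem (I.mul_mem_left _ _ hPI) (I.mul_mem_right _ _ hPI)) ?_ (hk f)
      exact fun h => hf (congrArg Subtype.val h)

end DiffOp

variable {d : ℕ} {A : Finset (Fin d → ℤ)}

open Classical in
/-- The monomial `tˣ`, or `0` when `x ∉ ℕA`. -/
def mono (A : Finset (Fin d → ℤ)) (x : Fin d → ℤ) : semigpAlgebra A :=
  if h : x ∈ semigp A then AddMonoidAlgebra.single ⟨x, h⟩ 1 else 0

open Classical in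
/-- The coefficient of `tˣ`, or `0` when `x ∉ ℕA`. -/
def coeffAt (A : Finset (Fin d → ℤ)) (x : Fin d → ℤ) : semigpAlgebra A →ₗ[ℂ] ℂ :=
  if h : x ∈ semigp A then
    Finsupp.lapply ⟨x, h⟩ ∘ₗ (AddMonoidAlgebra.coeffLinearEquiv ℂ).toLinearMap
  else 0

theorem mono_of_mem {x : Fin d → ℤ} (h : x ∈ semigp A) :
    mono A x = AddMonoidAlgebra.single ⟨x, h⟩ 1 := dif_pos h

theorem mono_of_notMem {x : Fin d → ℤ} (h : x ∉ semigp A) : mono A x = 0 := dif_neg h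

theorem coeffAt_of_mem {x : Fin d → ℤ} (h : x ∈ semigp A) (r : semigpAlgebra A) :
    coeffAt A x r = r.coeff ⟨x, h⟩ := by
  rw [coeffAt, dif_pos h]; rfl

theorem coeffAt_of_notMem {x : Fin d → ℤ} (h : x ∉ semigp A) : coeffAt A x = 0 := dif_neg h

theorem mono_mul_mono {x y : Fin d → ℤ} (hx : x ∈ semigp A) (hy : y ∈ semigp A) :
    mono A x * mono A y = mono A (x + y) := by
  rw [mono_of_mem hx, mono_of_mem hy, mono_of_mem (add_mem hx hy),
    AddMonoidAlgebra.single_mul_single, one_mul]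
  rfl

theorem coeffAt_mono_self {x : Fin d → ℤ} (hx : x ∈ semigp A) : coeffAt A x (mono A x) = 1 := by
  rw [coeffAt_of_mem hx, mono_of_mem hx]; simp

theorem coeffAt_mono_of_ne {x y : Fin d → ℤ} (h : y ≠ x) : coeffAt A y (mono A x) = 0 := by
  by_cases hy : y ∈ semigp A
  · by_cases hx : x ∈ semigp A
    · rw [coeffAt_of_mem hy, mono_of_mem hx, AddMonoidAlgebra.coeff_single,
        Finsupp.single_eq_of_ne (fun heq => h (congrArg Subtype.val heq))]
    · rw [mono_of_notMem hx, map_zero]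
  · rw [coeffAt_of_notMem hy, LinearMap.zero_apply]

theorem coeffAt_mono_mul {c : Fin d → ℤ} (hc : c ∈ semigp A) (y : Fin d → ℤ)
    (r : semigpAlgebra A) : coeffAt A (y + c) (mono A c * r) = coeffAt A y r := by
  rw [mono_of_mem hc]
  by_cases hy : y ∈ semigp A
  · rw [coeffAt_of_mem hy, coeffAt_of_mem (add_mem hy hc)]
    have : (⟨y + c, add_mem hy hc⟩ : semigp A) = ⟨c, hc⟩ + ⟨y, hy⟩ := Subtype.ext (add_comm _ _)
    rw [this, AddMonoidAlgebra.coeff_single_mul_add, one_mul]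
  · rw [coeffAt_of_notMem hy, LinearMap.zero_apply]
    by_cases hyc : y + c ∈ semigp A
    · rw [coeffAt_of_mem hyc, AddMonoidAlgebra.coeff_single_mul_of_forall_add_ne]
      intro m hm
      have := congrArg Subtype.val hm
      simp only [AddSubmonoid.coe_add] at this
      exact hy (by rw [show y = m by rw [add_comm] at this; exact (add_right_cancel this).symm]; exact m.2)
    · rw [coeffAt_of_notMem hyc, LinearMap.zero_apply]

theorem ext_coeffAt {r s : semigpAlgebra A} (h : ∀ x, coeffAt A x r = coeffAt A x s) : r = s := by
  ext ⟨x, hx⟩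
  rw [← coeffAt_of_mem hx, ← coeffAt_of_mem hx, h]

theorem mono_induction {p : semigpAlgebra A → Prop} (r : semigpAlgebra A)
    (add : ∀ r s, p r → p s → p (r + s)) (zero : p 0)
    (smul : ∀ (c : ℂ) (b : Fin d → ℤ), b ∈ semigp A → p (c • mono A b)) : p r := by
  induction r using AddMonoidAlgebra.induction_linear with
  | zero => exact zero
  | add r s hr hs => exact add r s hr hs
  | single b c =>
    have := smul c b b.2
    rwa [mono_of_mem b.2, AddMonoidAlgebra.smul_single, smul_eq_mul, mul_one] at this

theorem end_ext {P Q : Module.End ℂ (semigpAlgebra A)}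
    (h : ∀ b ∈ semigp A, P (mono A b) = Q (mono A b)) : P = Q := by
  refine LinearMap.ext fun r => ?_
  induction r using mono_induction with
  | add r s hr hs => rw [map_add, map_add, hr, hs]
  | zero => rw [map_zero, map_zero]
  | smul c b hb => rw [map_smul, map_smul, h b hb]

theorem eq_sum_mono (r : semigpAlgebra A) (F : Finset (Fin d → ℤ))
    (h : ∀ x, coeffAt A x r ≠ 0 → x ∈ F) : r = ∑ x ∈ F, coeffAt A x r • mono A x := by
  apply ext_coeffAt
  intro y
  rw [map_sum]
  by_cases hy : y ∈ F
  · rw [Finset.sum_eq_single_of_mem y hy fun x _ hxy => by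
      rw [map_smul, coeffAt_mono_of_ne hxy.symm, smul_zero]]
    by_cases hyA : y ∈ semigp A
    · rw [map_smul, coeffAt_mono_self hyA, smul_eq_mul, mul_one]
    · simp [coeffAt_of_notMem hyA]
  · rw [Finset.sum_eq_zero fun x hx => by
      rw [map_smul, coeffAt_mono_of_ne (by rintro rfl; exact hy hx), smul_zero]]
    by_contra hne
    exact hy (h y hne)

theorem exists_finset_support (r : semigpAlgebra A) :
    ∃ F : Finset (Fin d → ℤ), ∀ x, x ∈ F ↔ coeffAt A x r ≠ 0 := by
  classical
  refine ⟨r.coeff.support.image Subtype.val, fun x => ?_⟩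
  simp only [Finset.mem_image, Finsupp.mem_support_iff]
  constructor
  · rintro ⟨b, hb, rfl⟩
    rwa [coeffAt_of_mem b.2]
  · intro h
    by_cases hx : x ∈ semigp A
    · exact ⟨⟨x, hx⟩, by rwa [coeffAt_of_mem hx] at h, rfl⟩
    · rw [coeffAt_of_notMem hx] at h
      exact absurd rfl h

/-- The homogeneous operator `tᵇ ↦ g(b) tᵇ⁺ᵃ`. -/
def homOp (A : Finset (Fin d → ℤ)) (a : Fin d → ℤ) (g : (Fin d → ℤ) → ℂ) :
    Module.End ℂ (semigpAlgebra A) :=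
  (Finsupp.linearCombination ℂ fun b : semigp A => g b • mono A (b + a)) ∘ₗ
    (AddMonoidAlgebra.coeffLinearEquiv ℂ).toLinearMap

theorem homOp_mono {a b : Fin d → ℤ} (g : (Fin d → ℤ) → ℂ) (hb : b ∈ semigp A) :
    homOp A a g (mono A b) = g b • mono A (b + a) := by
  rw [mono_of_mem hb]
  change Finsupp.linearCombination ℂ _ (Finsupp.single _ 1) = _
  rw [Finsupp.linearCombination_single, one_smul]

/-- The bracket differences the coefficient function. Vanishing on the gap is essential: there `mono
A (b + a)` is the default 0, though `b + a + c` may lie in `ℕA`. -/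
theorem commMul_mono_homOp {a c : Fin d → ℤ} {g : (Fin d → ℤ) → ℂ} (hc : c ∈ semigp A)
    (hg : ∀ b ∈ semigp A, b + a ∉ semigp A → g b = 0) :
    commMul (mono A c) (homOp A a g) = homOp A (a + c) (-fwdDiff c g) := by
  refine end_ext fun b hb => ?_
  simp only [commMul, LinearMap.sub_apply, Module.End.mul_apply, LinearMap.mulLeft_apply]
  rw [homOp_mono _ hb, mono_mul_mono hc hb, homOp_mono _ (add_mem hc hb), homOp_mono _ hb,
    mul_smul_comm]
  have h1 : g b • (mono A c * mono A (b + a)) = g b • mono A (b + (a + c)) := by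
    by_cases hba : b + a ∈ semigp A
    · rw [mono_mul_mono hc hba]; congr 2; abel
    · rw [hg b hb hba, zero_smul, zero_smul]
  rw [h1, show c + b + a = b + (a + c) by abel, ← sub_smul, add_comm c b]
  simp [fwdDiff]

theorem isDiffOpOfOrder_succ_of_mono {k : ℕ} {P : Module.End ℂ (semigpAlgebra A)}
    (h : ∀ c ∈ semigp A, IsDiffOpOfOrder k (commMul (mono A c) P)) : IsDiffOpOfOrder (k + 1) P := by
  intro f
  induction f using mono_induction with
  | add r s hr hs => rw [commMul_add_left]; exact hr.add hs
  | zero => rw [commMul_zero_left]; exact .zero k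
  | smul c b hb => rw [commMul_smul_left]; exact (h b hb).smul c

theorem isDiffOpOfOrder_homOp {k : ℕ} {a : Fin d → ℤ} {g : (Fin d → ℤ) → ℂ} (hk : IsPolyFn k g)
    (hg : ∀ b ∈ semigp A, b + a ∉ semigp A → g b = 0) : IsDiffOpOfOrder (k + 1) (homOp A a g) := by
  induction k generalizing a g with
  | zero =>
    refine isDiffOpOfOrder_succ_of_mono fun c hc => ?_
    rw [commMul_mono_homOp hc hg, hk c]
    have : homOp A (a + c) (-0) = 0 := end_ext fun b hb => by simp [homOp_mono _ hb]
    rw [this]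
    exact .zero 0
  | succ k ih =>
    refine isDiffOpOfOrder_succ_of_mono fun c hc => ?_
    rw [commMul_mono_homOp hc hg]
    refine ih (by simpa using (hk c).smul (-1)) fun b hb hbac => ?_
    have h1 : g (b + c) = 0 := hg _ (add_mem hb hc) (by rwa [add_assoc, add_comm c a])
    have h2 : g b = 0 := hg b hb fun hmem => hbac (by rw [← add_assoc]; exact add_mem hmem hc)
    simp [fwdDiff, h1, h2]

/-- The differential operator `tᵇ ↦ f(b) tᵇ⁺ᵉ`, for `f` that vanishes on `Ω(e)`. -/
def polyOp (e : Fin d → ℤ) (f : MvPolynomial (Fin d) ℂ) (hf : VanishesOnGap A e f) :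
    diffOps (semigpAlgebra A) :=
  ⟨homOp A e fun x => eval (castVec ℂ x) f,
    (isPolyFn_eval f).elim fun k hk => ⟨k + 1, isDiffOpOfOrder_homOp hk hf⟩⟩

theorem coe_polyOp {e : Fin d → ℤ} {f : MvPolynomial (Fin d) ℂ} (hf : VanishesOnGap A e f) :
    (polyOp e f hf : Module.End ℂ (semigpAlgebra A)) =
      homOp A e fun x => eval (castVec ℂ x) f := rfl

theorem polyOp_mono {e b : Fin d → ℤ} {f : MvPolynomial (Fin d) ℂ} (hf : VanishesOnGap A e f)
    (hb : b ∈ semigp A) : (polyOp e f hf : Module.End ℂ (semigpAlgebra A)) (mono A b) =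
      eval (castVec ℂ b) f • mono A (b + e) := by
  rw [coe_polyOp, homOp_mono _ hb]

theorem VanishesOnGap.comp {e e' : Fin d → ℤ} {f f' : MvPolynomial (Fin d) ℂ}
    (hf : VanishesOnGap A e f) (hf' : VanishesOnGap A e' f') :
    VanishesOnGap A (e' + e) (shiftPoly (castVec ℂ e') f * f') := by
  intro b hb hbe
  rw [map_mul, eval_shiftPoly, ← map_add]
  by_cases h : b + e' ∈ semigp A
  · rw [hf _ h (by rwa [add_assoc]), zero_mul]
  · rw [hf' b hb h, mul_zero]

theorem polyOp_mul {e e' : Fin d → ℤ} {f f' : MvPolynomial (Fin d) ℂ}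
    (hf : VanishesOnGap A e f) (hf' : VanishesOnGap A e' f') :
    polyOp e f hf * polyOp e' f' hf' =
      polyOp (e' + e) (shiftPoly (castVec ℂ e') f * f') (hf.comp hf') := by
  refine Subtype.ext (end_ext fun b hb => ?_)
  rw [polyOp_mono _ hb]
  change (polyOp e f hf : Module.End ℂ (semigpAlgebra A))
    ((polyOp e' f' hf' : Module.End ℂ (semigpAlgebra A)) (mono A b)) = _
  rw [polyOp_mono _ hb, map_smul, map_mul, eval_shiftPoly, ← map_add]
  by_cases h : b + e' ∈ semigp A
  · rw [polyOp_mono _ h, smul_smul, mul_comm, add_assoc]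
  · rw [hf' b hb h, zero_smul, mul_zero, zero_smul]

theorem vanishesOnGap_of_mem {e : Fin d → ℤ} (he : e ∈ semigp A) (f : MvPolynomial (Fin d) ℂ) :
    VanishesOnGap A e f := fun _ hb h => absurd (add_mem hb he) h

theorem mulOp_mono {c : Fin d → ℤ} (hc : c ∈ semigp A) :
    mulOp (mono A c) = polyOp c 1 (vanishesOnGap_of_mem hc 1) := by
  refine Subtype.ext (end_ext fun b hb => ?_)
  rw [polyOp_mono _ hb, map_one, one_smul, add_comm b c]
  exact mono_mul_mono hc hb

/-- The operator `tᵇ ↦ f(b) tᵇ`. -/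
def weightOp (A : Finset (Fin d → ℤ)) (f : MvPolynomial (Fin d) ℂ) : diffOps (semigpAlgebra A) :=
  polyOp 0 f (vanishesOnGap_of_mem (zero_mem _) f)

theorem weightOp_mono {b : Fin d → ℤ} (f : MvPolynomial (Fin d) ℂ) (hb : b ∈ semigp A) :
    (weightOp A f : Module.End ℂ (semigpAlgebra A)) (mono A b) = eval (castVec ℂ b) f • mono A b := by
  rw [weightOp, polyOp_mono _ hb, add_zero]

theorem coeffAt_weightOp (f : MvPolynomial (Fin d) ℂ) (x : Fin d → ℤ) (r : semigpAlgebra A) :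
    coeffAt A x ((weightOp A f : Module.End ℂ (semigpAlgebra A)) r) =
      eval (castVec ℂ x) f * coeffAt A x r := by
  induction r using mono_induction with
  | add r s hr hs => rw [map_add, map_add, map_add, hr, hs, mul_add]
  | zero => simp
  | smul c b hb =>
    rw [map_smul, map_smul, map_smul, weightOp_mono _ hb, map_smul]
    by_cases h : x = b
    · subst h; simp only [smul_eq_mul]; ring
    · rw [coeffAt_mono_of_ne h]; simp

theorem weightOp_mul (f g : MvPolynomial (Fin d) ℂ) :
    weightOp A (f * g) = weightOp A f * weightOp A g := by
  refine Subtype.ext (end_ext fun b hb => ?_)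
  rw [weightOp_mono _ hb]
  change _ = (weightOp A f : Module.End ℂ (semigpAlgebra A))
    ((weightOp A g : Module.End ℂ (semigpAlgebra A)) (mono A b))
  rw [weightOp_mono _ hb, map_smul, weightOp_mono _ hb, smul_smul, map_mul, mul_comm]

theorem weightOp_add (f g : MvPolynomial (Fin d) ℂ) :
    weightOp A (f + g) = weightOp A f + weightOp A g := by
  refine Subtype.ext (end_ext fun b hb => ?_)
  rw [weightOp_mono _ hb]
  change _ = (weightOp A f : Module.End ℂ (semigpAlgebra A)) (mono A b) +
    (weightOp A g : Module.End ℂ (semigpAlgebra A)) (mono A b)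
  rw [weightOp_mono _ hb, weightOp_mono _ hb, map_add, add_smul]

theorem weightOp_one : weightOp A 1 = 1 := by
  refine Subtype.ext (end_ext fun b hb => ?_)
  rw [weightOp_mono _ hb, map_one, one_smul]
  rfl

theorem weightOp_zero : weightOp A 0 = 0 := by
  refine Subtype.ext (end_ext fun b hb => ?_)
  rw [weightOp_mono _ hb, map_zero, zero_smul]
  rfl

theorem polyOp_zero_eq {e : Fin d → ℤ} (he : e = 0) (f : MvPolynomial (Fin d) ℂ)
    (hf : VanishesOnGap A e f) : polyOp e f hf = weightOp A f := by
  subst he; rfl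

/-- The weight operator of `X i` is the Euler derivation `tᵇ ↦ b_i tᵇ`, so this is the Leibniz rule.
-/
theorem commutator_weightOp_mulOp (i : Fin d) (r : semigpAlgebra A) :
    weightOp A (X i) * mulOp r - mulOp r * weightOp A (X i) =
      mulOp ((weightOp A (X i) : Module.End ℂ (semigpAlgebra A)) r) := by
  refine Subtype.ext (end_ext fun b hb => ?_)
  change (weightOp A (X i) : Module.End ℂ (semigpAlgebra A)) (r * mono A b) -
    r * (weightOp A (X i) : Module.End ℂ (semigpAlgebra A)) (mono A b) =
      (weightOp A (X i) : Module.End ℂ (semigpAlgebra A)) r * mono A b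
  rw [weightOp_mono _ hb]
  induction r using mono_induction with
  | add r s hr hs =>
    rw [map_add, add_mul, add_mul, add_mul, map_add, ← hr, ← hs]; abel
  | zero => simp
  | smul c a ha =>
    rw [map_smul, smul_mul_assoc, map_smul, mono_mul_mono ha hb, weightOp_mono _ (add_mem ha hb),
      weightOp_mono _ ha]
    simp only [smul_mul_assoc, mul_smul_comm, mono_mul_mono ha hb, smul_smul, ← sub_smul]
    congr 1
    simp
    ring

theorem exists_mono_mem (I : TwoSidedIdeal (diffOps (semigpAlgebra A))) (r : semigpAlgebra A)
    (hr : r ≠ 0) (hrI : mulOp r ∈ I) : ∃ c ∈ semigp A, mulOp (mono A c) ∈ I := by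
  classical
  obtain ⟨F, hF⟩ := exists_finset_support r
  induction F using Finset.strongInduction generalizing r with
  | H F ih =>
  have hrF := eq_sum_mono r F fun x hx => (hF x).mpr hx
  obtain ⟨c, hc⟩ : F.Nonempty := by
    by_contra! h
    exact hr (by rw [hrF, h, Finset.sum_empty])
  have hsmul : ∀ (z : ℂ) (s : semigpAlgebra A), mulOp s ∈ I → mulOp (z • s) ∈ I := fun z s hs => by
    have : mulOp (z • s) = algebraMap ℂ _ z * mulOp s := by
      refine Subtype.ext (LinearMap.ext fun x => ?_)
      change (z • s) * x = z • (s * x)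
      rw [smul_mul_assoc]
    rw [this]
    exact I.mul_mem_left _ _ hs
  by_cases hone : ∀ x ∈ F, x = c
  · have hcoef := (hF c).mp hc
    have hcA : c ∈ semigp A := by
      by_contra h
      exact hcoef (by rw [coeffAt_of_notMem h]; rfl)
    have hFc : F = {c} := Finset.eq_singleton_iff_unique_mem.mpr ⟨hc, hone⟩
    rw [hFc, Finset.sum_singleton] at hrF
    refine ⟨c, hcA, ?_⟩
    have := hsmul (coeffAt A c r)⁻¹ r hrI
    nth_rw 2 [hrF] at this
    rwa [inv_smul_smul₀ hcoef] at this
  · push Not at hone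
    obtain ⟨x, hx, hxc⟩ := hone
    obtain ⟨i, hi⟩ := Function.ne_iff.mp hxc
    -- Two exponents `x ≠ c` differ in coordinate `i`. The Euler derivation minus `c i` kills the
    -- term at `c` and keeps the one at `x`, so the support shrinks but stays nonempty.
    set s := (weightOp A (X i) : Module.End ℂ (semigpAlgebra A)) r + (-(c i : ℂ)) • r with hs
    have hcoef : ∀ y, coeffAt A y s = ((y i : ℂ) - c i) * coeffAt A y r := fun y => by
      rw [hs, map_add, coeffAt_weightOp, map_smul, smul_eq_mul, eval_X, castVec_apply]; ring
    have hsI : mulOp s ∈ I := by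
      have h1 : mulOp s = mulOp ((weightOp A (X i) : Module.End ℂ (semigpAlgebra A)) r) +
          mulOp ((-(c i : ℂ)) • r) :=
        Subtype.ext (LinearMap.ext fun x => add_mul _ _ _)
      rw [h1, ← commutator_weightOp_mulOp]
      exact I.add_mem (I.sub_mem (I.mul_mem_left _ _ hrI) (I.mul_mem_right _ _ hrI))
        (hsmul _ _ hrI)
    refine ih (F.filter fun y => y i ≠ c i) ?_ s ?_ hsI fun y => ?_
    · exact Finset.filter_ssubset.mpr ⟨c, hc, by simp⟩
    · intro h0
      have := hcoef x
      rw [h0, map_zero] at this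
      rcases mul_eq_zero.mp this.symm with h | h
      · exact hi (by exact_mod_cast sub_eq_zero.mp h)
      · exact (hF x).mp hx h
    · rw [hcoef, Finset.mem_filter, hF, mul_ne_zero_iff, sub_ne_zero]
      constructor
      · rintro ⟨h1, h2⟩; exact ⟨by exact_mod_cast h2, h1⟩
      · rintro ⟨h1, h2⟩; exact ⟨h2, by exact_mod_cast h1⟩

theorem shiftPoly_ne_zero {ι : Type*} (c : ι → ℂ) {f : MvPolynomial ι ℂ} (hf : f ≠ 0) :
    shiftPoly c f ≠ 0 := by
  intro h
  refine hf (MvPolynomial.funext fun x => ?_)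
  rw [← sub_add_cancel x c, ← eval_shiftPoly, h, map_zero, map_zero]

/-- The ideal of the polynomials `f` whose weight operator lies in `I`. -/
def weightIdeal (I : TwoSidedIdeal (diffOps (semigpAlgebra A))) :
    Ideal (MvPolynomial (Fin d) ℂ) where
  carrier := {f | weightOp A f ∈ I}
  add_mem' {f g} hf hg := by
    change weightOp A (f + g) ∈ I
    rw [weightOp_add]; exact I.add_mem hf hg
  zero_mem' := by
    change weightOp A 0 ∈ I
    rw [weightOp_zero]; exact I.zero_mem
  smul_mem' f g hg := by
    change weightOp A (f * g) ∈ I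
    rw [weightOp_mul]; exact I.mul_mem_left _ _ hg

instance : Nontrivial (diffOps (semigpAlgebra A)) := by
  refine ⟨⟨0, 1, fun h => ?_⟩⟩
  have h1 := LinearMap.congr_fun (congrArg Subtype.val h) 1
  exact zero_ne_one h1

theorem isSimpleRing_of_dense (hA : AddSubgroup.closure (A : Set (Fin d → ℤ)) = ⊤)
    (h : ∀ α, ClassIsZariskiDense A α) : IsSimpleRing (diffOps (semigpAlgebra A)) := by
  refine IsSimpleRing.of_eq_bot_or_eq_top fun I => ?_
  refine or_iff_not_imp_left.mpr fun hI => I.one_mem_iff.mp ?_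
  obtain ⟨r, hr, hrI⟩ := exists_mulOp_mem I hI
  obtain ⟨c, hc, hcI⟩ := exists_mono_mem I r hr hrI
  obtain ⟨g, hg, hg0⟩ := exists_vanishesOnGap_ne_zero hA (-c)
  -- Composing `t^c` with an operator of degree `-c` lands in degree 0, with a shifted polynomial
  -- that is still nonzero.
  have hhJ : shiftPoly (castVec ℂ c) g ∈ weightIdeal I := by
    change weightOp A _ ∈ I
    have := I.mul_mem_left (polyOp (-c) g hg) _ hcI
    rw [mulOp_mono hc, polyOp_mul, polyOp_zero_eq (add_neg_cancel c), mul_one] at this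
    exact this
  set p := shiftPoly (castVec ℂ c) g
  have hp0 : p ≠ 0 := shiftPoly_ne_zero _ hg0
  by_contra hone
  have hJ : weightIdeal I ≠ ⊤ := fun htop => hone <| by
    have : (1 : MvPolynomial (Fin d) ℂ) ∈ weightIdeal I := by rw [htop]; trivial
    have h1 : weightOp A 1 ∈ I := this
    rwa [weightOp_one] at h1
  obtain ⟨m, hm, hle⟩ := Ideal.exists_le_maximal _ hJ
  -- By the Nullstellensatz, the polynomials of a proper ideal have a common zero `α`.
  obtain ⟨α, rfl⟩ := MvPolynomial.isMaximal_iff_eq_vanishingIdeal_singleton.mp hm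
  obtain ⟨β, h1, h2, hβ⟩ : ∃ β, Prec A α β ∧ Prec A β α ∧ eval β p ≠ 0 := by
    by_contra! hn
    exact hp0 (h α p hn)
  obtain ⟨x, rfl⟩ := exists_eq_add_of_prec hA h1
  obtain ⟨u, hu, huα⟩ := exists_vanishesOnGap_of_prec h1
  obtain ⟨w, hw, hwβ⟩ := exists_vanishesOnGap_of_prec (α := α + castVec ℂ x) (e := -x)
    (by simpa using h2)
  -- A loop from `α` to `α + x` and back: its value at `α` is `w(α + x) p(α + x) u(α)`, a product of
  -- three nonzero numbers.
  have hmem : polyOp (-x) w hw * (weightOp A p * polyOp x u hu) ∈ I :=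
    I.mul_mem_left _ _ (I.mul_mem_right _ _ hhJ)
  rw [weightOp, polyOp_mul, polyOp_mul, polyOp_zero_eq (by abel)] at hmem
  have := hle (show _ ∈ weightIdeal I from hmem)
  rw [MvPolynomial.mem_vanishingIdeal_singleton_iff, MvPolynomial.aeval_eq_eval] at this
  simp only [map_mul] at this
  change eval α _ * (eval α _ * eval α _) = 0 at this
  rw [eval_shiftPoly, eval_shiftPoly, add_zero] at this
  exact mul_ne_zero hwβ (mul_ne_zero hβ huα) this

end

end ToricDiff

/-! ### Components of an operator, and density from simplicity -/

namespace ToricDiff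

open MvPolynomial

noncomputable section

variable {d : ℕ} {A : Finset (Fin d → ℤ)}

theorem map_mono_add (P : Module.End ℂ (semigpAlgebra A)) {b c : Fin d → ℤ}
    (hb : b ∈ semigp A) (hc : c ∈ semigp A) :
    P (mono A (b + c)) = mono A c * P (mono A b) - commMul (mono A c) P (mono A b) := by
  simp only [commMul, LinearMap.sub_apply, Module.End.mul_apply, LinearMap.mulLeft_apply]
  rw [mono_mul_mono hc hb, add_comm b c, sub_sub_cancel]

/-- Build `b` one generator at a time: `P(tᵇ⁺ᵍ) = t^g P(tᵇ) - [t^g, P](tᵇ)`. The first term adds no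
new degree, and the second contributes degrees from finitely many finite sets, shifted by `-g`. -/
theorem exists_degree_support_of_commMul (P : Module.End ℂ (semigpAlgebra A))
    (h : ∀ g ∈ A, ∃ F : Finset (Fin d → ℤ), ∀ b ∈ semigp A, ∀ y,
      coeffAt A (b + y) (commMul (mono A g) P (mono A b)) ≠ 0 → y ∈ F) :
    ∃ F : Finset (Fin d → ℤ), ∀ b ∈ semigp A, ∀ y,
      coeffAt A (b + y) (P (mono A b)) ≠ 0 → y ∈ F := by
  classical
  choose! F hF using h
  obtain ⟨F₀, hF₀⟩ := exists_finset_support (P (mono A 0))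
  refine ⟨F₀ ∪ A.biUnion fun g => (F g).image fun y => y - g, fun b hb => ?_⟩
  induction hb using AddSubmonoid.closure_induction_right with
  | zero =>
    intro y hy
    rw [zero_add] at hy
    exact Finset.mem_union_left _ ((hF₀ y).mpr hy)
  | add_right b hb g hg ih =>
    intro y hy
    have hgA : g ∈ A := hg
    rw [map_mono_add P hb (AddSubmonoid.subset_closure hg), map_sub,
      show b + g + y = b + y + g by abel, coeffAt_mono_mul (AddSubmonoid.subset_closure hg)] at hy
    by_cases h0 : coeffAt A (b + y) (P (mono A b)) = 0
    · rw [h0, zero_sub, neg_ne_zero, add_assoc] at hy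
      refine Finset.mem_union_right _ (Finset.mem_biUnion.mpr ⟨g, hgA, Finset.mem_image.mpr
        ⟨y + g, hF g hgA b hb _ hy, add_sub_cancel_right _ _⟩⟩)
    · exact ih y h0

theorem exists_degree_support {k : ℕ} {P : Module.End ℂ (semigpAlgebra A)}
    (hP : IsDiffOpOfOrder k P) : ∃ F : Finset (Fin d → ℤ), ∀ b ∈ semigp A, ∀ y,
      coeffAt A (b + y) (P (mono A b)) ≠ 0 → y ∈ F := by
  induction k generalizing P with
  | zero =>
    refine exists_degree_support_of_commMul P fun g _ => ⟨∅, fun b _ y hy => ?_⟩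
    rw [isDiffOpOfOrder_zero_iff.mp hP, LinearMap.zero_apply, map_zero] at hy
    exact absurd rfl hy
  | succ k ih => exact exists_degree_support_of_commMul P fun g _ => ih (hP _)

theorem fwdDiff_coeffAt (P : Module.End ℂ (semigpAlgebra A)) (a : Fin d → ℤ) (c : semigp A) :
    fwdDiff c (fun b : semigp A => coeffAt A (b + a) (P (mono A b))) =
      (-1 : ℂ) • fun b : semigp A => coeffAt A (b + (a + c)) (commMul (mono A c) P (mono A b)) := by
  ext b
  simp only [fwdDiff, AddSubmonoid.coe_add, Pi.smul_apply, smul_eq_mul]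
  rw [map_mono_add P b.2 c.2, map_sub, show (b + c + a : Fin d → ℤ) = b + a + c by abel,
    coeffAt_mono_mul c.2, add_assoc]
  ring

/-- Differencing the coefficients in `b` amounts, up to sign, to taking a commutator, which lowers
the order. -/
theorem isPolyFn_coeffAt {k : ℕ} {P : Module.End ℂ (semigpAlgebra A)}
    (hP : IsDiffOpOfOrder k P) (a : Fin d → ℤ) :
    IsPolyFn k fun b : semigp A => coeffAt A (b + a) (P (mono A b)) := by
  induction k generalizing P a with
  | zero =>
    intro c
    rw [fwdDiff_coeffAt, isDiffOpOfOrder_zero_iff.mp hP]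
    ext b
    simp
  | succ k ih =>
    intro c
    rw [fwdDiff_coeffAt]
    exact (ih (hP _) _).smul _

theorem exists_component (hA : AddSubgroup.closure (A : Set (Fin d → ℤ)) = ⊤)
    (P : diffOps (semigpAlgebra A)) (a : Fin d → ℤ) : ∃ q : MvPolynomial (Fin d) ℂ,
      ∀ b ∈ semigp A, coeffAt A (b + a) ((P : Module.End ℂ (semigpAlgebra A)) (mono A b)) =
        eval (castVec ℂ b) q := by
  obtain ⟨k, hk⟩ := P.2
  obtain ⟨q, hq⟩ := (isPolyFn_coeffAt hk a).exists_eval_castVec hA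
  exact ⟨q, fun b hb => hq ⟨b, hb⟩⟩

/-- `q` is the component of degree `a` of `P`: the coefficient of `tᵇ⁺ᵃ` in `P(tᵇ)` is `q(b)`. -/
def IsComponent (P : diffOps (semigpAlgebra A)) (a : Fin d → ℤ) (q : MvPolynomial (Fin d) ℂ) :
    Prop :=
  ∀ b ∈ semigp A, coeffAt A (b + a) ((P : Module.End ℂ (semigpAlgebra A)) (mono A b)) =
    eval (castVec ℂ b) q

theorem IsComponent.unique (hA : AddSubgroup.closure (A : Set (Fin d → ℤ)) = ⊤)
    {P : diffOps (semigpAlgebra A)} {a : Fin d → ℤ} {q q' : MvPolynomial (Fin d) ℂ}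
    (h : IsComponent P a q) (h' : IsComponent P a q') : q = q' := by
  rw [← sub_eq_zero]
  refine eq_zero_of_eval_semigp hA _ fun b hb => ?_
  rw [map_sub, ← h b hb, ← h' b hb, sub_self]

theorem IsComponent.vanishesOnGap {P : diffOps (semigpAlgebra A)} {a : Fin d → ℤ}
    {q : MvPolynomial (Fin d) ℂ} (h : IsComponent P a q) : VanishesOnGap A a q := by
  intro b hb hba
  rw [← h b hb, coeffAt_of_notMem hba, LinearMap.zero_apply]

theorem isComponent_polyOp {e : Fin d → ℤ} {f : MvPolynomial (Fin d) ℂ}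
    (hf : VanishesOnGap A e f) : IsComponent (polyOp e f hf) e f := by
  intro b hb
  rw [polyOp_mono hf hb, map_smul]
  by_cases h : b + e ∈ semigp A
  · rw [coeffAt_mono_self h, smul_eq_mul, mul_one]
  · rw [hf b hb h, zero_smul]

theorem isComponent_polyOp_of_ne {e a : Fin d → ℤ} {f : MvPolynomial (Fin d) ℂ}
    (hf : VanishesOnGap A e f) (ha : a ≠ e) : IsComponent (polyOp e f hf) a 0 := by
  intro b hb
  rw [polyOp_mono hf hb, map_smul, coeffAt_mono_of_ne (fun h => ha (add_left_cancel h)),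
    smul_zero, map_zero]

/-- The component of degree `a` of `Q P` in terms of those of `Q` and `P`. -/
theorem exists_isComponent_mul (Q P : diffOps (semigpAlgebra A)) {p q : (Fin d → ℤ) → MvPolynomial (Fin d) ℂ}
    (hp : ∀ a, IsComponent P a (p a)) (hq : ∀ a, IsComponent Q a (q a)) (a : Fin d → ℤ) :
    ∃ F : Finset (Fin d → ℤ), IsComponent (Q * P) a
      (∑ e ∈ F, shiftPoly (castVec ℂ e) (q (a - e)) * p e) := by
  classical
  obtain ⟨k, hk⟩ := P.2
  obtain ⟨F, hF⟩ := exists_degree_support hk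
  refine ⟨F, fun b hb => ?_⟩
  have hsum : (P : Module.End ℂ (semigpAlgebra A)) (mono A b) =
      ∑ e ∈ F, eval (castVec ℂ b) (p e) • mono A (b + e) := by
    rw [eq_sum_mono ((P : Module.End ℂ (semigpAlgebra A)) (mono A b)) (F.image (b + ·)) fun x hx =>
      Finset.mem_image.mpr ⟨x - b, hF b hb _ (by rwa [add_sub_cancel]), add_sub_cancel _ _⟩,
      Finset.sum_image fun x _ y _ h => add_left_cancel h]
    exact Finset.sum_congr rfl fun e _ => by rw [hp e b hb]
  change coeffAt A (b + a) ((Q : Module.End ℂ (semigpAlgebra A))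
    ((P : Module.End ℂ (semigpAlgebra A)) (mono A b))) = _
  rw [hsum, map_sum, map_sum, map_sum]
  refine Finset.sum_congr rfl fun e _ => ?_
  rw [map_smul, map_smul, map_mul, eval_shiftPoly, ← map_add]
  -- If `b + e ∉ ℕA`, the monomial is the default 0, and on the other side `p e` vanishes at `b`.
  by_cases hbe : b + e ∈ semigp A
  · rw [← hq (a - e) _ hbe, show b + e + (a - e) = b + a by abel, smul_eq_mul, mul_comm]
  · rw [(hp e).vanishesOnGap b hb hbe, zero_smul, mul_zero]

theorem Prec.trans {α β γ : Fin d → ℂ} (h : Prec A α β) (h' : Prec A β γ) : Prec A α γ :=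
  fun τ hτ => (h τ hτ).trans (h' τ hτ)

/-- The class of `α` is annihilated by `P`: every component `q` of degree `a` of `P` vanishes at
all `β` such that both `β` and `β + a` lie in the class of `α`. -/
def KillsClass (α : Fin d → ℂ) (P : diffOps (semigpAlgebra A)) : Prop :=
  ∀ a q, IsComponent P a q → ∀ β, Prec A α β → Prec A β α → Prec A α (β + castVec ℂ a) →
    Prec A (β + castVec ℂ a) α → eval β q = 0

section KillsClass

variable {α : Fin d → ℂ} {P Q : diffOps (semigpAlgebra A)}

theorem killsClass_of_components (hA : AddSubgroup.closure (A : Set (Fin d → ℤ)) = ⊤)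
    (h : ∀ a, ∃ q, IsComponent P a q ∧ ∀ β, Prec A α β → Prec A β α →
      Prec A α (β + castVec ℂ a) → Prec A (β + castVec ℂ a) α → eval β q = 0) :
    KillsClass α P := by
  intro a q hq
  obtain ⟨q', hq', h⟩ := h a
  rwa [hq.unique hA hq']

theorem KillsClass.add (hA : AddSubgroup.closure (A : Set (Fin d → ℤ)) = ⊤)
    (hP : KillsClass α P) (hQ : KillsClass α Q) : KillsClass α (P + Q) := by
  refine killsClass_of_components hA fun a => ?_
  obtain ⟨p, hp⟩ := exists_component hA P a
  obtain ⟨q, hq⟩ := exists_component hA Q a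
  refine ⟨p + q, fun b hb => ?_, fun β h1 h2 h3 h4 => ?_⟩
  · rw [map_add, ← hp b hb, ← hq b hb, ← map_add]; rfl
  · rw [map_add, hP a p hp β h1 h2 h3 h4, hQ a q hq β h1 h2 h3 h4, add_zero]

theorem KillsClass.neg (hA : AddSubgroup.closure (A : Set (Fin d → ℤ)) = ⊤)
    (hP : KillsClass α P) : KillsClass α (-P) := by
  refine killsClass_of_components hA fun a => ?_
  obtain ⟨p, hp⟩ := exists_component hA P a
  refine ⟨-p, fun b hb => ?_, fun β h1 h2 h3 h4 => ?_⟩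
  · rw [map_neg, ← hp b hb, ← map_neg]; rfl
  · rw [map_neg, hP a p hp β h1 h2 h3 h4, neg_zero]

/-- A nonzero term of the product at `β` gives `β ⪯ β + e ⪯ β + a`. With both ends in the class, so
is `β + e`; both factors then move within the class, and one of them was assumed to vanish there. -/
theorem killsClass_mul (hA : AddSubgroup.closure (A : Set (Fin d → ℤ)) = ⊤)
    (h : KillsClass α P ∨ KillsClass α Q) : KillsClass α (Q * P) := by
  choose p hp using exists_component hA P
  choose q hq using exists_component hA Q
  refine killsClass_of_components hA fun a => ?_
  obtain ⟨F, hF⟩ := exists_isComponent_mul Q P hp hq a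
  refine ⟨_, hF, fun β h1 h2 h3 h4 => ?_⟩
  rw [map_sum]
  refine Finset.sum_eq_zero fun e _ => ?_
  rw [map_mul, eval_shiftPoly]
  by_contra hne
  obtain ⟨hqe, hpe⟩ := mul_ne_zero_iff.mp hne
  have hadd : β + castVec ℂ e + castVec ℂ (a - e) = β + castVec ℂ a := by
    rw [add_assoc, ← map_add, add_sub_cancel]
  have h5 : Prec A β (β + castVec ℂ e) := (IsComponent.vanishesOnGap (hp e)).prec hpe
  have h6 := (IsComponent.vanishesOnGap (hq (a - e))).prec hqe
  have h7 : Prec A (β + castVec ℂ e) α := h6.trans (by rwa [hadd])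
  rcases h with h | h
  · exact hpe (h e _ (hp e) β h1 h2 (h1.trans h5) h7)
  · exact hqe (h (a - e) _ (hq _) _ (h1.trans h5) h7 (by rwa [hadd]) (by rwa [hadd]))

end KillsClass

/-- The two-sided ideal of the operators that annihilate the class of `α`. -/
def killIdeal (hA : AddSubgroup.closure (A : Set (Fin d → ℤ)) = ⊤) (α : Fin d → ℂ) :
    TwoSidedIdeal (diffOps (semigpAlgebra A)) :=
  TwoSidedIdeal.mk' {P | KillsClass α P}
    (killsClass_of_components hA fun _ => ⟨0, fun b _ => by simp, fun _ _ _ _ _ => map_zero _⟩)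
    (fun hP hQ => KillsClass.add hA hP hQ) (fun hP => KillsClass.neg hA hP)
    (fun hP => killsClass_mul hA (.inl hP)) (fun hP => killsClass_mul hA (.inr hP))

theorem mem_killIdeal (hA : AddSubgroup.closure (A : Set (Fin d → ℤ)) = ⊤) {α : Fin d → ℂ}
    {P : diffOps (semigpAlgebra A)} : P ∈ killIdeal hA α ↔ KillsClass α P :=
  TwoSidedIdeal.mem_mk' ..

/-- If `f` vanishes on the class, its weight operator lies in `killIdeal`. The identity does not,
its degree-0 component being the constant 1; so simplicity makes the ideal zero, and `f = 0`
follows. -/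
theorem dense_of_isSimpleRing (hA : AddSubgroup.closure (A : Set (Fin d → ℤ)) = ⊤)
    (h : IsSimpleRing (diffOps (semigpAlgebra A))) (α : Fin d → ℂ) : ClassIsZariskiDense A α := by
  intro f hf
  have hf' : weightOp A f ∈ killIdeal hA α := by
    refine (mem_killIdeal hA).mpr (killsClass_of_components hA fun a => ?_)
    by_cases ha : a = 0
    · subst ha
      exact ⟨f, isComponent_polyOp _, fun β h1 h2 _ _ => hf β h1 h2⟩
    · exact ⟨0, isComponent_polyOp_of_ne _ ha, fun _ _ _ _ _ => map_zero _⟩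
  have hrefl : Prec A α α := fun _ _ => subset_rfl
  have hone : (1 : diffOps (semigpAlgebra A)) ∉ killIdeal hA α := fun hmem => by
    have h1 : IsComponent (weightOp A 1) 0 1 := isComponent_polyOp _
    rw [weightOp_one] at h1
    have := (mem_killIdeal hA).mp hmem 0 1 h1 α hrefl hrefl (by simpa using hrefl)
      (by simpa using hrefl)
    simp at this
  have hbot : killIdeal hA α = ⊥ :=
    (eq_bot_or_eq_top _).resolve_right fun htop => hone (by rw [htop]; trivial)
  rw [hbot, TwoSidedIdeal.mem_bot] at hf'
  have h1 : IsComponent (weightOp A f) 0 f := isComponent_polyOp _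
  rw [hf', ← weightOp_zero] at h1
  exact h1.unique hA (isComponent_polyOp _)

end

end ToricDiff

theorem mainTheorem4 (d : ℕ) (A : Finset (Fin d → ℤ))
    (hA : AddSubgroup.closure (A : Set (Fin d → ℤ)) = ⊤) :
    IsSimpleRing (ToricDiff.diffOps (ToricDiff.semigpAlgebra A)) ↔
      ((∀ C : Quotient (ToricDiff.paramSetoid A), ToricDiff.IsExtremeClass A C) ∧
        (∀ α : Fin d → ℂ, (ToricDiff.openCone A α).Nonempty)) := by
  rw [ToricDiff.conditions_iff_forall_dense hA]
  exact ⟨ToricDiff.dense_of_isSimpleRing hA, ToricDiff.isSimpleRing_of_dense hA⟩
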